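/- **Setting.** Let $n\ge 1$ and let $\Omega\subset\mathbb R^n$ be a bounded, connected, nonempty open set with $\operatorname{int}\overline\Omega=\Omega$. Let $\mathcal F$ be a finite forest of rooted trees with node set $\mathcal N$ and edge set $\mathcal E$: every tree has exactly one root, and roots have degree one. The set of roots is the disjoint union of the Dirichlet roots $\mathcal N_D$ and the Neumann roots $\mathcal N_N$, and $\mathcal N_D\neq\emptyset$. Let $\mathcal N_T$ be the set of terminals, i.e. of the leaves that are not roots, and $\mathcal N_i$ the set of neighbours of the node $i$. Let $\sigma,C_{k^S}\in\mathbb R$ and $c_D,c_N,c_{k^S}>0$. *Coefficients.* Let $k^D:\Omega\to\mathbb R^{n\times n}$ be measurable and symmetric with $\xi\cdot k^D(x)\xi\ge c_D|\xi|^2$; let $k^N_e\ge c_N$ for $e\in\mathcal E$; for $i\in\mathcal N_T$ let $B_i\subseteq\Omega$ be measurable and $k^S_i$ measurable with $0\le k_i^S\le C_{k^S}$ on $B_i$ and $\int_{B_i}k_i^S\,dx\ge c_{k^S}$. For $\mathfrak q=[\boldsymbol q^D,q^S,q^N]$, where $q^S_i$ is a function on $B_i$ (extended by zero) and $q^N_{i,j}=-q^N_{j,i}$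 is the flow along the edge $e(i,j)$, put $\mathfrak D\cdot\mathfrak q=[u^D,u^N]$ with $$u^D=\nabla\cdot\boldsymbol q^D-\sum_{i\in\mathcal N_T}k_i^Sq_i^S,\qquad u^N_i=\begin{cases}-\sum_{j\in\mathcal N_i}q^N_{j,i}, & i\in\mathcal N\setminus(\mathcal N_D\cup\mathcal N_T),\\ \int_{B_i}k_i^Sq_i^S\,dx-\sum_{j\in\mathcal N_i}q^N_{j,i}, & i\in\mathcal N_T.\end{cases}$$ On $L^2(\mathfrak B)=L^2(\Omega)\times\ell^2(\mathcal N\setminus\mathcal N_D)$ let $(\mathfrak p,\mathfrak w)=\int_\Omega p^Dw^D\,dx+\sum_{i\in\mathcal N\setminus\mathcal N_D}p^N_iw^N_i$ and $\|\mathfrak p\|_{L^2(\mathfrak B)}^2=(\mathfrak p,\mathfrak p)$. Let $$(\mathfrak q,\mathfrak v)_{\mathfrak K^{-1}}=\int_\Omega (k^D)^{-1}\boldsymbol q^D\cdot\boldsymbol v^D\,dx+\sum_{i\in\mathcal N_T}\int_{B_i}q_i^Sv_i^S\,dx+\sum_{e(i,j)\in\mathcal E}(k^N_{e(i,j)})^{-1}q^N_{i,j}v^N_{i,j},$$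 $$\|\mathfrak q\|_{H(\operatorname{div},\mathfrak B)}^2=(\mathfrak q,\mathfrak q)_{\mathfrak K^{-1}}+\|\mathfrak D\cdot\mathfrak q\|_{L^2(\mathfrak B)}^2 .$$ *Discretization.* Let $\mathcal M$ be a finite conforming mesh of $\Omega$ consisting of nondegenerate simplices and/or parallelepipeds: the closed cells cover $\overline\Omega$, and any two distinct cells meet in a common proper face (possibly empty). Assume that $\mathcal M$ is shape regular with constant $\sigma$: each cell $\tau$ contains a ball of some radius $r>0$ with $\operatorname{diam}\tau\le\sigma r$. Let $P_0(\mathcal M)$ be the space of cellwise constants; let $H_{h,0}(\operatorname{div},\mathcal M)$ be the lowest-order Raviart–Thomas space RT0 on $\mathcal M$ with zero normal component on $\partial\Omega$; and let $P_0(\mathcal M_i)$ be the space of functions on $B_i$ that are constant on each $\tau\cap B_i$, $\tau\in\mathcal M$ (functions being identified if they agree almost everywhere). Put $$H_{h,0}(\operatorname{div},\mathfrak B)=H_{h,0}(\operatorname{div},\mathcal M)\times\prod_{i\in\mathcal N_T}P_0(\mathcal M_i)\times\ell^2(\mathcal E),\qquad \mathfrak L_h^2=P_0(\mathcal M)\times\ell^2(\mathcal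 N\setminus\mathcal N_D).$$ **Theorem.** There are constants $\beta,C>0$ that depend only on $n$, $\Omega$, $\mathcal F$ (with its sets of Dirichlet and Neumann roots), $\sigma$, $c_D$, $c_N$, $c_{k^S}$ and $C_{k^S}$ (in particular not on the mesh size, nor otherwise on the mesh, the regions $B_i$ or the coefficients) such that, for all $\mathcal M$, $k^D$, $k^N$, $B_i$, $k^S_i$ as above, the following hold. 1. (Discrete inf-sup condition.) For all $\mathfrak s_h\in\mathfrak L_h^2$, $$\sup_{0\ne\mathfrak q_h\in H_{h,0}(\operatorname{div},\mathfrak B)}\frac{(\mathfrak s_h,\mathfrak D\cdot\mathfrak q_h)}{\|\mathfrak q_h\|_{H(\operatorname{div},\mathfrak B)}}\ge\beta\|\mathfrak s_h\|_{L^2(\mathfrak B)}.$$ 2. (Well-posedness.) For every $\mathfrak r\in L^2(\mathfrak B)$ there is exactly one pair $(\mathfrak q_h,\mathfrak p_h)\in H_{h,0}(\operatorname{div},\mathfrak B)\times\mathfrak L_h^2$ with $$(\mathfrak q_h,\mathfrak v_h)_{\mathfrak K^{-1}}-(\mathfrak p_h,\mathfrak D\cdot\mathfrak v_h)=0\quad\forall\,\mathfrak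 v_h\in H_{h,0}(\operatorname{div},\mathfrak B),\qquad -(\mathfrak D\cdot\mathfrak q_h,\mathfrak w_h)=-(\mathfrak r,\mathfrak w_h)\quad\forall\,\mathfrak w_h\in\mathfrak L_h^2,$$ and it satisfies $$\|\mathfrak q_h\|_{H(\operatorname{div},\mathfrak B)}+\|\mathfrak p_h\|_{L^2(\mathfrak B)}\le C\,\|\mathfrak r\|_{L^2(\mathfrak B)}.$$ -/

import Mathlib

namespace MixedDim

open MeasureTheory

noncomputable section

/-- `ℝⁿ` with its Euclidean norm. -/
abbrev E (n : ℕ) : Type := EuclideanSpace ℝ (Fin n)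

/-! ### The forest -/

/-- A finite forest of rooted trees: every tree (connected component) has exactly one root, roots
have degree one, and every root is either a Dirichlet root or a Neumann root. -/
structure RootedForest (V : Type*) [Fintype V] [DecidableEq V] where
  graph : SimpleGraph V
  acyclic : graph.IsAcyclic
  dirichlet : Finset V
  neumann : Finset V
  disjoint : Disjoint dirichlet neumann
  existsUnique_root : ∀ c : graph.ConnectedComponent,
    ∃! v, v ∈ dirichlet ∪ neumann ∧ graph.connectedComponentMk v = c
  root_degree : ∀ v ∈ dirichlet ∪ neumann, (graph.neighborSet v).ncard = 1

namespace RootedForest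

variable {V : Type*} [Fintype V] [DecidableEq V] (F : RootedForest V)

open Classical in
/-- Terminal nodes: the leaves that are not roots. -/
def terminals : Finset V :=
  Finset.univ.filter fun v => v ∉ F.dirichlet ∪ F.neumann ∧ (F.graph.neighborSet v).ncard = 1

/-- The nodes `𝒩 \ 𝒩_D` that carry a pressure unknown. -/
abbrev FreeNode : Type _ := {i : V // i ∉ F.dirichlet}

/-- Edge fluxes `q i j` (flow from `i` to `j`): one unknown per edge, with `q j i = - q i j`. -/
def edgeFlux : Submodule ℝ (V → V → ℝ) where
  carrier := {q | (∀ i j, q j i = - q i j) ∧ ∀ i j, ¬ F.graph.Adj i j → q i j = 0}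
  zero_mem' := by simp
  add_mem' := by
    rintro a b ⟨ha, ha'⟩ ⟨hb, hb'⟩
    refine ⟨fun i j => ?_, fun i j h => ?_⟩
    · simp only [Pi.add_apply, ha i j, hb i j]; ring
    · simp [ha' i j h, hb' i j h]
  smul_mem' := by
    rintro c a ⟨ha, ha'⟩
    refine ⟨fun i j => ?_, fun i j h => ?_⟩
    · simp [ha i j]
    · simp [ha' i j h]

end RootedForest

/-! ### Mesh cells: affine images of the reference simplex and of the reference cube -/

inductive CellKind
  | simplex
  | parallelepiped

/-- The closed reference cell. -/
def CellKind.ref (n : ℕ) : CellKind → Set (E n)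
  | .simplex => {x | (∀ i, 0 ≤ x i) ∧ ∑ i, x i ≤ 1}
  | .parallelepiped => {x | ∀ i, 0 ≤ x i ∧ x i ≤ 1}

/-- The facets (faces of codimension one) of the reference cell. -/
def CellKind.refFacets (n : ℕ) : CellKind → Set (Set (E n))
  | .simplex => {G | (∃ i, G = {x | x ∈ CellKind.simplex.ref n ∧ x i = 0}) ∨
      G = {x | x ∈ CellKind.simplex.ref n ∧ ∑ i, x i = 1}}
  | .parallelepiped => {G | ∃ i, G = {x | x ∈ CellKind.parallelepiped.ref n ∧ x i = 0} ∨
      G = {x | x ∈ CellKind.parallelepiped.ref n ∧ x i = 1}}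

/-- The lowest-order Raviart-Thomas fields on the reference cell: `a + b x` with `b` a scalar on
the simplex, and fields whose `i`-th component is `a i + b i * x i` on the cube. -/
def CellKind.IsRefRT0 {n : ℕ} : CellKind → (E n → E n) → Prop
  | .simplex, q => ∃ (a : E n) (b : ℝ), ∀ x, q x = a + b • x
  | .parallelepiped, q => ∃ a b : Fin n → ℝ, ∀ x i, q x i = a i + b i * x i

/-- A nondegenerate simplex or parallelepiped, parametrized over the reference cell. -/
structure Cell (n : ℕ) where
  kind : CellKind
  map : E n ≃ᵃ[ℝ] E n

namespace Cell

variable {n : ℕ} (K : Cell n)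

/-- The closed cell. -/
def carrier : Set (E n) := K.map '' K.kind.ref n

def facets : Set (Set (E n)) := (fun G => K.map '' G) '' K.kind.refFacets n

/-- Proper faces of all dimensions, the empty one included: the intersections of facets. -/
def IsFace (G : Set (E n)) : Prop := ∃ S ⊆ K.facets, S.Nonempty ∧ G = ⋂₀ S

/-- The local space `RT₀(K)`: Piola transforms of the reference fields (the constant factor
`1 / det` does not change the space). Its elements are polynomial fields on all of `ℝⁿ`, which are
determined by their restriction to the cell. -/
def rt0 : Submodule ℝ (E n → E n) where
  carrier := {q | ∃ p, K.kind.IsRefRT0 p ∧ ∀ x, q x = K.map.linear (p (K.map.symm x))}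
  zero_mem' := by
    refine ⟨fun _ => 0, ?_, by simp⟩
    cases K.kind
    · exact ⟨0, 0, by simp⟩
    · exact ⟨0, 0, by simp⟩
  add_mem' := by
    rintro q q' ⟨p, hp, h⟩ ⟨p', hp', h'⟩
    refine ⟨p + p', ?_, fun x => by simp [h x, h' x]⟩
    cases hk : K.kind
    · rw [hk] at hp hp'
      obtain ⟨a, b, hab⟩ := hp
      obtain ⟨a', b', hab'⟩ := hp'
      refine ⟨a + a', b + b', fun x => ?_⟩
      simp only [Pi.add_apply, hab x, hab' x, add_smul]
      abel
    · rw [hk] at hp hp'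
      obtain ⟨a, b, hab⟩ := hp
      obtain ⟨a', b', hab'⟩ := hp'
      refine ⟨a + a', b + b', fun x i => ?_⟩
      simp only [Pi.add_apply, PiLp.add_apply, hab x, hab' x]
      ring
  smul_mem' := by
    rintro c q ⟨p, hp, h⟩
    refine ⟨c • p, ?_, fun x => by simp [h x]⟩
    cases hk : K.kind
    · rw [hk] at hp
      obtain ⟨a, b, hab⟩ := hp
      refine ⟨c • a, c * b, fun x => ?_⟩
      simp only [Pi.smul_apply, hab x, smul_add, mul_smul]
    · rw [hk] at hp
      obtain ⟨a, b, hab⟩ := hp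
      refine ⟨c • a, c • b, fun x i => ?_⟩
      simp only [Pi.smul_apply, PiLp.smul_apply, hab x, smul_eq_mul]
      ring

end Cell

/-! ### Meshes and the discrete spaces on them -/

/-- `ν` is orthogonal to the flat set `G`. -/
def IsNormalTo {n : ℕ} (G : Set (E n)) (ν : E n) : Prop :=
  ∀ x ∈ G, ∀ y ∈ G, inner ℝ ν (x - y) = 0

/-- A conforming mesh of `Ω`: finitely many cells that cover the closure of `Ω`, such that two
distinct cells meet in a common proper face (possibly empty). -/
structure Mesh {n : ℕ} (Ω : Set (E n)) where
  N : ℕ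
  cell : Fin N → Cell n
  iUnion_cell : ⋃ τ, (cell τ).carrier = closure Ω
  conforming : ∀ τ τ', τ ≠ τ' →
    (cell τ).IsFace ((cell τ).carrier ∩ (cell τ').carrier) ∧
    (cell τ').IsFace ((cell τ).carrier ∩ (cell τ').carrier)

namespace Mesh

variable {n : ℕ} {Ω : Set (E n)} (M : Mesh Ω)

/-- Shape regularity: the diameter of each cell is at most `σ` times the radius of an inscribed
ball. -/
def ShapeRegular (σ : ℝ) : Prop :=
  ∀ τ, ∃ x r, 0 < r ∧ Metric.closedBall x r ⊆ (M.cell τ).carrier ∧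
    Metric.diam (M.cell τ).carrier ≤ σ * r

/-- `H_{h,0}(div, 𝓜)`: fields that are `RT₀` on every cell, whose normal component is continuous
across the facets shared by two cells and vanishes on the facets in `∂Ω`. A field is given by its
restrictions `q τ` to the cells. -/
def rt0Zero : Submodule ℝ (Fin M.N → E n → E n) where
  carrier := {q | (∀ τ, q τ ∈ (M.cell τ).rt0) ∧
    (∀ τ τ', ∀ G ∈ (M.cell τ).facets, G ∈ (M.cell τ').facets →
      ∀ ν, IsNormalTo G ν → ∀ x ∈ G, inner ℝ (q τ x) ν = inner ℝ (q τ' x) ν) ∧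
    (∀ τ, ∀ G ∈ (M.cell τ).facets, G ⊆ frontier Ω →
      ∀ ν, IsNormalTo G ν → ∀ x ∈ G, inner ℝ (q τ x) ν = 0)}
  zero_mem' := ⟨fun τ => (M.cell τ).rt0.zero_mem, by simp, by simp⟩
  add_mem' := by
    rintro a b ⟨ha, ha', ha''⟩ ⟨hb, hb', hb''⟩
    refine ⟨fun τ => (M.cell τ).rt0.add_mem (ha τ) (hb τ), ?_, ?_⟩
    · intro τ τ' G hG hG' ν hν x hx
      simp only [Pi.add_apply, inner_add_left, ha' τ τ' G hG hG' ν hν x hx,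
        hb' τ τ' G hG hG' ν hν x hx]
    · intro τ G hG hG' ν hν x hx
      simp only [Pi.add_apply, inner_add_left, ha'' τ G hG hG' ν hν x hx,
        hb'' τ G hG hG' ν hν x hx, add_zero]
  smul_mem' := by
    rintro c a ⟨ha, ha', ha''⟩
    refine ⟨fun τ => (M.cell τ).rt0.smul_mem c (ha τ), ?_, ?_⟩
    · intro τ τ' G hG hG' ν hν x hx
      simp only [Pi.smul_apply, inner_smul_left, ha' τ τ' G hG hG' ν hν x hx]
    · intro τ G hG hG' ν hν x hx
      simp only [Pi.smul_apply, inner_smul_left, ha'' τ G hG hG' ν hν x hx, mul_zero]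

open Classical in
/-- The cells of the restricted mesh `𝓜 ∩ B`, i.e. the `τ` for which `τ ∩ B` is not negligible. -/
def restrict (B : Set (E n)) : Finset (Fin M.N) :=
  Finset.univ.filter fun τ => volume ((M.cell τ).carrier ∩ B) ≠ 0

/-- The function on `Ω` given by cellwise functions (set to zero on the skeleton, a null set). -/
def glue {X : Type*} [AddCommMonoid X] (f : Fin M.N → E n → X) (x : E n) : X :=
  ∑ τ, (interior (M.cell τ).carrier).indicator (f τ) x

/-- The function on `B` given by its constant values on the cells `τ ∩ B` of `𝓜 ∩ B`. -/
def glueOn (B : Set (E n)) (c : M.restrict B → ℝ) (x : E n) : ℝ :=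
  ∑ τ : M.restrict B, (interior (M.cell τ.1).carrier ∩ B).indicator (fun _ => c τ) x

end Mesh

/-! ### Mixed-dimensional functions and operators -/

section Operators

variable {V : Type*} [Fintype V] [DecidableEq V]

/-- The material data: permeability `kD`, edge conductivities `kN`, and for each terminal the
region `B i` and the square root `kS i` of the transfer coefficient (used on `B i` only). -/
structure Coefficients (n : ℕ) (F : RootedForest V) where
  kD : E n → Matrix (Fin n) (Fin n) ℝ
  kN : Sym2 V → ℝ
  B : F.terminals → Set (E n)
  kS : F.terminals → E n → ℝ

structure Coefficients.Admissible {n : ℕ} {F : RootedForest V} (K : Coefficients n F)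
    (Ω : Set (E n)) (cD cN cS CS : ℝ) : Prop where
  kD_measurable : ∀ a b, Measurable fun x => K.kD x a b
  kD_symm : ∀ x ∈ Ω, (K.kD x).IsSymm
  kD_lower : ∀ x ∈ Ω, ∀ ξ : E n, cD * ‖ξ‖ ^ 2 ≤ inner ℝ ξ (Matrix.toEuclideanLin (K.kD x) ξ)
  kN_lower : ∀ e ∈ F.graph.edgeSet, cN ≤ K.kN e
  B_measurable : ∀ i, MeasurableSet (K.B i)
  B_subset : ∀ i, K.B i ⊆ Ω
  kS_measurable : ∀ i, Measurable (K.kS i)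
  kS_nonneg : ∀ i, ∀ x ∈ K.B i, 0 ≤ K.kS i x
  kS_le : ∀ i, ∀ x ∈ K.B i, K.kS i x ≤ CS
  kS_integral : ∀ i, cS ≤ ∫ x in K.B i, K.kS i x

/-- Mixed-dimensional pressures `[p^D, p^N]`. -/
abbrev Pressure (n : ℕ) (F : RootedForest V) : Type _ := (E n → ℝ) × (F.FreeNode → ℝ)

/-- Mixed-dimensional (scaled) fluxes `[q^D, q^S, q^N]`. -/
abbrev Flux (n : ℕ) (F : RootedForest V) : Type _ :=
  (E n → E n) × (F.terminals → E n → ℝ) × (V → V → ℝ)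

/-- The inner product of `L²(𝔅)`. -/
def l2Inner {n : ℕ} {F : RootedForest V} (Ω : Set (E n)) (p w : Pressure n F) : ℝ :=
  (∫ x in Ω, p.1 x * w.1 x) + ∑ i, p.2 i * w.2 i

/-- The norm of `L²(𝔅)`. -/
def l2Norm {n : ℕ} {F : RootedForest V} (Ω : Set (E n)) (p : Pressure n F) : ℝ :=
  √(l2Inner Ω p p)

/-- The pointwise divergence. For a field that is smooth on each cell of a mesh and has continuous
normal components it is, almost everywhere, the distributional divergence. -/
def divergence {n : ℕ} (f : E n → E n) (x : E n) : ℝ :=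
  LinearMap.trace ℝ (E n) (fderiv ℝ f x : E n →ₗ[ℝ] E n)

open Classical in
/-- The (rescaled) mixed-dimensional divergence `𝔇 · [q^D, q^S, q^N]`. -/
def mdDiv {n : ℕ} {F : RootedForest V} (K : Coefficients n F) (q : Flux n F) : Pressure n F :=
  (fun x => divergence q.1 x - ∑ i, (K.B i).indicator (fun y => K.kS i y * q.2.1 i y) x,
   fun i => (if h : i.1 ∈ F.terminals then ∫ x in K.B ⟨i.1, h⟩, K.kS ⟨i.1, h⟩ x * q.2.1 ⟨i.1, h⟩ x
      else 0) - ∑ j with F.graph.Adj i.1 j, q.2.2 j i.1)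

open Classical in
/-- The inner product `(q, v)_{𝔎⁻¹}` (rescaled, so that `q^S` has unit weight). The factor `1 / 2`
is there because every edge appears as two ordered pairs. -/
def kInner {n : ℕ} {F : RootedForest V} (Ω : Set (E n)) (K : Coefficients n F)
    (q v : Flux n F) : ℝ :=
  (∫ x in Ω, inner ℝ (Matrix.toEuclideanLin (K.kD x)⁻¹ (q.1 x)) (v.1 x)) +
  (∑ i, ∫ x in K.B i, q.2.1 i x * v.2.1 i x) +
  1 / 2 * ∑ i, ∑ j with F.graph.Adj i j, (K.kN s(i, j))⁻¹ * q.2.2 i j * v.2.2 i j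

/-- The norm of `H(div, 𝔅)`. -/
def hdivNorm {n : ℕ} {F : RootedForest V} (Ω : Set (E n)) (K : Coefficients n F)
    (q : Flux n F) : ℝ :=
  √(kInner Ω K q q + l2Norm Ω (mdDiv K q) ^ 2)

/-! ### The finite-element discretization -/

/-- The space `H_{h,0}(div, 𝔅) = H_{h,0}(div, 𝓜) × ∏ P₀(𝓜 ∩ B i) × l²(ℰ)`. -/
abbrev DiscreteFlux {n : ℕ} {F : RootedForest V} {Ω : Set (E n)} (M : Mesh Ω)
    (K : Coefficients n F) : Type _ :=
  M.rt0Zero × ((i : F.terminals) → M.restrict (K.B i) → ℝ) × F.edgeFlux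

/-- The space `P₀(𝓜) × l²(𝒩 \ 𝒩_D)`. -/
abbrev DiscretePressure {n : ℕ} {Ω : Set (E n)} (M : Mesh Ω) (F : RootedForest V) : Type _ :=
  (Fin M.N → ℝ) × (F.FreeNode → ℝ)

/-- A discrete flux as a mixed-dimensional flux. -/
def DiscreteFlux.toFlux {n : ℕ} {F : RootedForest V} {Ω : Set (E n)} {M : Mesh Ω}
    {K : Coefficients n F} (q : DiscreteFlux M K) : Flux n F :=
  (M.glue q.1.1, fun i => M.glueOn (K.B i) (q.2.1 i), q.2.2.1)

/-- A discrete pressure as a mixed-dimensional pressure. -/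
def DiscretePressure.toPressure {n : ℕ} {F : RootedForest V} {Ω : Set (E n)} {M : Mesh Ω}
    (p : DiscretePressure M F) : Pressure n F :=
  (M.glue fun τ _ => p.1 τ, p.2)

/-- `(q, p)` solves the mixed finite-element problem with right-hand side `r`. -/
def IsDiscreteSolution {n : ℕ} {F : RootedForest V} {Ω : Set (E n)} (M : Mesh Ω)
    (K : Coefficients n F) (r : Pressure n F) (q : DiscreteFlux M K)
    (p : DiscretePressure M F) : Prop :=
  (∀ v : DiscreteFlux M K,
    kInner Ω K (DiscreteFlux.toFlux q) (DiscreteFlux.toFlux v) -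
      l2Inner Ω (DiscretePressure.toPressure p) (mdDiv K (DiscreteFlux.toFlux v)) = 0) ∧
  (∀ w : DiscretePressure M F,
    -l2Inner Ω (mdDiv K (DiscreteFlux.toFlux q)) (DiscretePressure.toPressure w) =
      -l2Inner Ω r (DiscretePressure.toPressure w))

end Operators

end

end MixedDim

/-! The inf-sup condition follows once every discrete pressure `s` has a discrete flux `q` with `(s,
𝔇·q) = ‖s‖²` and `‖q‖² ≤ C‖s‖²` (`exists_flux`). On the forest one looks for edge flows and terminal
exchange rates that produce the nodal values of `s` and have a prescribed total exchange. They exist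
by duality (`netMap_surjective`): a functional that annihilates all attainable data is constant
along edges, zero at Dirichlet roots and equal to one common number at all terminals. Every tree has
a terminal, so a single Dirichlet root makes the functional vanish. The total is chosen as `-∫ s^D`,
and the rates are realized by constants `q^S` on the regions `B i`. There remains an RT0 field with
zero normal component whose divergence is `s^D` plus the cell averages of the exchange; this datum
has mean zero by the choice of the total.

The heart is thus a right inverse of the discrete divergence that is bounded uniformly in the mesh
(`uniformRightInverse`). It is built on the mesh itself, without elliptic regularity or
interpolation. For `n ≥ 2` the flux through a facet is `w (p a - p b)`, where `p` solves a Laplace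
equation on the graph of cells with weights of order `h ^ (n - 2)`. The bound amounts to a Poincaré
inequality for cellwise constant functions. It is first proved in `L¹`: in a convex set the values
at two generic points differ by at most the jumps over the facets that the segment crosses, and the
pairs whose segment meets a ball of radius `ρ` have measure `O(ρ ^ (n - 1))`
(`lintegral_crossFn_le`, `osc_convex_le`). A connected `Ω` is reached by chaining through the cells
of one fixed mesh and through small balls (`oscBound_of_connected`). Applied to signed squares, the
`L¹` inequality gives the `L²` one (`exists_l2_poincare_of_l1`). For `n = 1` the right inverse is
the antiderivative.

Well-posedness is injectivity of a square linear system (`existsUnique_saddlePoint`). In the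
stability estimate, `𝔇·q` is in general not cellwise constant, because `k^S` is not, so it is no
admissible test function. One tests with its RT0 part instead and bounds the exchange term by the
energy (`stability`). -/

namespace MixedDim

open MeasureTheory
open scoped Pointwise

noncomputable section

/-! ### Volumes of simplices and prisms -/

/-- The standard simplex `{x ≥ 0, ∑ x ≤ 1}` in `ℝᵐ`. -/
def cornerSimplex (m : ℕ) : Set (Fin m → ℝ) := {y | (∀ i, 0 ≤ y i) ∧ ∑ i, y i ≤ 1}

theorem isClosed_cornerSimplex (m : ℕ) : IsClosed (cornerSimplex m) := by
  have : cornerSimplex m = (⋂ i, {y : Fin m → ℝ | 0 ≤ y i}) ∩ {y | ∑ i, y i ≤ 1} := by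
    ext y
    simp [cornerSimplex]
  rw [this]
  refine (isClosed_iInter fun i => isClosed_le continuous_const (continuous_apply i)).inter ?_
  exact isClosed_le (f := fun y : Fin m → ℝ => ∑ i, y i) (by fun_prop) continuous_const

theorem volume_cornerSimplex_slice (m : ℕ) {s : ℝ} (hs : 0 < s) :
    volume {y : Fin m → ℝ | (∀ i, 0 ≤ y i) ∧ ∑ i, y i ≤ s} =
      ENNReal.ofReal (s ^ m) * volume (cornerSimplex m) := by
  have : {y : Fin m → ℝ | (∀ i, 0 ≤ y i) ∧ ∑ i, y i ≤ s} = s • cornerSimplex m := by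
    ext y
    rw [Set.mem_smul_set_iff_inv_smul_mem₀ hs.ne']
    simp only [cornerSimplex, Set.mem_ofPred_eq, Pi.smul_apply, smul_eq_mul, ← Finset.mul_sum]
    refine and_congr (forall_congr' fun i => ?_) ?_
    · exact (mul_nonneg_iff_of_pos_left (inv_pos.2 hs)).symm
    · rw [inv_mul_le_iff₀ hs, mul_one]
  rw [this, Measure.addHaar_smul, abs_of_nonneg (by positivity)]
  simp

theorem lintegral_one_sub_pow (m : ℕ) :
    ∫⁻ t in Set.Ico (0 : ℝ) 1, ENNReal.ofReal ((1 - t) ^ m) = ENNReal.ofReal (1 / (m + 1)) := by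
  rw [← ofReal_integral_eq_lintegral_ofReal]
  · rw [integral_Ico_eq_integral_Ioc, ← intervalIntegral.integral_of_le zero_le_one]
    congr 1
    have := intervalIntegral.integral_comp_sub_left (a := 0) (b := 1) (fun x : ℝ => x ^ m) 1
    rw [this]
    simp
  · exact ((by fun_prop : Continuous fun t : ℝ => (1 - t) ^ m).integrableOn_Icc).mono_set
      Set.Ico_subset_Icc_self
  · filter_upwards [ae_restrict_mem measurableSet_Ico] with t ht
    exact pow_nonneg (by linarith [ht.2]) m

/-- Fubini in the first coordinate: the slice at height `t` is the simplex scaled by `1 - t`. Only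
this ratio of volumes matters later; it says that the unit prism over a coordinate facet has `m + 1`
times the volume of the simplex. -/
theorem volume_cornerSimplex_succ (m : ℕ) :
    volume (cornerSimplex (m + 1)) = ENNReal.ofReal (1 / (m + 1)) * volume (cornerSimplex m) := by
  let e := MeasurableEquiv.piFinSuccAbove (fun _ : Fin (m + 1) => ℝ) 0
  have he := volume_preserving_piFinSuccAbove (fun _ : Fin (m + 1) => ℝ) 0
  have h1 := he.symm.measure_preimage
    (isClosed_cornerSimplex (m + 1)).measurableSet.nullMeasurableSet
  rw [← h1]
  have hms : MeasurableSet (e.symm ⁻¹' cornerSimplex (m + 1)) :=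
    e.symm.measurable (isClosed_cornerSimplex (m + 1)).measurableSet
  change (volume.prod volume) _ = _
  rw [Measure.prod_apply hms]
  have h2 : ∀ t : ℝ, Prod.mk t ⁻¹' (e.symm ⁻¹' cornerSimplex (m + 1)) =
      if 0 ≤ t then {y : Fin m → ℝ | (∀ i, 0 ≤ y i) ∧ ∑ i, y i ≤ 1 - t} else ∅ := by
    intro t
    ext y
    have : y ∈ Prod.mk t ⁻¹' (e.symm ⁻¹' cornerSimplex (m + 1)) ↔
        (0 ≤ t ∧ ∀ i, 0 ≤ y i) ∧ t + ∑ i, y i ≤ 1 := by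
      have : e.symm (t, y) = Fin.cons t y := by
        simp [e, MeasurableEquiv.piFinSuccAbove, Fin.consEquiv]
      simp [cornerSimplex, this, Fin.forall_fin_succ, Fin.sum_univ_succ]
    rw [this]
    split_ifs with h
    · simp only [h, true_and, Set.mem_ofPred_eq]
      refine and_congr_right fun _ => ?_
      constructor <;> intro <;> linarith
    · simp [h]
  -- The null set `t = 1` is discarded, since the slice there is not a positive multiple of the
  -- simplex.
  have h3 : (fun t : ℝ => volume (Prod.mk t ⁻¹' (e.symm ⁻¹' cornerSimplex (m + 1)))) =ᵐ[volume]
      (Set.Ico (0 : ℝ) 1).indicator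
        fun t => ENNReal.ofReal ((1 - t) ^ m) * volume (cornerSimplex m) := by
    have : ∀ᵐ t : ℝ, t ≠ 1 := by simp [ae_iff]
    filter_upwards [this] with t ht
    rw [h2]
    by_cases h0 : 0 ≤ t
    · rw [if_pos h0]
      rcases lt_or_gt_of_ne ht with h | h
      · rw [Set.indicator_of_mem (Set.mem_Ico.2 ⟨h0, h⟩), volume_cornerSimplex_slice m (by linarith)]
      · rw [Set.indicator_of_notMem (fun h' => by linarith [h'.2])]
        have : {y : Fin m → ℝ | (∀ i, 0 ≤ y i) ∧ ∑ i, y i ≤ 1 - t} = ∅ := by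
          ext y
          simp only [Set.mem_ofPred_eq, Set.mem_empty_iff_false, iff_false, not_and, not_le]
          intro hy
          have := Finset.sum_nonneg fun i (_ : i ∈ Finset.univ) => hy i
          linarith
        simp [this]
    · rw [if_neg h0, Set.indicator_of_notMem (fun h' => h0 h'.1)]
      simp
  rw [lintegral_congr_ae h3, lintegral_indicator measurableSet_Ico, lintegral_mul_const' _ _
    ?_, lintegral_one_sub_pow]
  have : cornerSimplex m ⊆ Set.Icc 0 1 := by
    intro y hy
    refine ⟨fun i => hy.1 i, fun i => ?_⟩
    exact (Finset.single_le_sum (fun j _ => hy.1 j) (Finset.mem_univ i)).trans hy.2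
  exact ((measure_mono this).trans_lt isCompact_Icc.measure_lt_top).ne

theorem volume_cornerPrism (m : ℕ) (i : Fin (m + 1)) :
    volume {x : Fin (m + 1) → ℝ | (0 ≤ x i ∧ x i ≤ 1) ∧ (fun j => x (i.succAbove j)) ∈
      cornerSimplex m} = volume (cornerSimplex m) := by
  have he := volume_preserving_piFinSuccAbove (fun _ : Fin (m + 1) => ℝ) i
  have h1 := he.measure_preimage (s := Set.Icc (0 : ℝ) 1 ×ˢ cornerSimplex m)
    (measurableSet_Icc.prod (isClosed_cornerSimplex m).measurableSet).nullMeasurableSet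
  have h2 : (volume : Measure (ℝ × (Fin m → ℝ))) (Set.Icc (0 : ℝ) 1 ×ˢ cornerSimplex m) =
      volume (cornerSimplex m) := by
    change (volume.prod volume) _ = _
    rw [Measure.prod_prod]
    simp
  rw [← h2, ← h1]
  rfl

/-- The prism over `G` with axis `w`. -/
def prism {n : ℕ} (G : Set (E n)) (w : E n) : Set (E n) :=
  {y | ∃ x ∈ G, ∃ t ∈ Set.Icc (0 : ℝ) 1, y = x + t • w}

/-- A shear that fixes the directions of the hyperplane `g = 0` and sends `e` to `w` carries one
prism onto a translate of the other, and its determinant is `g.linear w`. The translation appears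
because the hyperplane need not contain the origin. Prism volumes take the place of facet areas
throughout, so no surface measure is needed. -/
theorem volume_prism_eq {n : ℕ} {G : Set (E n)} (g : E n →ᵃ[ℝ] ℝ) (hG : ∀ x ∈ G, g x = 0)
    {e : E n} (he : g.linear e = 1) (w : E n) :
    volume (prism G w) = ENNReal.ofReal |g.linear w| * volume (prism G e) := by
  let T : E n →ₗ[ℝ] E n := LinearMap.transvection g.linear (w - e)
  have hdet : LinearMap.det T = g.linear w := by
    simp [T, LinearMap.transvection.det, he]
  rw [← hdet, ← Measure.addHaar_image_linearMap,
    ← measure_preimage_add volume (g 0 • (e - w)) (T '' prism G e)]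
  congr 1
  have hT : ∀ x ∈ G, ∀ t : ℝ, T (x + t • e) = g 0 • (e - w) + (x + t • w) := by
    intro x hx t
    have hgx : g.linear x = - g 0 := by
      have := congrFun g.decomp x
      simp only [Pi.add_apply, hG x hx] at this
      linarith
    simp only [T, LinearMap.transvection.apply, map_add, map_smul, hgx, he]
    module
  ext y
  constructor
  · rintro ⟨x, hx, t, ht, rfl⟩
    refine ⟨x + t • e, ⟨x, hx, t, ht, rfl⟩, ?_⟩
    exact hT x hx t
  · rintro ⟨_, ⟨x, hx, t, ht, rfl⟩, hy⟩
    refine ⟨x, hx, t, ht, ?_⟩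
    rw [hT x hx] at hy
    exact (add_left_cancel hy).symm

theorem prism_image {n : ℕ} (A : E n ≃ᵃ[ℝ] E n) (G : Set (E n)) (w : E n) :
    A '' prism G w = prism (A '' G) (A.linear w) := by
  have h : ∀ (x : E n) (t : ℝ), A (x + t • w) = A x + t • A.linear w := by
    intro x t
    have := A.map_vadd x (t • w)
    simp only [vadd_eq_add, map_smul] at this
    rw [add_comm x, this, add_comm]
  ext y
  constructor
  · rintro ⟨_, ⟨x, hx, t, ht, rfl⟩, rfl⟩
    exact ⟨A x, ⟨x, hx, rfl⟩, t, ht, h x t⟩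
  · rintro ⟨_, ⟨x, hx, rfl⟩, t, ht, rfl⟩
    exact ⟨_, ⟨x, hx, t, ht, rfl⟩, h x t⟩

theorem volume_image_affineEquiv {n : ℕ} (A : E n ≃ᵃ[ℝ] E n) (s : Set (E n)) :
    volume (A '' s) = ENNReal.ofReal |LinearMap.det (A.linear : E n →ₗ[ℝ] E n)| * volume s := by
  rw [← Measure.addHaar_image_linearMap, ← measure_preimage_add volume (A 0) (A '' s)]
  congr 1
  have h : ∀ x, A x = A 0 + A.linear x := by
    intro x
    have := A.map_vadd 0 x
    simp only [vadd_eq_add, add_zero] at this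
    rw [this, add_comm]
  ext y
  constructor
  · rintro ⟨x, hx, hxy⟩
    refine ⟨x, hx, ?_⟩
    rw [h x] at hxy
    exact add_left_cancel hxy
  · rintro ⟨x, hx, rfl⟩
    exact ⟨x, hx, by rw [h x]; rfl⟩

end

end MixedDim

namespace MixedDim

open MeasureTheory

noncomputable section

/-! ### Facets, facet normals and Raviart-Thomas basis fields of a cell -/

/-- A convex polytope `S` with facets `Fs`, cut out by affine functions `g i`, together with
dual basis fields `φ i` in the space `R`: the flux of `φ i` is nonzero through the facet `i` only. -/
structure FacetSystem {n : ℕ} (S : Set (E n)) (Fs : Set (Set (E n)))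
    (R : (E n → E n) → Prop) where
  ι : Type
  [fintype : Fintype ι]
  [decEq : DecidableEq ι]
  card_le : Fintype.card ι ≤ 2 * n
  g : ι → E n →ᵃ[ℝ] ℝ
  mem_iff : ∀ x, x ∈ S ↔ ∀ i, 0 ≤ g i x
  facets_eq : Fs = Set.range fun i => {x | x ∈ S ∧ g i x = 0}
  center : ι → E n
  g_center_self : ∀ i, g i (center i) = 0
  g_center_pos : ∀ i j, j ≠ i → 0 < g j (center i)
  φ : ι → E n →ᵃ[ℝ] E n
  φ_mem : ∀ i, R (φ i)
  -- The functions `g j` grow inwards, so `-1` is a unit outward flux density in the scale of `g j`.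
  φ_normal : ∀ i j x, g j x = 0 → (g j).linear (φ i x) = if i = j then -1 else 0
  -- This form is preserved by affine maps and bounds `φ i` on the cell by its diameter.
  φ_sub : ∀ i, ∀ x ∈ S, ∃ z ∈ S, φ i x = x - z
  -- The common divergence of the basis fields: `n` on a simplex, `1` on a parallelepiped.
  d : ℝ
  one_le_d : 1 ≤ d
  trace_φ : ∀ i, LinearMap.trace ℝ (E n) (φ i).linear = d
  axis : ι → E n
  g_axis : ∀ i, (g i).linear (axis i) = 1
  -- The divergence theorem for `φ i`: the left side is its flux through the facet `i`, the right
  -- side the integral of its divergence.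
  volume_prism_axis : ∀ i, volume (prism {x | x ∈ S ∧ g i x = 0} (axis i)) =
    ENNReal.ofReal d * volume S

attribute [instance] FacetSystem.fintype FacetSystem.decEq

/-- The `i`-th coordinate as an affine function. -/
def coordA {n : ℕ} (i : Fin n) : E n →ᵃ[ℝ] ℝ :=
  (EuclideanSpace.proj (𝕜 := ℝ) i).toLinearMap.toAffineMap

@[simp] theorem coordA_apply {n : ℕ} (i : Fin n) (x : E n) : coordA i x = x i := rfl

@[simp] theorem coordA_linear {n : ℕ} (i : Fin n) (x : E n) : (coordA i).linear x = x i := rfl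

theorem preimage_toLp_volume {n : ℕ} (s : Set (E n)) (hs : MeasurableSet s) :
    volume s = volume ((WithLp.toLp 2 : (Fin n → ℝ) → E n) ⁻¹' s) :=
  ((PiLp.volume_preserving_toLp (Fin n)).measure_preimage hs.nullMeasurableSet).symm

theorem measurableSet_simplex_ref (n : ℕ) : MeasurableSet (CellKind.simplex.ref n) := by
  have : CellKind.simplex.ref n =
      (WithLp.ofLp : E n → (Fin n → ℝ)) ⁻¹' cornerSimplex n := rfl
  rw [this]
  exact (isClosed_cornerSimplex n).measurableSet.preimage (WithLp.measurable_ofLp 2 _)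

theorem volume_simplex_prism {m : ℕ} (i : Fin (m + 1)) :
    volume (prism {x | x ∈ CellKind.simplex.ref (m + 1) ∧ coordA i x = 0}
      (EuclideanSpace.single i 1)) =
      ENNReal.ofReal ((m + 1 : ℕ) : ℝ) * volume (CellKind.simplex.ref (m + 1)) := by
  have h1 : volume (CellKind.simplex.ref (m + 1)) = volume (cornerSimplex (m + 1)) :=
    preimage_toLp_volume _ (measurableSet_simplex_ref _)
  let P : Set (E (m + 1)) := {x | (0 ≤ x i ∧ x i ≤ 1) ∧ (fun j => x (i.succAbove j)) ∈
      cornerSimplex m}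
  have hP : prism {x | x ∈ CellKind.simplex.ref (m + 1) ∧ coordA i x = 0}
      (EuclideanSpace.single i 1) = P := by
    ext y
    constructor
    · rintro ⟨x, ⟨⟨hx, hx'⟩, hxi⟩, t, ht, rfl⟩
      rw [coordA_apply] at hxi
      refine ⟨?_, ?_, ?_⟩
      · simpa [hxi] using ht
      · intro j
        simpa using hx (i.succAbove j)
      · rw [Fin.sum_univ_succAbove _ i, hxi, zero_add] at hx'
        simpa using hx'
    · rintro ⟨h0, h2, h3⟩
      refine ⟨y - y i • EuclideanSpace.single i 1, ⟨⟨?_, ?_⟩, ?_⟩, y i, h0, by simp⟩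
      · intro j
        rcases Fin.eq_self_or_eq_succAbove i j with rfl | ⟨j, rfl⟩
        · simp
        · simpa using h2 j
      · rw [Fin.sum_univ_succAbove _ i]
        simpa using h3
      · simp
  have hPm : MeasurableSet P := by
    have hi : Measurable fun x : E (m + 1) => x i := by fun_prop
    have hj : Measurable fun x : E (m + 1) => (fun j => x (i.succAbove j)) := by fun_prop
    exact (((measurableSet_Ici (a := (0 : ℝ))).preimage hi).inter
      ((measurableSet_Iic (a := (1 : ℝ))).preimage hi)).inter
      ((isClosed_cornerSimplex m).measurableSet.preimage hj)
  have h2 : volume P = volume (cornerSimplex m) := by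
    rw [preimage_toLp_volume P hPm]
    exact volume_cornerPrism m i
  rw [hP, h1, h2, volume_cornerSimplex_succ, ← mul_assoc, ← ENNReal.ofReal_mul (by positivity)]
  have : ((m + 1 : ℕ) : ℝ) * (1 / (m + 1)) = 1 := by
    push_cast
    field_simp
  rw [this]
  simp

/-- The sum of the coordinates. -/
def sumL (n : ℕ) : E n →ₗ[ℝ] ℝ := ∑ i, (EuclideanSpace.proj (𝕜 := ℝ) i).toLinearMap

@[simp] theorem sumL_apply {n : ℕ} (x : E n) : sumL n x = ∑ i, x i := by
  simp [sumL]

/-- The affine map of the reference simplex that exchanges the vertices `0` and `e i`. -/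
def swapVertex {n : ℕ} (i : Fin n) : E n ≃ᵃ[ℝ] E n :=
  AffineEquiv.ofBijective (φ := AffineMap.id ℝ (E n) +
    (AffineMap.const ℝ (E n) (EuclideanSpace.single i (1 : ℝ)) +
      ((-(sumL n + (EuclideanSpace.proj (𝕜 := ℝ) i).toLinearMap)).smulRight
        (EuclideanSpace.single i (1 : ℝ))).toAffineMap)) <| by
    apply Function.Involutive.bijective
    intro x
    ext j
    by_cases hj : j = i
    · subst hj
      simp [Finset.sum_add_distrib]
      ring
    · simp [hj]

theorem swapVertex_apply {n : ℕ} (i : Fin n) (x : E n) :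
    swapVertex i x = x + (1 - ∑ j, x j - x i) • EuclideanSpace.single i (1 : ℝ) := by
  simp only [swapVertex]
  ext j
  by_cases hj : j = i
  · subst hj
    simp
    ring
  · simp [hj]

theorem swapVertex_linear {n : ℕ} (i : Fin n) :
    ((swapVertex i).linear : E n →ₗ[ℝ] E n) =
      LinearMap.transvection (-(sumL n + (EuclideanSpace.proj (𝕜 := ℝ) i).toLinearMap))
        (EuclideanSpace.single i 1) := by
  ext x : 1
  have h := (swapVertex i).map_vadd 0 x
  simp only [vadd_eq_add, add_zero] at h
  have h2 : (swapVertex i).linear x = swapVertex i x - swapVertex i 0 := by rw [h]; abel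
  change (swapVertex i).linear x = _
  rw [h2, swapVertex_apply, swapVertex_apply, LinearMap.transvection.apply]
  ext j
  by_cases hj : j = i
  · subst hj
    simp
  · simp [hj]

theorem det_swapVertex {n : ℕ} (i : Fin n) :
    LinearMap.det ((swapVertex i).linear : E n →ₗ[ℝ] E n) = -1 := by
  rw [swapVertex_linear, LinearMap.transvection.det]
  simp

theorem swapVertex_facet {n : ℕ} (i : Fin n) :
    swapVertex i '' {x | x ∈ CellKind.simplex.ref n ∧ coordA i x = 0} =
      {x | x ∈ CellKind.simplex.ref n ∧ ∑ j, x j = 1} := by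
  have hs : ∀ x : E n, ∑ j, swapVertex i x j = 1 - x i := by
    intro x
    simp [swapVertex_apply, Finset.sum_add_distrib]
    ring
  have hi : ∀ x : E n, swapVertex i x i = 1 - ∑ j, x j := by
    intro x
    simp [swapVertex_apply]
  have hj : ∀ (x : E n) (j), j ≠ i → swapVertex i x j = x j := by
    intro x j hj
    simp [swapVertex_apply, hj]
  have hinv : ∀ x : E n, swapVertex i (swapVertex i x) = x := by
    intro x
    ext j
    by_cases h : j = i
    · subst h
      rw [hi, hs]; ring
    · rw [hj _ j h, hj _ j h]
  ext y
  constructor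
  · rintro ⟨x, ⟨⟨hx, hx'⟩, hxi⟩, rfl⟩
    rw [coordA_apply] at hxi
    refine ⟨⟨fun j => ?_, ?_⟩, ?_⟩
    · by_cases h : j = i
      · subst h
        rw [hi]; linarith
      · rw [hj _ j h]; exact hx j
    · rw [hs, hxi]; norm_num
    · rw [hs, hxi]; norm_num
  · rintro ⟨⟨hy, hy'⟩, hys⟩
    refine ⟨swapVertex i y, ⟨⟨fun j => ?_, ?_⟩, ?_⟩, hinv y⟩
    · by_cases h : j = i
      · subst h
        rw [hi]; linarith
      · rw [hj _ j h]; exact hy j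
    · rw [hs]; linarith [hy i]
    · rw [coordA_apply, hi, hys]; norm_num

/-- The oblique facet is the image of a coordinate facet under the exchange of two vertices, a map
of determinant `-1`; the volume is inherited from the coordinate case. -/
theorem volume_simplex_prism_sum {m : ℕ} (i : Fin (m + 1)) :
    volume (prism {x | x ∈ CellKind.simplex.ref (m + 1) ∧ ∑ j, x j = 1}
      (-EuclideanSpace.single i 1)) =
      ENNReal.ofReal ((m + 1 : ℕ) : ℝ) * volume (CellKind.simplex.ref (m + 1)) := by
  have : -EuclideanSpace.single i (1 : ℝ) =
      (swapVertex i).linear (EuclideanSpace.single i 1) := by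
    have h := LinearMap.congr_fun (swapVertex_linear i) (EuclideanSpace.single i 1)
    rw [LinearEquiv.coe_coe] at h
    rw [h, LinearMap.transvection.apply]
    simp only [LinearMap.neg_apply, LinearMap.add_apply, sumL_apply]
    simp
    module
  rw [this, ← swapVertex_facet i, ← prism_image, volume_image_affineEquiv, det_swapVertex,
    volume_simplex_prism]
  simp

end

end MixedDim

/-! ### Facet systems of the reference cells and of their affine images -/

namespace MixedDim

open MeasureTheory

noncomputable section

/-- The facet system of the reference simplex. -/
def simplexFacetSystem (m : ℕ) : FacetSystem (CellKind.simplex.ref (m + 1))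
    (CellKind.simplex.refFacets (m + 1)) CellKind.simplex.IsRefRT0 where
  ι := Option (Fin (m + 1))
  card_le := by simp [two_mul]
  g
    | none => AffineMap.const ℝ (E (m + 1)) (1 : ℝ) - (sumL (m + 1)).toAffineMap
    | some i => coordA i
  mem_iff x := by
    simp [CellKind.ref, Option.forall, and_comm]
  facets_eq := by
    ext G
    simp only [CellKind.refFacets, Set.mem_ofPred_eq, Set.mem_range, Option.exists]
    rw [or_comm]
    refine or_congr ?_ (exists_congr fun i => ?_)
    · have : {x : E (m + 1) | x ∈ CellKind.simplex.ref (m + 1) ∧ ∑ i, x i = 1} =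
          {x | x ∈ CellKind.simplex.ref (m + 1) ∧
            (AffineMap.const ℝ (E (m + 1)) (1 : ℝ) - (sumL (m + 1)).toAffineMap) x = 0} := by
        ext x
        simp [sub_eq_zero, @eq_comm ℝ 1]
      rw [this, eq_comm]
    · rw [eq_comm]
      rfl
  center
    | none => WithLp.toLp 2 fun _ => 1 / ((m : ℝ) + 1)
    | some i => WithLp.toLp 2 fun j => if j = i then 0 else 1 / ((m : ℝ) + 2)
  g_center_self i := by
    cases i
    · simp
      field_simp
      ring
    · simp
  g_center_pos i j hij := by
    rcases i with _ | i <;> rcases j with _ | j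
    · exact absurd rfl hij
    · simp
      positivity
    · simp [Finset.sum_ite, Finset.filter_ne', Finset.card_erase_of_mem]
      field_simp
      linarith
    · have : j ≠ i := fun h => hij (by rw [h])
      simp [this]
      positivity
  -- Each field is `x` minus the vertex opposite to the facet: it is tangential along every facet
  -- containing that vertex.
  φ
    | none => AffineMap.id ℝ (E (m + 1))
    | some i => AffineMap.id ℝ (E (m + 1)) -
        AffineMap.const ℝ (E (m + 1)) (EuclideanSpace.single i (1 : ℝ))
  φ_mem i := by
    rcases i with _ | i
    · exact ⟨0, 1, by simp⟩
    · exact ⟨-EuclideanSpace.single i 1, 1, fun x => by simp; abel⟩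
  φ_normal i j x hx := by
    rcases i with _ | i <;> rcases j with _ | j
    · simp [sub_eq_zero] at hx ⊢
      linarith
    · simpa using hx
    · simp [sub_eq_zero] at hx ⊢
      linarith
    · simp at hx
      by_cases h : i = j
      · subst h
        simp [hx]
      · have : j ≠ i := fun h' => h h'.symm
        simp [hx, h, this]
  φ_sub i x _ := by
    rcases i with _ | i
    · exact ⟨0, ⟨by simp, by simp⟩, by simp⟩
    · refine ⟨EuclideanSpace.single i 1, ⟨fun j => ?_, by simp⟩, by simp⟩
      by_cases h : j = i
      · subst h; simp
      · simp [h]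
  d := (m + 1 : ℕ)
  one_le_d := by simp
  trace_φ i := by
    have : Module.finrank ℝ (E (m + 1)) = m + 1 := by simp
    rcases i with _ | i
    · change LinearMap.trace ℝ (E (m + 1)) LinearMap.id = _
      rw [LinearMap.trace_id, this]
    · change LinearMap.trace ℝ (E (m + 1)) (LinearMap.id - 0) = _
      rw [sub_zero, LinearMap.trace_id, this]
  axis
    | none => -EuclideanSpace.single 0 (1 : ℝ)
    | some i => EuclideanSpace.single i (1 : ℝ)
  g_axis i := by
    rcases i with _ | i
    · simp
    · simp
  volume_prism_axis i := by
    rcases i with _ | i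
    · rw [← volume_simplex_prism_sum 0]
      congr 2
      ext x
      simp [sub_eq_zero, @eq_comm ℝ 1]
    · exact volume_simplex_prism i

theorem update_mem_cube {n : ℕ} {x : E n} (hx : x ∈ CellKind.parallelepiped.ref n) (i : Fin n)
    {t : ℝ} (ht : 0 ≤ t ∧ t ≤ 1) :
    x - (x i - t) • EuclideanSpace.single i (1 : ℝ) ∈ CellKind.parallelepiped.ref n := by
  intro j
  by_cases h : j = i
  · subst h
    simpa using ht
  · simpa [h] using hx j

/-- The facet system of the reference cube. -/
def cubeFacetSystem (n : ℕ) : FacetSystem (CellKind.parallelepiped.ref n)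
    (CellKind.parallelepiped.refFacets n) CellKind.parallelepiped.IsRefRT0 where
  ι := Fin n ⊕ Fin n
  card_le := by simp; omega
  g
    | .inl i => coordA i
    | .inr i => AffineMap.const ℝ (E n) (1 : ℝ) - coordA i
  mem_iff x := by
    simp [CellKind.ref, forall_and]
  facets_eq := by
    ext G
    simp only [CellKind.refFacets, Set.mem_ofPred_eq, Set.mem_range, Sum.exists, exists_or]
    refine or_congr (exists_congr fun i => ?_) (exists_congr fun i => ?_)
    · rw [eq_comm]
      rfl
    · have : {x : E n | x ∈ CellKind.parallelepiped.ref n ∧ x i = 1} =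
          {x | x ∈ CellKind.parallelepiped.ref n ∧
            (AffineMap.const ℝ (E n) (1 : ℝ) - coordA i) x = 0} := by
        ext x
        simp [sub_eq_zero, @eq_comm ℝ 1]
      rw [this, eq_comm]
  center
    | .inl i => WithLp.toLp 2 fun j => if j = i then 0 else 1 / 2
    | .inr i => WithLp.toLp 2 fun j => if j = i then 1 else 1 / 2
  g_center_self i := by
    rcases i with i | i <;> simp
  g_center_pos i j hij := by
    rcases i with i | i <;> rcases j with j | j
    · have : j ≠ i := fun h => hij (by rw [h])
      simp [this]
    · simp
      split_ifs <;> norm_num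
    · simp
      split_ifs <;> norm_num
    · have : j ≠ i := fun h => hij (by rw [h])
      simp [this]
      norm_num
  -- Only the `i`-th component is nonzero: `x i - 1` for the facet `x i = 0`, and `x i` for the
  -- facet `x i = 1`. It vanishes on the opposite facet.
  φ
    | .inl i => ((EuclideanSpace.proj (𝕜 := ℝ) i).toLinearMap.smulRight
        (EuclideanSpace.single i (1 : ℝ))).toAffineMap -
          AffineMap.const ℝ (E n) (EuclideanSpace.single i (1 : ℝ))
    | .inr i => ((EuclideanSpace.proj (𝕜 := ℝ) i).toLinearMap.smulRight
        (EuclideanSpace.single i (1 : ℝ))).toAffineMap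
  φ_mem i := by
    rcases i with i | i
    · refine ⟨fun j => if j = i then -1 else 0, fun j => if j = i then 1 else 0, fun x j => ?_⟩
      by_cases h : j = i
      · subst h
        simp
        ring
      · simp [h]
    · refine ⟨0, fun j => if j = i then 1 else 0, fun x j => ?_⟩
      by_cases h : j = i
      · subst h
        simp
      · simp [h]
  φ_normal i j x hx := by
    rcases i with i | i <;> rcases j with j | j <;> by_cases h : j = i
    · subst h
      simp at hx ⊢
      linarith
    · have : i ≠ j := fun h' => h h'.symm
      simp [h, this]
    · subst h
      simp [sub_eq_zero] at hx ⊢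
      linarith
    · simp [h]
    · subst h
      simpa using hx
    · simp [h]
    · subst h
      simp [sub_eq_zero] at hx ⊢
      linarith
    · have : i ≠ j := fun h' => h h'.symm
      simp [h, this]
  φ_sub i x hx := by
    rcases i with i | i
    · refine ⟨_, update_mem_cube hx i (t := 1) (by norm_num), ?_⟩
      simp [sub_smul]
    · refine ⟨_, update_mem_cube hx i (t := 0) (by norm_num), ?_⟩
      simp
  d := 1
  one_le_d := le_rfl
  trace_φ i := by
    have (j : Fin n) : LinearMap.trace ℝ (E n) ((EuclideanSpace.proj (𝕜 := ℝ) j).toLinearMap.smulRight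
        (EuclideanSpace.single j (1 : ℝ))) = 1 := by
      rw [LinearMap.trace_smulRight]
      simp
    rcases i with i | i
    · change LinearMap.trace ℝ (E n) (_ - 0) = _
      rw [sub_zero]
      exact this i
    · exact this i
  axis
    | .inl i => EuclideanSpace.single i (1 : ℝ)
    | .inr i => -EuclideanSpace.single i (1 : ℝ)
  g_axis i := by
    rcases i with i | i <;> simp
  volume_prism_axis i := by
    rw [ENNReal.ofReal_one, one_mul]
    congr 1
    rcases i with i | i
    · ext y
      constructor
      · rintro ⟨x, ⟨hx, hxi⟩, t, ht, rfl⟩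
        have := update_mem_cube hx i (t := t) ht
        simp only [coordA_apply] at hxi
        simpa [hxi] using this
      · intro hy
        refine ⟨_, ⟨update_mem_cube hy i (t := 0) (by norm_num), by simp⟩, y i, hy i, by simp⟩
    · ext y
      constructor
      · rintro ⟨x, ⟨hx, hxi⟩, t, ht, rfl⟩
        have := update_mem_cube hx i (t := 1 - t) ⟨by linarith [ht.2], by linarith [ht.1]⟩
        have hxi' : x i = 1 := by
          simpa [sub_eq_zero, @eq_comm ℝ 1] using hxi
        simpa [hxi', sub_eq_add_neg] using this
      · intro hy
        refine ⟨_, ⟨update_mem_cube hy i (t := 1) (by norm_num), by simp⟩, 1 - y i,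
          ⟨by linarith [(hy i).2], by linarith [(hy i).1]⟩, ?_⟩
        module

/-- Transport of a facet system along an affine isomorphism. -/
def FacetSystem.image {n : ℕ} {S : Set (E n)} {Fs : Set (Set (E n))} {R R' : (E n → E n) → Prop}
    (D : FacetSystem S Fs R) (A : E n ≃ᵃ[ℝ] E n)
    (hR : ∀ p, R p → R' fun x => A.linear (p (A.symm x))) :
    FacetSystem (A '' S) ((fun G => A '' G) '' Fs) R' where
  ι := D.ι
  card_le := D.card_le
  g i := (D.g i).comp A.symm.toAffineMap
  mem_iff x := by
    rw [← AffineEquiv.preimage_symm, Set.mem_preimage, D.mem_iff]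
    rfl
  facets_eq := by
    refine (congrArg _ D.facets_eq).trans ?_
    rw [← Set.range_comp]
    congr 1
    funext i
    ext x
    simp only [Function.comp, ← AffineEquiv.preimage_symm]
    rfl
  center i := A (D.center i)
  g_center_self i := by simpa using D.g_center_self i
  g_center_pos i j h := by simpa using D.g_center_pos i j h
  φ i := A.linear.toLinearMap.toAffineMap.comp ((D.φ i).comp A.symm.toAffineMap)
  φ_mem i := hR _ (D.φ_mem i)
  φ_normal i j x hx := by
    have h := D.φ_normal i j (A.symm x) hx
    simpa using h
  φ_sub i x hx := by
    obtain ⟨y, hy, rfl⟩ := hx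
    obtain ⟨z, hz, h⟩ := D.φ_sub i y hy
    refine ⟨A z, ⟨z, hz, rfl⟩, ?_⟩
    simp only [AffineMap.comp_apply, AffineEquiv.coe_toAffineMap, AffineEquiv.symm_apply_apply, h]
    exact A.toAffineMap.linearMap_vsub y z
  d := D.d
  one_le_d := D.one_le_d
  trace_φ i := by
    rw [← D.trace_φ i, ← LinearMap.trace_conj' (D.φ i).linear A.linear]
    rfl
  axis i := A.linear (D.axis i)
  g_axis i := by
    have h := D.g_axis i
    simpa using h
  volume_prism_axis i := by
    have : {x | x ∈ A '' S ∧ ((D.g i).comp A.symm.toAffineMap) x = 0} =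
        A '' {x | x ∈ S ∧ D.g i x = 0} := by
      ext x
      simp only [← AffineEquiv.preimage_symm]
      rfl
    rw [this, ← prism_image, volume_image_affineEquiv, volume_image_affineEquiv,
      D.volume_prism_axis i]
    ring

theorem Cell.nonempty_facetSystem {n : ℕ} (hn : 0 < n) (K : Cell n) :
    Nonempty (FacetSystem K.carrier K.facets fun q => q ∈ K.rt0) := by
  have hR : ∀ p, K.kind.IsRefRT0 p → (fun x => K.map.linear (p (K.map.symm x))) ∈ K.rt0 :=
    fun p hp => ⟨p, hp, fun _ => rfl⟩
  obtain ⟨m, rfl⟩ : ∃ m, n = m + 1 := ⟨n - 1, by omega⟩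
  have : Nonempty (FacetSystem (K.kind.ref (m + 1)) (K.kind.refFacets (m + 1))
      K.kind.IsRefRT0) := by
    cases K.kind
    · exact ⟨simplexFacetSystem m⟩
    · exact ⟨cubeFacetSystem (m + 1)⟩
  exact ⟨this.some.image K.map hR⟩

end

end MixedDim

/-! ### Local geometry of a facet, seen from one or from two cells -/

namespace MixedDim

open MeasureTheory

noncomputable section

theorem affine_add {n : ℕ} (g : E n →ᵃ[ℝ] ℝ) (x v : E n) : g (x + v) = g x + g.linear v := by
  have := g.map_vadd x v
  simp only [vadd_eq_add] at this
  rw [add_comm x, this, add_comm]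

theorem affine_continuous {n : ℕ} (g : E n →ᵃ[ℝ] ℝ) : Continuous g :=
  g.continuous_of_finiteDimensional

/-- Linear functionals with nested kernels are proportional. -/
theorem linear_eq_smul_of_ker {n : ℕ} {f h : E n →ₗ[ℝ] ℝ} {e : E n} (he : f e = 1)
    (hk : ∀ v, f v = 0 → h v = 0) (v : E n) : h v = h e * f v := by
  have := hk (v - f v • e) (by simp [he])
  simp only [map_sub, map_smul, smul_eq_mul] at this
  linarith

theorem linear_eq_zero_of_small {n : ℕ} {f : E n →ₗ[ℝ] ℝ} {ε : ℝ} (hε : 0 < ε) {v : E n}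
    (h : ∀ t : ℝ, ‖t • v‖ < ε → f (t • v) = 0) : f v = 0 := by
  have hp : 0 < ‖v‖ + 1 := by positivity
  have ht : ‖(ε / (2 * (‖v‖ + 1))) • v‖ < ε := by
    rw [norm_smul, Real.norm_of_nonneg (by positivity), div_mul_eq_mul_div, div_lt_iff₀ (by positivity)]
    nlinarith [norm_nonneg v]
  have := h _ ht
  rw [map_smul, smul_eq_mul] at this
  exact (mul_eq_zero.1 this).resolve_left (by positivity)

theorem volume_affine_zero {n : ℕ} (g : E n →ᵃ[ℝ] ℝ) (hg : g.linear ≠ 0) :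
    volume {x | g x = 0} = 0 := by
  let s : AffineSubspace ℝ (E n) := (AffineSubspace.mk' (0 : ℝ) ⊥).comap g
  have hs : (s : Set (E n)) = {x | g x = 0} := by
    ext x
    simp [s]
  rw [← hs]
  apply Measure.addHaar_affineSubspace
  intro htop
  apply hg
  have h0 : ∀ x, g x = 0 := by
    intro x
    have : x ∈ (s : Set (E n)) := by rw [htop]; trivial
    rwa [hs] at this
  ext v
  have := affine_add g 0 v
  rw [h0, h0] at this
  simpa using this.symm

namespace FacetSystem

variable {n : ℕ} {S S' : Set (E n)} {Fs Fs' : Set (Set (E n))} {R R' : (E n → E n) → Prop}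
  (D' : FacetSystem S' Fs' R') (D : FacetSystem S Fs R)

/-- The facet with index `i`. -/
def facet (i : D.ι) : Set (E n) := {x | x ∈ S ∧ D.g i x = 0}

theorem exists_facet {G : Set (E n)} (hG : G ∈ Fs) : ∃ i, D.facet i = G := by
  have h := D.facets_eq
  have : G ∈ Set.range fun i => {x | x ∈ S ∧ D.g i x = 0} := by
    rw [← h]
    exact hG
  exact this

theorem linear_ne_zero (i : D.ι) : (D.g i).linear ≠ 0 := by
  intro h
  have := D.g_axis i
  simp [h] at this

theorem center_mem_facet (i : D.ι) : D.center i ∈ D.facet i := by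
  refine ⟨(D.mem_iff _).2 fun j => ?_, D.g_center_self i⟩
  by_cases h : j = i
  · rw [h, D.g_center_self]
  · exact (D.g_center_pos i j h).le

theorem facet_subset {i j : D.ι} (h : D.facet i ⊆ D.facet j) : i = j := by
  by_contra hij
  have h1 := D.g_center_pos i j (Ne.symm hij)
  have h2 := (h (D.center_mem_facet i)).2
  linarith

theorem exists_ball_pos {x : E n} {p : D.ι → Prop} (h : ∀ j, p j → 0 < D.g j x) :
    ∃ ε > 0, ∀ v : E n, ‖v‖ < ε → ∀ j, p j → 0 < D.g j (x + v) := by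
  have hev : ∀ᶠ y in nhds x, ∀ j, p j → 0 < D.g j y := by
    rw [Filter.eventually_all]
    intro j
    by_cases hj : p j
    · filter_upwards [((affine_continuous (D.g j)).tendsto x).eventually_const_lt (h j hj)]
        with y hy _
      exact hy
    · exact Filter.Eventually.of_forall fun _ h => absurd h hj
  obtain ⟨ε, hε, hb⟩ := Metric.eventually_nhds_iff.1 hev
  refine ⟨ε, hε, fun v hv => hb ?_⟩
  simpa [dist_eq_norm] using hv

/-- Near its center a facet fills its hyperplane, because the other inequalities are strict there.
Hence a facet, as a set, determines its hyperplane; this is how different descriptions of the same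
facet are compared. -/
theorem exists_facet_ball (i : D.ι) : ∃ ε > 0, ∀ v : E n, ‖v‖ < ε → (D.g i).linear v = 0 →
    D.center i + v ∈ D.facet i := by
  obtain ⟨ε, hε, h⟩ := D.exists_ball_pos (x := D.center i) (p := fun j => j ≠ i)
    (fun j hj => D.g_center_pos i j hj)
  refine ⟨ε, hε, fun v hv hv0 => ?_⟩
  have h0 : D.g i (D.center i + v) = 0 := by rw [affine_add, D.g_center_self, hv0, add_zero]
  refine ⟨(D.mem_iff _).2 fun j => ?_, h0⟩
  by_cases hj : j = i
  · rw [hj, h0]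
  · exact (h v hv j hj).le

theorem isClosed (D : FacetSystem S Fs R) : IsClosed S := by
  have : S = ⋂ i, {x | 0 ≤ D.g i x} := by
    ext x
    simp [D.mem_iff]
  rw [this]
  exact isClosed_iInter fun i => isClosed_le continuous_const (affine_continuous _)

theorem convex (D : FacetSystem S Fs R) : Convex ℝ S := by
  have : S = ⋂ i, {x | 0 ≤ D.g i x} := by
    ext x
    simp [D.mem_iff]
  rw [this]
  exact convex_iInter fun i => (convex_Ici (0 : ℝ)).affine_preimage (D.g i)

theorem mem_interior_iff (x : E n) : x ∈ interior S ↔ ∀ i, 0 < D.g i x := by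
  constructor
  · intro hx i
    obtain ⟨ε, hε, hb⟩ := Metric.mem_nhds_iff.1 (mem_interior_iff_mem_nhds.1 hx)
    have hp : 0 < ‖D.axis i‖ + 1 := by positivity
    have ht : ‖(ε / (2 * (‖D.axis i‖ + 1))) • D.axis i‖ < ε := by
      rw [norm_smul, Real.norm_of_nonneg (by positivity), div_mul_eq_mul_div,
        div_lt_iff₀ (by positivity)]
      nlinarith [norm_nonneg (D.axis i)]
    have hm : x + -((ε / (2 * (‖D.axis i‖ + 1))) • D.axis i) ∈ S := by
      apply hb
      simpa [dist_eq_norm] using ht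
    have := (D.mem_iff _).1 hm i
    rw [affine_add, map_neg, map_smul, D.g_axis, smul_eq_mul, mul_one] at this
    have : 0 < ε / (2 * (‖D.axis i‖ + 1)) := by positivity
    linarith
  · intro h
    rw [mem_interior_iff_mem_nhds, Metric.mem_nhds_iff]
    obtain ⟨ε, hε, hb⟩ := D.exists_ball_pos (x := x) (p := fun _ => True) (fun j _ => h j)
    refine ⟨ε, hε, fun y hy => (D.mem_iff y).2 fun j => ?_⟩
    have := hb (y - x) (by simpa [dist_eq_norm] using hy) j trivial
    rw [add_sub_cancel] at this
    exact this.le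

theorem volume_prism (i : D.ι) (w : E n) : volume (prism (D.facet i) w) =
    ENNReal.ofReal (|(D.g i).linear w| * D.d) * volume S := by
  rw [volume_prism_eq (D.g i) (fun x hx => hx.2) (D.g_axis i) w, ENNReal.ofReal_mul (abs_nonneg _),
    mul_assoc, ← D.volume_prism_axis i]
  rfl

/-- The facet spans its hyperplane, so a normal vector represents a multiple of `(D.g i).linear`,
and evaluation at the axis gives the factor. This turns the normal conditions in `rt0Zero` into
conditions on `g`. -/
theorem eq_smul_normal {i : D.ι} {ν : E n} (hν : IsNormalTo (D.facet i) ν) (v : E n) :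
    inner ℝ v ν = inner ℝ (D.axis i) ν * (D.g i).linear v := by
  obtain ⟨ε, hε, hb⟩ := D.exists_facet_ball i
  have := linear_eq_smul_of_ker (f := (D.g i).linear) (h := (innerSL ℝ ν).toLinearMap)
    (D.g_axis i) ?_ v
  · simpa [real_inner_comm] using this
  · intro v hv
    apply linear_eq_zero_of_small hε
    intro t ht
    have := hν _ (hb (t • v) ht (by simp [hv])) _ (D.center_mem_facet i)
    simpa [inner_smul_right] using this

variable {D' D}

/-- Two systems that share a facet have proportional facet functionals. -/
theorem exists_smul_of_facet_eq {i : D.ι} {j : D'.ι} (h : D.facet i = D'.facet j) :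
    ∃ κ : ℝ, κ ≠ 0 ∧ (∀ x, D'.g j x = κ * D.g i x) ∧
      ∀ v, (D'.g j).linear v = κ * (D.g i).linear v := by
  obtain ⟨ε, hε, hb⟩ := D.exists_facet_ball i
  have hc : D'.g j (D.center i) = 0 := (h ▸ D.center_mem_facet i).2
  have hlin := linear_eq_smul_of_ker (f := (D.g i).linear) (h := (D'.g j).linear) (D.g_axis i) (by
    intro v hv
    apply linear_eq_zero_of_small hε
    intro t ht
    have h1 := hb (t • v) ht (by simp [hv])
    rw [h] at h1
    have := h1.2
    rwa [affine_add, hc, zero_add] at this)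
  refine ⟨(D'.g j).linear (D.axis i), ?_, ?_, hlin⟩
  · intro h0
    apply D'.linear_ne_zero j
    ext v
    rw [hlin, h0]
    simp
  · intro x
    have h1 := affine_add (D'.g j) (D.center i) (x - D.center i)
    have h2 := affine_add (D.g i) (D.center i) (x - D.center i)
    rw [add_sub_cancel, hc, zero_add] at h1
    rw [add_sub_cancel, D.g_center_self, zero_add] at h2
    rw [h1, h2, hlin]

/-- The center of a shared facet lies in the relative interior from both sides. -/
theorem center_pos_of_facet_eq {i : D.ι} {j : D'.ι} (h : D.facet i = D'.facet j) (k : D'.ι)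
    (hk : k ≠ j) : 0 < D'.g k (D.center i) := by
  have hmem : D.center i ∈ D'.facet j := h ▸ D.center_mem_facet i
  refine lt_of_le_of_ne ((D'.mem_iff _).1 hmem.1 k) fun h0 => ?_
  obtain ⟨ε, hε, hb⟩ := D.exists_facet_ball i
  -- If `D'.g k` vanished at this center, it would be nonnegative on a neighborhood within the
  -- hyperplane, hence constant along it. It would then also vanish at the center chosen by `D'`,
  -- where it is positive.
  have hker : ∀ v, (D.g i).linear v = 0 → (D'.g k).linear v = 0 := by
    intro v hv
    apply linear_eq_zero_of_small hε
    intro t ht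
    have h1 := hb (t • v) ht (by simp [hv])
    have h2 := hb (-(t • v)) (by simpa using ht) (by simp [hv])
    rw [h] at h1 h2
    have h3 := (D'.mem_iff _).1 h1.1 k
    have h4 := (D'.mem_iff _).1 h2.1 k
    rw [affine_add, ← h0, zero_add] at h3 h4
    rw [map_neg] at h4
    linarith
  obtain ⟨κ, hκ, hκ1, -⟩ := exists_smul_of_facet_eq h
  have h5 := D'.g_center_pos j k hk
  have h6 : D.g i (D'.center j) = 0 := by
    have := hκ1 (D'.center j)
    rw [D'.g_center_self] at this
    exact (mul_eq_zero.1 this.symm).resolve_left hκ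
  have h7 := affine_add (D'.g k) (D.center i) (D'.center j - D.center i)
  have h8 := affine_add (D.g i) (D.center i) (D'.center j - D.center i)
  rw [add_sub_cancel, ← h0, zero_add] at h7
  rw [add_sub_cancel, D.g_center_self, zero_add, h6] at h8
  rw [hker _ h8.symm] at h7
  linarith

/-- Near the center of a shared facet only the facet inequality is active. -/
theorem exists_halfBall_of_facet_eq {i : D.ι} {j : D'.ι} (h : D.facet i = D'.facet j) :
    ∃ ε > 0, ∀ v : E n, ‖v‖ < ε →
      (0 ≤ (D'.g j).linear v → D.center i + v ∈ S') ∧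
      (0 < (D'.g j).linear v → D.center i + v ∈ interior S') := by
  obtain ⟨ε, hε, hb⟩ := D'.exists_ball_pos (x := D.center i) (p := fun k => k ≠ j)
    (fun k hk => center_pos_of_facet_eq h k hk)
  have hc : D'.g j (D.center i) = 0 := (h ▸ D.center_mem_facet i).2
  refine ⟨ε, hε, fun v hv => ⟨fun h0 => (D'.mem_iff _).2 fun k => ?_,
    fun h0 => (D'.mem_interior_iff _).2 fun k => ?_⟩⟩
  · by_cases hk : k = j
    · rw [hk, affine_add, hc, zero_add]; exact h0
    · exact (hb v hv k hk).le
  · by_cases hk : k = j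
    · rw [hk, affine_add, hc, zero_add]; exact h0
    · exact hb v hv k hk

end FacetSystem

end

end MixedDim

/-! ### Shared facets of a mesh, and splitting of integrals into cells -/

namespace MixedDim

open MeasureTheory

noncomputable section

namespace Mesh

variable {n : ℕ} {Ω : Set (E n)} (M : Mesh Ω)

/-- A choice of facet systems for all cells of a mesh. -/
abbrev FacetSystems : Type _ := ∀ τ, FacetSystem (M.cell τ).carrier (M.cell τ).facets
  fun q => q ∈ (M.cell τ).rt0

/-- The volume of a cell. -/
def vol (τ : Fin M.N) : ℝ := volume.real (M.cell τ).carrier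

/-- The diameter of a cell. -/
def diam (τ : Fin M.N) : ℝ := Metric.diam (M.cell τ).carrier

theorem vol_nonneg (τ : Fin M.N) : 0 ≤ M.vol τ := measureReal_nonneg

theorem carrier_subset (τ : Fin M.N) : (M.cell τ).carrier ⊆ closure Ω := by
  rw [← M.iUnion_cell]
  exact Set.subset_iUnion (fun τ => (M.cell τ).carrier) τ

theorem isBounded_carrier (hΩ : Bornology.IsBounded Ω) (τ : Fin M.N) :
    Bornology.IsBounded (M.cell τ).carrier :=
  hΩ.closure.subset (M.carrier_subset τ)

theorem volume_carrier_ne_top (hΩ : Bornology.IsBounded Ω) (τ : Fin M.N) :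
    volume (M.cell τ).carrier ≠ ⊤ :=
  (M.isBounded_carrier hΩ τ).measure_lt_top.ne

theorem interior_subset (hreg : interior (closure Ω) = Ω) (τ : Fin M.N) :
    interior (M.cell τ).carrier ⊆ Ω :=
  (interior_mono (M.carrier_subset τ)).trans hreg.le

variable {M} (D : M.FacetSystems)

theorem exists_inter_subset_facet {τ τ' : Fin M.N} (h : τ ≠ τ') :
    ∃ i, (M.cell τ).carrier ∩ (M.cell τ').carrier ⊆ (D τ).facet i := by
  obtain ⟨S, hS, ⟨G, hG⟩, hGS⟩ := (M.conforming τ τ' h).1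
  obtain ⟨i, hi⟩ := (D τ).exists_facet (hS hG)
  refine ⟨i, ?_⟩
  rw [hGS, hi]
  exact Set.sInter_subset_of_mem hG

include D in
theorem notMem_of_mem_interior {τ τ' : Fin M.N} (h : τ ≠ τ') {x : E n}
    (hx : x ∈ interior (M.cell τ).carrier) : x ∉ (M.cell τ').carrier := by
  intro hx'
  obtain ⟨i, hi⟩ := exists_inter_subset_facet D h
  have h1 := (hi ⟨_root_.interior_subset hx, hx'⟩).2
  have h2 := ((D τ).mem_interior_iff x).1 hx i
  linarith

include D in
-- By conformity the intersection lies in some facet of `τ`. It contains `G`, and no facet contains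
-- another one, so both inclusions are equalities.
theorem inter_eq_of_facet {τ τ' : Fin M.N} (h : τ ≠ τ') {G : Set (E n)}
    (hG : G ∈ (M.cell τ).facets) (hG' : G ∈ (M.cell τ').facets) :
    (M.cell τ).carrier ∩ (M.cell τ').carrier = G := by
  obtain ⟨i, hi⟩ := (D τ).exists_facet hG
  obtain ⟨i', hi'⟩ := (D τ').exists_facet hG'
  obtain ⟨k, hk⟩ := exists_inter_subset_facet D h
  have hsub : G ⊆ (M.cell τ).carrier ∩ (M.cell τ').carrier := by
    intro x hx
    exact ⟨(hi ▸ hx : x ∈ (D τ).facet i).1, (hi' ▸ hx : x ∈ (D τ').facet i').1⟩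
  have : i = k := (D τ).facet_subset (hi ▸ hsub.trans hk)
  subst this
  exact (hk.trans hi.le).antisymm hsub

/-- Two cells on a common facet lie on opposite sides of it. -/
theorem exists_neg_smul {τ τ' : Fin M.N} (h : τ ≠ τ') {i : (D τ).ι} {j : (D τ').ι}
    (hij : (D τ).facet i = (D τ').facet j) :
    ∃ κ > 0, ∀ v, ((D τ').g j).linear v = -κ * ((D τ).g i).linear v := by
  obtain ⟨κ, hκ, -, hlin⟩ := FacetSystem.exists_smul_of_facet_eq hij
  rcases lt_or_gt_of_ne hκ with hneg | hpos
  · exact ⟨-κ, by linarith, fun v => by rw [hlin]; ring⟩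
  -- A positive factor puts both cells on the same side: the point slightly inside `τ` from the
  -- center of the facet is interior to `τ` and also belongs to `τ'`.
  · exfalso
    obtain ⟨ε, hε, hb⟩ := FacetSystem.exists_halfBall_of_facet_eq hij
    obtain ⟨ε', hε', hb'⟩ := FacetSystem.exists_halfBall_of_facet_eq
      (D := D τ) (D' := D τ) (i := i) rfl
    set a := (D τ).axis i
    have hp : 0 < ‖a‖ + 1 := by positivity
    let t := min ε ε' / (2 * (‖a‖ + 1))
    have ht0 : 0 < t := by
      have : 0 < min ε ε' := lt_min hε hε'
      positivity
    have ht : ‖t • a‖ < min ε ε' := by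
      have : 0 < min ε ε' := lt_min hε hε'
      rw [norm_smul, Real.norm_of_nonneg ht0.le, div_mul_eq_mul_div, div_lt_iff₀ (by positivity)]
      nlinarith [norm_nonneg a]
    have hl : 0 < ((D τ).g i).linear (t • a) := by
      rw [map_smul, (D τ).g_axis, smul_eq_mul, mul_one]; exact ht0
    have h1 := (hb (t • a) (ht.trans_le (min_le_left _ _))).1 (by rw [hlin]; positivity)
    have h2 := (hb' (t • a) (ht.trans_le (min_le_right _ _))).2 hl
    exact notMem_of_mem_interior D h h2 h1

/-- The area of a common facet, computed from either side. -/
theorem smul_area_eq (hΩ : Bornology.IsBounded Ω) {τ τ' : Fin M.N} {i : (D τ).ι} {j : (D τ').ι}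
    (hij : (D τ).facet i = (D τ').facet j) {κ : ℝ} (hκ : 0 < κ)
    (hlin : ∀ v, ((D τ').g j).linear v = -κ * ((D τ).g i).linear v) :
    κ * ((D τ').d * M.vol τ') = (D τ).d * M.vol τ := by
  -- One and the same prism over the common facet is measured with both facet systems.
  have h1 := (D τ).volume_prism i ((D τ).axis i)
  have h2 := (D τ').volume_prism j ((D τ).axis i)
  have hd := (D τ).one_le_d
  have hd' := (D τ').one_le_d
  rw [← hij, h1, hlin, (D τ).g_axis, ← ofReal_measureReal (M.volume_carrier_ne_top hΩ τ),
    ← ofReal_measureReal (M.volume_carrier_ne_top hΩ τ'), ← ENNReal.ofReal_mul (by positivity),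
    ← ENNReal.ofReal_mul (by positivity), ENNReal.ofReal_eq_ofReal_iff] at h2
  · simp only [abs_one, one_mul, mul_one, abs_neg, abs_of_pos hκ] at h2
    rw [vol, vol, h2]
    ring
  · positivity
  · positivity

/-- Of three cells on a common facet two would lie on the same side. In terms of the functionals,
the product of two negative factors would have to be a negative factor. -/
theorem eq_of_facet_eq {τ τ₁ τ₂ : Fin M.N} (h₁ : τ ≠ τ₁) (h₂ : τ ≠ τ₂) {i : (D τ).ι}
    {j₁ : (D τ₁).ι} {j₂ : (D τ₂).ι} (hi₁ : (D τ).facet i = (D τ₁).facet j₁)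
    (hi₂ : (D τ).facet i = (D τ₂).facet j₂) : τ₁ = τ₂ := by
  by_contra h
  obtain ⟨κ₁, hκ₁, hl₁⟩ := exists_neg_smul D h₁ hi₁
  obtain ⟨κ₂, hκ₂, hl₂⟩ := exists_neg_smul D h₂ hi₂
  obtain ⟨κ, hκ, hl⟩ := exists_neg_smul D h (hi₁.symm.trans hi₂)
  have e := (D τ).g_axis i
  have h3 := hl ((D τ).axis i)
  rw [hl₁, hl₂, e] at h3
  nlinarith

include D in
-- The half balls in the two cells form a ball around the center of the facet, contained in `closure
-- Ω`. As `Ω` is the interior of its closure, the center belongs to `Ω`; slits along facets are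
-- excluded.
theorem facet_not_subset_frontier (hopen : IsOpen Ω) (hreg : interior (closure Ω) = Ω)
    {τ τ' : Fin M.N} (h : τ ≠ τ') {G : Set (E n)}
    (hG : G ∈ (M.cell τ).facets) (hG' : G ∈ (M.cell τ').facets) : ¬ G ⊆ frontier Ω := by
  obtain ⟨i, rfl⟩ := (D τ).exists_facet hG
  obtain ⟨j, hij⟩ := (D τ').exists_facet hG'
  obtain ⟨κ, hκ, hl⟩ := exists_neg_smul D h hij.symm
  obtain ⟨ε, hε, hb⟩ := FacetSystem.exists_halfBall_of_facet_eq hij.symm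
  obtain ⟨ε', hε', hb'⟩ := FacetSystem.exists_halfBall_of_facet_eq
      (D := D τ) (D' := D τ) (i := i) rfl
  intro hsub
  have hf := hsub ((D τ).center_mem_facet i)
  have hInt : (D τ).center i ∈ interior (closure Ω) := by
    rw [mem_interior_iff_mem_nhds, Metric.mem_nhds_iff]
    refine ⟨min ε ε', lt_min hε hε', fun y hy => ?_⟩
    have hy' : ‖y - (D τ).center i‖ < min ε ε' := by simpa [dist_eq_norm] using hy
    have e : y = (D τ).center i + (y - (D τ).center i) := by abel
    rw [e]
    rcases le_total 0 (((D τ).g i).linear (y - (D τ).center i)) with h0 | h0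
    · exact M.carrier_subset τ ((hb' _ (hy'.trans_le (min_le_right _ _))).1 h0)
    · exact M.carrier_subset τ' ((hb _ (hy'.trans_le (min_le_left _ _))).1 (by rw [hl]; nlinarith))
  rw [hreg] at hInt
  rw [hopen.frontier_eq] at hf
  exact hf.2 hInt

include D in
theorem volume_carrier_diff_interior (τ : Fin M.N) :
    volume ((M.cell τ).carrier \ interior (M.cell τ).carrier) = 0 := by
  have := (D τ).convex.addHaar_frontier volume
  rwa [(D τ).isClosed.frontier_eq] at this

include D in
theorem interior_ae_eq (τ : Fin M.N) :
    interior (M.cell τ).carrier =ᵐ[volume] (M.cell τ).carrier :=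
  (_root_.interior_subset.eventuallyLE).antisymm
    (ae_le_set.2 (volume_carrier_diff_interior D τ))

include D in
theorem vol_eq (τ : Fin M.N) : M.vol τ = volume.real (interior (M.cell τ).carrier) :=
  (measureReal_congr (interior_ae_eq D τ)).symm

include D in
theorem ae_exists_mem_interior : ∀ᵐ x ∂volume, x ∈ closure Ω →
    ∃ τ, x ∈ interior (M.cell τ).carrier := by
  have : ∀ᵐ x ∂(volume : Measure (E n)), ∀ τ, x ∉ (M.cell τ).carrier \ interior (M.cell τ).carrier :=
    ae_all_iff.2 fun τ => measure_eq_zero_iff_ae_notMem.1 (volume_carrier_diff_interior D τ)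
  filter_upwards [this] with x hx hxΩ
  rw [← M.iUnion_cell, Set.mem_iUnion] at hxΩ
  obtain ⟨τ, hτ⟩ := hxΩ
  refine ⟨τ, ?_⟩
  by_contra h
  exact hx τ ⟨hτ, h⟩

include D in
theorem pairwise_disjoint_interior :
    Pairwise (Function.onFun Disjoint fun τ => interior (M.cell τ).carrier) := by
  intro τ τ' h
  exact Set.disjoint_left.2 fun x hx hx' =>
    notMem_of_mem_interior D h hx (_root_.interior_subset hx')

include D in
theorem restrict_eq_sum (hreg : interior (closure Ω) = Ω) :
    volume.restrict Ω = ∑ τ, volume.restrict (interior (M.cell τ).carrier) := by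
  have h : Ω =ᵐ[volume] ⋃ τ, interior (M.cell τ).carrier := by
    refine Filter.EventuallyLE.antisymm ?_
      (Set.iUnion_subset fun τ => M.interior_subset hreg τ).eventuallyLE
    filter_upwards [ae_exists_mem_interior D] with x hx hxΩ
    exact Set.mem_iUnion.2 (hx (subset_closure hxΩ))
  rw [Measure.restrict_congr_set h, Measure.restrict_iUnion (pairwise_disjoint_interior D)
    (fun τ => isOpen_interior.measurableSet), Measure.sum_fintype]

include D in
theorem glue_of_mem {X : Type*} [AddCommMonoid X] (f : Fin M.N → E n → X) {τ : Fin M.N} {x : E n}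
    (hx : x ∈ interior (M.cell τ).carrier) : M.glue f x = f τ x := by
  rw [glue, Finset.sum_eq_single τ, Set.indicator_of_mem hx]
  · intro τ' _ h
    exact Set.indicator_of_notMem
      (fun hx' => notMem_of_mem_interior D h.symm hx (_root_.interior_subset hx')) _
  · simp

include D in
theorem integral_eq_sum (hreg : interior (closure Ω) = Ω) {X : Type*} [NormedAddCommGroup X]
    [NormedSpace ℝ X] {F : E n → X}
    (hF : ∀ τ, IntegrableOn F (interior (M.cell τ).carrier)) :
    IntegrableOn F Ω ∧ ∫ x in Ω, F x = ∑ τ, ∫ x in interior (M.cell τ).carrier, F x := by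
  unfold IntegrableOn at *
  rw [restrict_eq_sum D hreg]
  exact ⟨integrable_finsetSum_measure.2 fun τ _ => hF τ,
    integral_finsetSum_measure fun τ _ => hF τ⟩

include D in
theorem lintegral_eq_sum (hreg : interior (closure Ω) = Ω) (F : E n → ENNReal) :
    ∫⁻ x in Ω, F x = ∑ τ, ∫⁻ x in interior (M.cell τ).carrier, F x := by
  rw [restrict_eq_sum D hreg, lintegral_finsetSum_measure]

/-- Integrals of cellwise constant functions. -/
theorem setIntegral_const_interior (D : M.FacetSystems) (hΩ : Bornology.IsBounded Ω) (τ : Fin M.N)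
    {F : E n → ℝ} {c : ℝ} (hF : ∀ x ∈ interior (M.cell τ).carrier, F x = c) :
    IntegrableOn F (interior (M.cell τ).carrier) ∧
      ∫ x in interior (M.cell τ).carrier, F x = c * M.vol τ := by
  have hms : MeasurableSet (interior (M.cell τ).carrier) := isOpen_interior.measurableSet
  have hfin : volume (interior (M.cell τ).carrier) ≠ ⊤ :=
    ((measure_mono _root_.interior_subset).trans_lt
      (M.volume_carrier_ne_top hΩ τ).lt_top).ne
  constructor
  · exact (integrableOn_congr_fun hF hms).2 (integrableOn_const (C := c) hfin)
  · rw [setIntegral_congr_fun hms hF, setIntegral_const, vol_eq D, smul_eq_mul, mul_comm]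

end Mesh

end

end MixedDim

namespace MixedDim

open MeasureTheory

noncomputable section

/-! ### Cells met by a segment -/

/-- The difference telescopes along a path, and a path uses every oriented edge at most once. -/
theorem abs_sub_le_sum_of_walk {V : Type*} [Fintype V] {G : SimpleGraph V} [DecidableRel G.Adj]
    (u : V → ℝ) {a b : V} (h : G.Reachable a b) :
    |u a - u b| ≤ ∑ x, ∑ y, if G.Adj x y then |u x - u y| else 0 := by
  classical
  obtain ⟨p, hp⟩ := h.exists_isPath
  have h1 : ∀ {a b : V} (p : G.Walk a b),
      |u a - u b| ≤ (p.darts.map fun d => |u d.fst - u d.snd|).sum := by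
    intro a b p
    induction p with
    | nil => simp
    | cons h p ih =>
      rw [SimpleGraph.Walk.darts_cons, List.map_cons, List.sum_cons]
      exact (abs_sub_le _ _ _).trans (add_le_add le_rfl ih)
  refine (h1 p).trans ?_
  have hnd : p.darts.Nodup := SimpleGraph.Walk.darts_nodup_of_support_nodup hp.support_nodup
  rw [← List.sum_toFinset _ hnd]
  have hinj : Set.InjOn (fun d : G.Dart => d.toProd) (p.darts.toFinset : Set G.Dart) :=
    fun d _ d' _ h => SimpleGraph.Dart.ext _ _ h
  calc ∑ d ∈ p.darts.toFinset, |u d.fst - u d.snd|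
      = ∑ z ∈ p.darts.toFinset.image (fun d : G.Dart => d.toProd),
          if G.Adj z.1 z.2 then |u z.1 - u z.2| else 0 := by
        rw [Finset.sum_image hinj]
        refine Finset.sum_congr rfl fun d _ => ?_
        rw [if_pos d.adj]
    _ ≤ ∑ z : V × V, if G.Adj z.1 z.2 then |u z.1 - u z.2| else 0 := by
        apply Finset.sum_le_sum_of_subset_of_nonneg (Finset.subset_univ _)
        intro z _ _
        split_ifs
        · exact abs_nonneg _
        · exact le_rfl
    _ = _ := by rw [Fintype.sum_prod_type]

namespace Mesh

variable {n : ℕ} {Ω : Set (E n)} (M : Mesh Ω)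

/-- Two cells that share a facet. -/
def Adj (τ τ' : Fin M.N) : Prop :=
  τ ≠ τ' ∧ (M.cell τ).carrier ∩ (M.cell τ').carrier ∈ (M.cell τ).facets ∧
    (M.cell τ).carrier ∩ (M.cell τ').carrier ∈ (M.cell τ').facets

variable {M}

theorem Adj.symm {τ τ' : Fin M.N} (h : M.Adj τ τ') : M.Adj τ' τ := by
  refine ⟨h.1.symm, ?_, ?_⟩
  · rw [Set.inter_comm]; exact h.2.2
  · rw [Set.inter_comm]; exact h.2.1

variable (D : M.FacetSystems)

/-- Almost every segment avoids the faces of codimension two. -/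
theorem ae_segment_generic : ∀ᵐ x ∂(volume : Measure (E n)), ∀ᵐ y ∂(volume : Measure (E n)),
    ∀ τ, ∀ i j : (D τ).ι, i ≠ j → ∀ t : ℝ, (D τ).g i (AffineMap.lineMap x y t) = 0 →
      (D τ).g j (AffineMap.lineMap x y t) ≠ 0 := by
  have hx : ∀ᵐ x ∂(volume : Measure (E n)), ∀ τ, ∀ i : (D τ).ι, (D τ).g i x ≠ 0 := by
    rw [ae_all_iff]; intro τ
    rw [ae_all_iff]; intro i
    exact measure_eq_zero_iff_ae_notMem.1 (volume_affine_zero _ ((D τ).linear_ne_zero i))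
  filter_upwards [hx] with x hx
  rw [ae_all_iff]; intro τ
  rw [ae_all_iff]; intro i
  rw [ae_all_iff]; intro j
  by_cases hij : i = j
  · exact Filter.Eventually.of_forall fun y h => absurd hij h
  by_cases hex : ∃ z, (D τ).g i z = 0 ∧ (D τ).g j z = 0
  swap
  · exact Filter.Eventually.of_forall fun y _ t h1 h2 => hex ⟨_, h1, h2⟩
  obtain ⟨z, hz1, hz2⟩ := hex
  -- The zero set of `h` is the hyperplane through `x` and the codimension-two set `g i = g j = 0`.
  -- A segment from `x` that meets this set must have its other end on that hyperplane, a null set.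
  -- The value `t = 0` is excluded by `g i x ≠ 0`.
  let h : E n →ᵃ[ℝ] ℝ := (D τ).g i x • (D τ).g j - (D τ).g j x • (D τ).g i
  have hlin : h.linear ≠ 0 := by
    intro h0
    have h1 : ((D τ).g i x) * ((D τ).g j).linear ((D τ).center i - z) -
        ((D τ).g j x) * ((D τ).g i).linear ((D τ).center i - z) = 0 := by
      have := LinearMap.congr_fun h0 ((D τ).center i - z)
      simpa [h] using this
    have h2 := affine_add ((D τ).g i) z ((D τ).center i - z)
    have h3 := affine_add ((D τ).g j) z ((D τ).center i - z)
    rw [add_sub_cancel, hz1, zero_add, (D τ).g_center_self] at h2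
    rw [add_sub_cancel, hz2, zero_add] at h3
    rw [← h2, ← h3, mul_zero, sub_zero] at h1
    have h4 := (D τ).g_center_pos i j (Ne.symm hij)
    rcases mul_eq_zero.1 h1 with h5 | h5
    · exact hx τ i h5
    · linarith
  filter_upwards [measure_eq_zero_iff_ae_notMem.1 (volume_affine_zero h hlin)] with y hy _ t h1 h2
  rw [AffineMap.apply_lineMap, AffineMap.lineMap_apply] at h1 h2
  simp only [vsub_eq_sub, smul_eq_mul, vadd_eq_add] at h1 h2
  have h3 : t * ((D τ).g i x * (D τ).g j y - (D τ).g j x * (D τ).g i y) = 0 := by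
    linear_combination (D τ).g i x * h2 - (D τ).g j x * h1
  rcases mul_eq_zero.1 h3 with h4 | h4
  · rw [h4] at h1
    exact hx τ i (by simpa using h1)
  · exact hy (by simpa [h] using h4)

open Classical in
/-- The variation of a cellwise constant function along a generic segment. -/
theorem abs_sub_le_sum_crossed {x y : E n} {τ τ' : Fin M.N}
    (hx : x ∈ (M.cell τ).carrier) (hy : y ∈ interior (M.cell τ').carrier)
    (hseg : ∀ t ∈ Set.Icc (0 : ℝ) 1, AffineMap.lineMap x y t ∈ closure Ω)
    (hgen : ∀ τ, ∀ i j : (D τ).ι, i ≠ j → ∀ t : ℝ, (D τ).g i (AffineMap.lineMap x y t) = 0 →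
      (D τ).g j (AffineMap.lineMap x y t) ≠ 0) (u : Fin M.N → ℝ) :
    |u τ - u τ'| ≤ ∑ a, ∑ b, if M.Adj a b ∧ ∃ t ∈ Set.Icc (0 : ℝ) 1,
      AffineMap.lineMap x y t ∈ (M.cell a).carrier ∩ (M.cell b).carrier
        then |u a - u b| else 0 := by
  let G : SimpleGraph (Fin M.N) :=
    { Adj := fun a b => M.Adj a b ∧ ∃ t ∈ Set.Icc (0 : ℝ) 1,
        AffineMap.lineMap x y t ∈ (M.cell a).carrier ∩ (M.cell b).carrier
      symm := ⟨fun a b h => ⟨h.1.symm, by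
        obtain ⟨t, ht, h2⟩ := h.2
        exact ⟨t, ht, h2.symm⟩⟩⟩
      loopless := ⟨fun a h => h.1.1 rfl⟩ }
  refine abs_sub_le_sum_of_walk (G := G) u ?_
  by_contra hnr
  let γ : ℝ → E n := fun t => AffineMap.lineMap x y t
  have hγ : Continuous γ := AffineMap.lineMap_continuous
  have hcl : ∀ P : Fin M.N → Prop, IsClosed {t | ∃ σ, P σ ∧ γ t ∈ (M.cell σ).carrier} := by
    intro P
    have : {t | ∃ σ, P σ ∧ γ t ∈ (M.cell σ).carrier} =
        ⋃ σ, {t | P σ ∧ γ t ∈ (M.cell σ).carrier} := by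
      ext t; simp
    rw [this]
    refine isClosed_iUnion_of_finite fun σ => ?_
    by_cases hP : P σ
    · simp only [hP, true_and]
      exact (D σ).isClosed.preimage hγ
    · simp [hP]
  -- The parameters whose point lies in a cell reachable from `τ`, and those whose point lies in an
  -- unreachable one, form two nonempty closed sets covering `[0, 1]`. They have a common parameter
  -- by connectedness, and the two cells met there turn out to be adjacent.
  have hcov := isPreconnected_closed_iff.1 (isPreconnected_Icc (a := (0 : ℝ)) (b := 1)) _ _
    (hcl fun σ => G.Reachable τ σ) (hcl fun σ => ¬ G.Reachable τ σ) ?_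
    ⟨0, by simp, τ, SimpleGraph.Reachable.refl _, by simpa [γ] using hx⟩
    ⟨1, by simp, τ', hnr, by simpa [γ] using _root_.interior_subset hy⟩
  swap
  · intro t ht
    have := hseg t ht
    rw [← M.iUnion_cell, Set.mem_iUnion] at this
    obtain ⟨σ, hσ⟩ := this
    by_cases h : G.Reachable τ σ
    · exact Or.inl ⟨σ, h, hσ⟩
    · exact Or.inr ⟨σ, h, hσ⟩
  obtain ⟨t, ht, ⟨a, ha, hta⟩, ⟨b, hb, htb⟩⟩ := hcov
  have hab : a ≠ b := fun h => hb (h ▸ ha)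
  -- A generic segment never lies on two facets of `c` at once, so a face that it meets is an
  -- intersection of a single facet.
  have key : ∀ {c : Fin M.N} (_ : γ t ∈ (M.cell c).carrier) (I : Set (E n))
      (_ : γ t ∈ I) (_ : (M.cell c).IsFace I), I ∈ (M.cell c).facets := by
    intro c hc I hI hF
    obtain ⟨S, hS, ⟨F, hF⟩, rfl⟩ := hF
    have hall : ∀ F' ∈ S, F' = F := by
      intro F' hF'
      obtain ⟨i, hi⟩ := (D c).exists_facet (hS hF)
      obtain ⟨j, hj⟩ := (D c).exists_facet (hS hF')
      by_contra hne
      have hij : i ≠ j := fun h => hne (by rw [← hi, ← hj, h])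
      have h1 : γ t ∈ (D c).facet i := hi ▸ hI F hF
      have h2 : γ t ∈ (D c).facet j := hj ▸ hI F' hF'
      exact hgen c i j hij t h1.2 h2.2
    have : S = {F} := by
      ext F'
      exact ⟨fun h => hall F' h, fun h => by rw [Set.mem_singleton_iff.1 h]; exact hF⟩
    rw [this, Set.sInter_singleton]
    exact hS hF
  have hconf := M.conforming a b hab
  have hadj : G.Adj a b := ⟨⟨hab, key hta _ ⟨hta, htb⟩ hconf.1,
    key htb _ ⟨hta, htb⟩ hconf.2⟩, t, ht, hta, htb⟩
  exact hb (ha.trans hadj.reachable)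

end Mesh

end

end MixedDim

namespace MixedDim

open MeasureTheory

noncomputable section

/-! ### The measure of the pairs whose segment meets a small ball -/

/-- The pairs of points for which the point with parameter `θ` on the segment is close to `z`. -/
def nearAt {n : ℕ} (z : E n) (ρ θ : ℝ) : Set (E n × E n) :=
  {p | dist (AffineMap.lineMap p.1 p.2 θ) z ≤ 2 * ρ}

theorem measurableSet_nearAt {n : ℕ} (z : E n) (ρ θ : ℝ) : MeasurableSet (nearAt z ρ θ) := by
  have : IsClosed (nearAt z ρ θ) := by
    refine isClosed_le (f := fun p : E n × E n => dist (AffineMap.lineMap p.1 p.2 θ) z) ?_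
      continuous_const
    simp only [AffineMap.lineMap_apply, vsub_eq_sub, vadd_eq_add]
    fun_prop
  exact this.measurableSet

/-- An upper bound for the indicator of the pairs whose segment meets `closedBall z ρ`. -/
def crossFn {n : ℕ} (R : ℝ) (z : E n) (ρ : ℝ) (p : E n × E n) : ENNReal :=
  ∑ k ∈ Finset.range (⌈2 * R / ρ⌉₊ + 1), (nearAt z ρ (k / ⌈2 * R / ρ⌉₊)).indicator 1 p

theorem measurable_crossFn {n : ℕ} (R : ℝ) (z : E n) (ρ : ℝ) : Measurable (crossFn R z ρ) := by
  unfold crossFn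
  exact Finset.measurable_fun_sum _ fun k _ =>
    measurable_one.indicator (measurableSet_nearAt z ρ _)

/-- With `m = ⌈2R/ρ⌉` equal steps, consecutive nodes of the segment are at distance at most `ρ`. The
node `⌊t m⌋ / m` is therefore within `ρ` of the point at `t`, and within `2ρ` of `z`. -/
theorem one_le_crossFn {n : ℕ} {R ρ : ℝ} (hR : 0 < R) (hρ : 0 < ρ) {z x y : E n}
    (hx : x ∈ Metric.closedBall 0 R) (hy : y ∈ Metric.closedBall 0 R) {t : ℝ}
    (ht : t ∈ Set.Icc (0 : ℝ) 1) (h : dist (AffineMap.lineMap x y t) z ≤ ρ) :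
    1 ≤ crossFn R z ρ (x, y) := by
  set m := ⌈2 * R / ρ⌉₊ with hm
  have hmpos : (0 : ℝ) < m := by
    have : 0 < m := Nat.ceil_pos.2 (by positivity)
    exact_mod_cast this
  have hmR : 2 * R / m ≤ ρ := by
    rw [div_le_iff₀ hmpos, mul_comm ρ, ← div_le_iff₀ hρ]
    exact Nat.le_ceil _
  set k := ⌊t * m⌋₊ with hk
  have hk1 : (k : ℝ) ≤ t * m := Nat.floor_le (mul_nonneg ht.1 hmpos.le)
  have hk2 : t * m < k + 1 := Nat.lt_floor_add_one _
  have hkm : k < m + 1 := by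
    have : (k : ℝ) ≤ m := hk1.trans (by nlinarith [ht.2])
    have : k ≤ m := by exact_mod_cast this
    omega
  have hnear : (x, y) ∈ nearAt z ρ (k / m) := by
    have hxy : dist x y ≤ 2 * R := by
      have := dist_triangle_right x y 0
      rw [Metric.mem_closedBall] at hx hy
      linarith
    have h1 : dist (AffineMap.lineMap x y ((k : ℝ) / m) : E n) (AffineMap.lineMap x y t) ≤ ρ := by
      rw [dist_lineMap_lineMap]
      have h2 : dist ((k : ℝ) / m) t ≤ 1 / m := by
        rw [Real.dist_eq, abs_le]
        constructor
        · rw [← sub_nonneg]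
          have : (k : ℝ) / m - t - -(1 / m) = (k + 1 - t * m) / m := by field_simp; ring
          rw [this]
          exact div_nonneg (by linarith) hmpos.le
        · rw [← sub_nonneg]
          have : 1 / (m : ℝ) - (k / m - t) = (1 + (t * m - k)) / m := by field_simp; ring
          rw [this]
          exact div_nonneg (by linarith) hmpos.le
      calc dist ((k : ℝ) / m) t * dist x y ≤ 1 / m * (2 * R) := by gcongr
        _ = 2 * R / m := by ring
        _ ≤ ρ := hmR
    change dist (AffineMap.lineMap x y ((k : ℝ) / m) : E n) z ≤ 2 * ρ
    linarith [dist_triangle (AffineMap.lineMap x y ((k : ℝ) / m) : E n)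
      (AffineMap.lineMap x y t) z]
  have : (nearAt z ρ (k / m)).indicator (1 : E n × E n → ENNReal) (x, y) = 1 := by
    rw [Set.indicator_of_mem hnear]; rfl
  rw [← this]
  exact Finset.single_le_sum (f := fun k : ℕ => (nearAt z ρ (k / m)).indicator
    (1 : E n × E n → ENNReal) (x, y)) (fun _ _ => zero_le) (Finset.mem_range.2 hkm)

/-- For fixed `x` the condition confines `y` to a ball of radius `2ρ / θ ≤ 4ρ`. -/
theorem volume_nearAt_section {n : ℕ} (z x : E n) {ρ θ : ℝ} (hρ : 0 < ρ) (hθ : 1 / 2 ≤ θ) :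
    volume {y | (x, y) ∈ nearAt z ρ θ} ≤
      ENNReal.ofReal ((4 * ρ) ^ n) * volume (Metric.ball (0 : E n) 1) := by
  have hθ0 : 0 < θ := by linarith
  have hsub : {y | (x, y) ∈ nearAt z ρ θ} ⊆
      Metric.closedBall (x + θ⁻¹ • (z - x)) (4 * ρ) := by
    intro y hy
    have hy' : dist (AffineMap.lineMap x y θ) z ≤ 2 * ρ := hy
    rw [AffineMap.lineMap_apply, vsub_eq_sub, vadd_eq_add, dist_eq_norm] at hy'
    rw [Metric.mem_closedBall, dist_eq_norm]
    have e : y - (x + θ⁻¹ • (z - x)) = θ⁻¹ • (θ • (y - x) + x - z) := by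
      have : y - (x + θ⁻¹ • (z - x)) = (θ⁻¹ * θ) • (y - x) - θ⁻¹ • (z - x) := by
        rw [inv_mul_cancel₀ hθ0.ne', one_smul]; abel
      rw [this]
      module
    rw [e, norm_smul, Real.norm_of_nonneg (by positivity), inv_mul_le_iff₀ hθ0]
    nlinarith
  refine (measure_mono hsub).trans ?_
  rw [Measure.addHaar_closedBall _ _ (by positivity)]
  simp

/-- Exchanging the end points replaces `θ` by `1 - θ`, and one of these is at least `1 / 2`. -/
theorem lintegral_nearAt_le {n : ℕ} (B : Set (E n)) (z : E n) {ρ θ : ℝ} (hρ : 0 < ρ) :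
    ∫⁻ x in B, ∫⁻ y in B, (nearAt z ρ θ).indicator 1 (x, y) ≤
      volume B * (ENNReal.ofReal ((4 * ρ) ^ n) * volume (Metric.ball (0 : E n) 1)) := by
  have key : ∀ θ : ℝ, 1 / 2 ≤ θ → ∫⁻ x in B, ∫⁻ y in B, (nearAt z ρ θ).indicator 1 (x, y) ≤
      volume B * (ENNReal.ofReal ((4 * ρ) ^ n) * volume (Metric.ball (0 : E n) 1)) := by
    intro θ hθ
    rw [mul_comm, ← setLIntegral_const]
    refine lintegral_mono fun x => ?_
    refine (setLIntegral_le_lintegral B _).trans ?_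
    have : (fun y => (nearAt z ρ θ).indicator (1 : E n × E n → ENNReal) (x, y)) =
        {y | (x, y) ∈ nearAt z ρ θ}.indicator 1 := rfl
    rw [this, lintegral_indicator_one]
    · exact volume_nearAt_section z x hρ hθ
    · exact (measurableSet_nearAt z ρ θ).preimage measurable_prodMk_left
  rcases le_total (1 / 2) θ with h | h
  · exact key θ h
  · rw [lintegral_lintegral_swap]
    · refine (le_of_eq ?_).trans (key (1 - θ) (by linarith))
      refine lintegral_congr fun y => lintegral_congr fun x => ?_
      have : (x, y) ∈ nearAt z ρ θ ↔ (y, x) ∈ nearAt z ρ (1 - θ) := by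
        simp only [nearAt, Set.mem_ofPred_eq, AffineMap.lineMap_apply_one_sub]
      by_cases h : (x, y) ∈ nearAt z ρ θ
      · rw [Set.indicator_of_mem h, Set.indicator_of_mem (this.1 h)]; rfl
      · rw [Set.indicator_of_notMem h, Set.indicator_of_notMem (fun h' => h (this.2 h'))]
    · exact (measurable_one.indicator (measurableSet_nearAt z ρ θ)).aemeasurable

/-- There are at most `6R/ρ` nodes, as `ρ ≤ 2R`, and each contributes `O(ρ ^ n)`. The resulting
exponent `n - 1` is that of the area of a facet of size `ρ`. -/
theorem lintegral_crossFn_le {n : ℕ} (hn : 0 < n) {R : ℝ} (hR : 0 < R) : ∃ C : ℝ, 0 < C ∧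
    ∀ (z : E n) (ρ : ℝ), 0 < ρ → ρ ≤ 2 * R → ∫⁻ x in Metric.closedBall (0 : E n) R,
      ∫⁻ y in Metric.closedBall (0 : E n) R, crossFn R z ρ (x, y) ≤
        ENNReal.ofReal (C * ρ ^ (n - 1)) := by
  set B := Metric.closedBall (0 : E n) R with hB
  set ω := volume.real (Metric.ball (0 : E n) 1)
  have hω : 0 < ω := ENNReal.toReal_pos (Metric.measure_ball_pos _ _ one_pos).ne'
    measure_ball_lt_top.ne
  have hVB : 0 < volume.real B :=
    ENNReal.toReal_pos (Metric.measure_closedBall_pos _ _ hR).ne' measure_closedBall_lt_top.ne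
  refine ⟨6 * R * (volume.real B * (4 ^ n * ω)), by positivity, fun z ρ hρ hρR => ?_⟩
  set m := ⌈2 * R / ρ⌉₊ with hm
  have h1 : ∫⁻ x in B, ∫⁻ y in B, crossFn R z ρ (x, y) =
      ∑ k ∈ Finset.range (m + 1), ∫⁻ x in B, ∫⁻ y in B,
        (nearAt z ρ (k / m)).indicator 1 (x, y) := by
    unfold crossFn
    have hme : ∀ k : ℕ, Measurable ((nearAt z ρ (k / m)).indicator (1 : E n × E n → ENNReal)) :=
      fun k => measurable_one.indicator (measurableSet_nearAt z ρ _)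
    rw [← lintegral_finsetSum]
    · refine lintegral_congr fun x => ?_
      rw [lintegral_finsetSum]
      exact fun k _ => (hme k).comp measurable_prodMk_left
    · exact fun k _ => (hme k).lintegral_prod_right'
  rw [h1]
  have hc : ((m + 1 : ℕ) : ℝ) ≤ 6 * R / ρ := by
    have := Nat.ceil_lt_add_one (show 0 ≤ 2 * R / ρ by positivity)
    have h2 : 1 ≤ 2 * R / ρ := by rwa [le_div_iff₀ hρ, one_mul]
    have h3 : 6 * R / ρ = 3 * (2 * R / ρ) := by ring
    push_cast
    rw [h3]
    linarith
  calc _ ≤ ∑ k ∈ Finset.range (m + 1),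
        volume B * (ENNReal.ofReal ((4 * ρ) ^ n) * volume (Metric.ball (0 : E n) 1)) :=
        Finset.sum_le_sum fun k _ => lintegral_nearAt_le B z hρ
    _ = ENNReal.ofReal ((m + 1 : ℕ) * (volume.real B * ((4 * ρ) ^ n * ω))) := by
        rw [Finset.sum_const, Finset.card_range, nsmul_eq_mul,
          ← ofReal_measureReal (s := B) measure_closedBall_lt_top.ne,
          ← ofReal_measureReal (s := Metric.ball (0 : E n) 1) measure_ball_lt_top.ne,
          ENNReal.ofReal_mul (by positivity), ENNReal.ofReal_mul (by positivity),
          ENNReal.ofReal_mul (by positivity), ENNReal.ofReal_natCast]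
    _ ≤ _ := by
        apply ENNReal.ofReal_le_ofReal
        calc ((m + 1 : ℕ) : ℝ) * (volume.real B * ((4 * ρ) ^ n * ω))
            ≤ 6 * R / ρ * (volume.real B * ((4 * ρ) ^ n * ω)) := by gcongr
          _ = _ := by
            obtain ⟨k, rfl⟩ : ∃ k, n = k + 1 := ⟨n - 1, by omega⟩
            rw [Nat.add_sub_cancel, mul_pow, pow_succ ρ]
            field_simp

end

end MixedDim

namespace MixedDim

open MeasureTheory

noncomputable section

/-! ### The Poincaré inequality for cellwise constant functions in `L¹` -/

/-- The mean oscillation of `u` between two sets. -/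
def osc {n : ℕ} (u : E n → ℝ) (W W' : Set (E n)) : ENNReal :=
  ∫⁻ x in W, ∫⁻ y in W', ‖u x - u y‖ₑ

namespace Mesh

variable {n : ℕ} {Ω : Set (E n)} (M : Mesh Ω)

open Classical in
/-- The jumps of a cellwise constant function, weighted with the size of the facets. -/
def jumpSum (u : Fin M.N → ℝ) : ℝ :=
  ∑ a, ∑ b, if M.Adj a b then min (M.diam a) (M.diam b) ^ (n - 1) * |u a - u b| else 0

theorem diam_nonneg (τ : Fin M.N) : 0 ≤ M.diam τ := Metric.diam_nonneg

theorem jumpSum_nonneg (u : Fin M.N → ℝ) : 0 ≤ M.jumpSum u := by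
  refine Finset.sum_nonneg fun a _ => Finset.sum_nonneg fun b _ => ?_
  split_ifs
  · exact mul_nonneg (pow_nonneg (le_min (M.diam_nonneg a) (M.diam_nonneg b)) _) (abs_nonneg _)
  · exact le_rfl

/-- A cellwise constant function. -/
def constFn (u : Fin M.N → ℝ) : E n → ℝ := M.glue fun τ _ => u τ

theorem measurable_constFn (u : Fin M.N → ℝ) : Measurable (M.constFn u) := by
  unfold constFn glue
  exact Finset.measurable_fun_sum _ fun τ _ =>
    measurable_const.indicator isOpen_interior.measurableSet

variable {M}

/-- For almost all pairs in `W` the segment stays in `closure Ω`, and the difference of values is at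
most the sum of the crossed jumps. The intersection of two cells lies within `min (diam a) (diam b)`
of any of its points, so the set of pairs crossing it has measure `O(min ^ (n - 1))`. The constant
depends only on `n` and `R`, not on `W` or the mesh. -/
theorem osc_convex_le (hn : 0 < n) {R : ℝ} (hR : 0 < R) (hΩR : closure Ω ⊆ Metric.closedBall 0 R) :
    ∃ C > 0, ∀ (M : Mesh Ω) (_ : M.FacetSystems), (∀ τ, 0 < M.diam τ) → ∀ W : Set (E n),
      MeasurableSet W → Convex ℝ W → W ⊆ closure Ω → ∀ u : Fin M.N → ℝ,
      osc (M.constFn u) W W ≤ ENNReal.ofReal (C * M.jumpSum u) := by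
  classical
  obtain ⟨C, hC, hcross⟩ := lintegral_crossFn_le hn hR
  refine ⟨C, hC, fun M D hdiam W hWm hWc hWΩ u => ?_⟩
  let z : Fin M.N → Fin M.N → E n := fun a b =>
    if h : ((M.cell a).carrier ∩ (M.cell b).carrier).Nonempty then h.some else 0
  let ρ : Fin M.N → Fin M.N → ℝ := fun a b => min (M.diam a) (M.diam b)
  have hρ0 : ∀ a b, 0 < ρ a b := fun a b => lt_min (hdiam a) (hdiam b)
  have hρR : ∀ a b, ρ a b ≤ 2 * R := by
    intro a b
    refine (min_le_left _ _).trans ?_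
    exact (Metric.diam_mono ((M.carrier_subset a).trans hΩR) Metric.isBounded_closedBall).trans
      (Metric.diam_closedBall hR.le)
  let F : E n → E n → ENNReal := fun x y => ∑ a, ∑ b, if M.Adj a b then
    ENNReal.ofReal |u a - u b| * crossFn R (z a b) (ρ a b) (x, y) else 0
  have hpt : ∀ᵐ x ∂volume.restrict W, ∀ᵐ y ∂volume.restrict W,
      ‖M.constFn u x - M.constFn u y‖ₑ ≤ F x y := by
    have h1 := ae_exists_mem_interior D
    filter_upwards [ae_restrict_of_ae (ae_segment_generic D), ae_restrict_of_ae h1,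
      ae_restrict_mem hWm] with x hgen hxi hxW
    filter_upwards [ae_restrict_of_ae hgen, ae_restrict_of_ae h1, ae_restrict_mem hWm]
      with y hgen hyi hyW
    obtain ⟨τ, hτ⟩ := hxi (hWΩ hxW)
    obtain ⟨τ', hτ'⟩ := hyi (hWΩ hyW)
    rw [constFn, glue_of_mem D _ hτ, glue_of_mem D _ hτ', Real.enorm_eq_ofReal_abs]
    have hmain := abs_sub_le_sum_crossed D (_root_.interior_subset hτ) hτ'
      (fun t ht => hWΩ (hWc.lineMap_mem hxW hyW ht)) hgen u
    refine (ENNReal.ofReal_le_ofReal hmain).trans ?_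
    have hnn : ∀ a b, 0 ≤ if M.Adj a b ∧ ∃ t ∈ Set.Icc (0 : ℝ) 1,
        AffineMap.lineMap x y t ∈ (M.cell a).carrier ∩ (M.cell b).carrier
          then |u a - u b| else 0 := by
      intro a b
      split_ifs
      · exact abs_nonneg _
      · exact le_rfl
    rw [ENNReal.ofReal_sum_of_nonneg fun a _ => Finset.sum_nonneg fun b _ => hnn a b]
    refine Finset.sum_le_sum fun a _ => ?_
    rw [ENNReal.ofReal_sum_of_nonneg fun b _ => hnn a b]
    refine Finset.sum_le_sum fun b _ => ?_
    split_ifs with h1 h2 h2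
    · obtain ⟨t, ht, hp⟩ := h1.2
      have hne : ((M.cell a).carrier ∩ (M.cell b).carrier).Nonempty := ⟨_, hp⟩
      have hz : z a b ∈ (M.cell a).carrier ∩ (M.cell b).carrier := by
        simp only [z, dif_pos hne]
        exact hne.some_mem
      have hd : dist (AffineMap.lineMap x y t) (z a b) ≤ ρ a b := by
        have hbd : ∀ a, Bornology.IsBounded (M.cell a).carrier := fun a =>
          Metric.isBounded_closedBall.subset ((M.carrier_subset a).trans hΩR)
        exact le_min (Metric.dist_le_diam_of_mem (hbd a) hp.1 hz.1)
          (Metric.dist_le_diam_of_mem (hbd b) hp.2 hz.2)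
      have := one_le_crossFn hR (hρ0 a b) (hΩR (hWΩ hxW)) (hΩR (hWΩ hyW)) ht hd
      exact le_mul_of_one_le_right zero_le this
    · exact absurd h1.1 h2
    · simp
    · simp
  have hmeas : ∀ a b, Measurable (crossFn R (z a b) (ρ a b)) := fun a b =>
    measurable_crossFn _ _ _
  calc osc (M.constFn u) W W ≤ ∫⁻ x in W, ∫⁻ y in W, F x y :=
        lintegral_mono_ae (hpt.mono fun x hx => lintegral_mono_ae hx)
    _ = ∑ a, ∑ b, if M.Adj a b then ENNReal.ofReal |u a - u b| *
          ∫⁻ x in W, ∫⁻ y in W, crossFn R (z a b) (ρ a b) (x, y) else 0 := by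
        have hm : ∀ a b, Measurable fun p : E n × E n => if M.Adj a b then
            ENNReal.ofReal |u a - u b| * crossFn R (z a b) (ρ a b) p else 0 := by
          intro a b
          split_ifs
          · exact (hmeas a b).const_mul _
          · exact measurable_const
        have hm' : ∀ a b x, Measurable fun y : E n => if M.Adj a b then
            ENNReal.ofReal |u a - u b| * crossFn R (z a b) (ρ a b) (x, y) else 0 :=
          fun a b x => (hm a b).comp measurable_prodMk_left
        simp only [F]
        have e1 : ∀ x, ∫⁻ y in W, (∑ a, ∑ b, if M.Adj a b then ENNReal.ofReal |u a - u b| *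
            crossFn R (z a b) (ρ a b) (x, y) else 0) = ∑ a, ∑ b, ∫⁻ y in W, (if M.Adj a b then
              ENNReal.ofReal |u a - u b| * crossFn R (z a b) (ρ a b) (x, y) else 0) := by
          intro x
          rw [lintegral_finsetSum]
          · refine Finset.sum_congr rfl fun a _ => ?_
            rw [lintegral_finsetSum]
            exact fun b _ => hm' a b x
          · exact fun a _ => Finset.measurable_fun_sum _ fun b _ => hm' a b x
        simp only [e1]
        rw [lintegral_finsetSum]
        · refine Finset.sum_congr rfl fun a _ => ?_
          rw [lintegral_finsetSum]
          · refine Finset.sum_congr rfl fun b _ => ?_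
            split_ifs
            · rw [← lintegral_const_mul _ (hmeas a b).lintegral_prod_right']
              refine lintegral_congr fun x => ?_
              exact lintegral_const_mul _ ((hmeas a b).comp measurable_prodMk_left)
            · simp
          · exact fun b _ => (hm a b).lintegral_prod_right'
        · exact fun a _ => Finset.measurable_fun_sum _ fun b _ => (hm a b).lintegral_prod_right'
    _ ≤ ∑ a, ∑ b, ENNReal.ofReal (if M.Adj a b then
          C * (min (M.diam a) (M.diam b) ^ (n - 1) * |u a - u b|) else 0) := by
        refine Finset.sum_le_sum fun a _ => Finset.sum_le_sum fun b _ => ?_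
        split_ifs
        · have h1 : ∫⁻ x in W, ∫⁻ y in W, crossFn R (z a b) (ρ a b) (x, y) ≤
              ENNReal.ofReal (C * ρ a b ^ (n - 1)) := by
            refine le_trans ?_ (hcross (z a b) (ρ a b) (hρ0 a b) (hρR a b))
            refine (lintegral_mono_set (hWΩ.trans hΩR)).trans ?_
            exact lintegral_mono fun x => lintegral_mono_set (hWΩ.trans hΩR)
          refine (mul_le_mul_right h1 _).trans ?_
          rw [← ENNReal.ofReal_mul (abs_nonneg _)]
          apply ENNReal.ofReal_le_ofReal
          apply le_of_eq
          simp only [ρ]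
          ring
        · simp
    _ = ENNReal.ofReal (C * M.jumpSum u) := by
        have hnn : ∀ a b, 0 ≤ if M.Adj a b then
            C * (min (M.diam a) (M.diam b) ^ (n - 1) * |u a - u b|) else 0 := by
          intro a b
          split_ifs
          · exact mul_nonneg hC.le (mul_nonneg (pow_nonneg (hρ0 a b).le _) (abs_nonneg _))
          · exact le_rfl
        rw [jumpSum, Finset.mul_sum,
          ENNReal.ofReal_sum_of_nonneg fun a _ => ?_]
        · refine Finset.sum_congr rfl fun a _ => ?_
          rw [Finset.mul_sum, ENNReal.ofReal_sum_of_nonneg fun b _ => ?_]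
          · refine Finset.sum_congr rfl fun b _ => ?_
            congr 1
            split_ifs <;> simp
          · have := hnn a b
            split_ifs at this ⊢
            · exact this
            · simp
        · rw [Finset.mul_sum]
          refine Finset.sum_nonneg fun b _ => ?_
          have := hnn a b
          split_ifs at this ⊢
          · exact this
          · simp

end Mesh

theorem osc_comm {n : ℕ} {u : E n → ℝ} (hu : Measurable u) (W W' : Set (E n)) :
    osc u W W' = osc u W' W := by
  unfold osc
  rw [lintegral_lintegral_swap]
  · refine lintegral_congr fun x => lintegral_congr fun y => ?_
    exact enorm_sub_rev _ _
  · have : Measurable fun p : E n × E n => ‖u p.1 - u p.2‖ₑ := by fun_prop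
    exact this.aemeasurable

theorem osc_mono {n : ℕ} (u : E n → ℝ) {W₁ W₂ W₁' W₂' : Set (E n)} (h : W₁ ⊆ W₂) (h' : W₁' ⊆ W₂') :
    osc u W₁ W₁' ≤ osc u W₂ W₂' :=
  (lintegral_mono_set h).trans (lintegral_mono fun _ => lintegral_mono_set h')

/-- The triangle inequality through a point `z`, averaged over `z ∈ W'`. Divided by the volume of
`W'`, it lets oscillation bounds be chained through any set of positive measure. -/
theorem volume_mul_osc_le {n : ℕ} {u : E n → ℝ} (hu : Measurable u) (W W' W'' : Set (E n)) :
    volume W' * osc u W W'' ≤ volume W'' * osc u W W' + volume W * osc u W'' W' := by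
  have hm : Measurable fun p : E n × E n => ‖u p.1 - u p.2‖ₑ := by fun_prop
  have hs : ∀ x, Measurable fun y => ‖u x - u y‖ₑ := fun x => hm.comp measurable_prodMk_left
  have hi : ∀ V : Set (E n), Measurable fun x => ∫⁻ z in V, ‖u x - u z‖ₑ := fun V =>
    hm.lintegral_prod_right'
  have hpt : ∀ x y, volume W' * ‖u x - u y‖ₑ ≤
      (∫⁻ z in W', ‖u x - u z‖ₑ) + ∫⁻ z in W', ‖u y - u z‖ₑ := by
    intro x y
    rw [← lintegral_add_left (hs x), mul_comm, ← setLIntegral_const]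
    refine lintegral_mono fun z => ?_
    have : u x - u y = (u x - u z) - (u y - u z) := by ring
    rw [this]
    exact enorm_sub_le
  calc volume W' * osc u W W''
      = ∫⁻ x in W, ∫⁻ y in W'', volume W' * ‖u x - u y‖ₑ := by
        unfold osc
        rw [← lintegral_const_mul _ (hi W'')]
        refine lintegral_congr fun x => ?_
        rw [lintegral_const_mul _ (hs x)]
    _ ≤ ∫⁻ x in W, ∫⁻ y in W'', ((∫⁻ z in W', ‖u x - u z‖ₑ) + ∫⁻ z in W', ‖u y - u z‖ₑ) :=
        lintegral_mono fun x => lintegral_mono fun y => hpt x y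
    _ = _ := by
        have : ∀ x, ∫⁻ y in W'', ((∫⁻ z in W', ‖u x - u z‖ₑ) + ∫⁻ z in W', ‖u y - u z‖ₑ) =
            volume W'' * (∫⁻ z in W', ‖u x - u z‖ₑ) + osc u W'' W' := by
          intro x
          rw [lintegral_add_left measurable_const, setLIntegral_const, mul_comm, osc]
        simp only [this]
        rw [lintegral_add_left ((hi W').const_mul _), lintegral_const_mul _ (hi W'),
          setLIntegral_const, mul_comm (osc u W'' W')]
        rfl

end

end MixedDim

/-! ### Shape regularity, and chaining of oscillation bounds over a connected domain -/

namespace MixedDim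

open MeasureTheory

noncomputable section

namespace Mesh

variable {n : ℕ} {Ω : Set (E n)}

theorem nonempty_facetSystems (hn : 0 < n) (M : Mesh Ω) : Nonempty M.FacetSystems :=
  ⟨fun τ => ((M.cell τ).nonempty_facetSystem hn).some⟩

theorem ShapeRegular.diam_pos (hn : 0 < n) (hΩ : Bornology.IsBounded Ω) {M : Mesh Ω} {σ : ℝ}
    (hM : M.ShapeRegular σ) (τ : Fin M.N) : 0 < M.diam τ := by
  obtain ⟨x, r, hr, hsub, -⟩ := hM τ
  let e : E n := EuclideanSpace.single ⟨0, hn⟩ 1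
  have he : ‖e‖ = 1 := by simp [e]
  have h1 : x + r • e ∈ (M.cell τ).carrier := hsub (by
    simp [norm_smul, he, abs_of_pos hr])
  have h2 : x ∈ (M.cell τ).carrier := hsub (Metric.mem_closedBall_self hr.le)
  have h3 := Metric.dist_le_diam_of_mem (M.isBounded_carrier hΩ τ) h1 h2
  have h4 : dist (x + r • e) x = r := by simp [norm_smul, he, abs_of_pos hr]
  rw [h4] at h3
  exact hr.trans_le h3

theorem exists_vol_ge (hn : 0 < n) (hΩ : Bornology.IsBounded Ω) (σ : ℝ) : ∃ c > 0,
    ∀ M : Mesh Ω, M.ShapeRegular σ → ∀ τ, c * M.diam τ ^ n ≤ M.vol τ := by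
  set ω := volume.real (Metric.ball (0 : E n) 1)
  have hω : 0 < ω := ENNReal.toReal_pos (Metric.measure_ball_pos _ _ one_pos).ne'
    measure_ball_lt_top.ne
  -- Nothing is assumed about the sign of `σ`; `|σ| + 1` is a positive upper bound.
  refine ⟨ω / (|σ| + 1) ^ n, by positivity, fun M hM τ => ?_⟩
  obtain ⟨x, r, hr, hsub, hd⟩ := hM τ
  have hdp := hM.diam_pos hn hΩ τ
  have h1 : ω * r ^ n ≤ M.vol τ := by
    have h2 : volume.real (Metric.closedBall x r) ≤ M.vol τ :=
      measureReal_mono hsub (M.volume_carrier_ne_top hΩ τ)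
    have h3 : volume.real (Metric.closedBall x r) = ω * r ^ n := by
      rw [Measure.real, Measure.addHaar_closedBall _ _ hr.le, ENNReal.toReal_mul,
        ENNReal.toReal_ofReal (by positivity), finrank_euclideanSpace_fin, mul_comm]
      rfl
    rwa [h3] at h2
  have h4 : M.diam τ ≤ (|σ| + 1) * r := by
    have h5 : M.diam τ ≤ σ * r := hd
    nlinarith [le_abs_self σ]
  calc ω / (|σ| + 1) ^ n * M.diam τ ^ n ≤ ω / (|σ| + 1) ^ n * ((|σ| + 1) * r) ^ n := by gcongr
    _ = ω * r ^ n := by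
      rw [mul_pow]
      field_simp
    _ ≤ _ := h1

theorem ShapeRegular.vol_pos (hn : 0 < n) (hΩ : Bornology.IsBounded Ω) {M : Mesh Ω} {σ : ℝ}
    (hM : M.ShapeRegular σ) (τ : Fin M.N) : 0 < M.vol τ := by
  obtain ⟨c, hc, h⟩ := exists_vol_ge hn hΩ σ
  exact (mul_pos hc (pow_pos (hM.diam_pos hn hΩ τ) n)).trans_le (h M hM τ)

end Mesh

section Linking

variable {n : ℕ} {Ω : Set (E n)}

/-- The oscillation between `W` and `W'` is controlled by the jumps, uniformly in the mesh. -/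
def OscBound (Ω : Set (E n)) (σ : ℝ) (W W' : Set (E n)) : Prop :=
  ∃ C : ℝ, 0 ≤ C ∧ ∀ M : Mesh Ω, M.ShapeRegular σ → ∀ u : Fin M.N → ℝ,
    osc (M.constFn u) W W' ≤ ENNReal.ofReal (C * M.jumpSum u)

theorem OscBound.symm {σ : ℝ} {W W' : Set (E n)} (h : OscBound Ω σ W W') : OscBound Ω σ W' W := by
  obtain ⟨C, hC, h⟩ := h
  exact ⟨C, hC, fun M hM u => (osc_comm (M.measurable_constFn u) _ _).trans_le (h M hM u)⟩

theorem OscBound.mono {σ : ℝ} {W₁ W₂ W₁' W₂' : Set (E n)} (h : OscBound Ω σ W₂ W₂')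
    (h1 : W₁ ⊆ W₂) (h2 : W₁' ⊆ W₂') : OscBound Ω σ W₁ W₁' := by
  obtain ⟨C, hC, h⟩ := h
  exact ⟨C, hC, fun M hM u => (osc_mono _ h1 h2).trans (h M hM u)⟩

theorem OscBound.trans {σ : ℝ} {W W' W'' : Set (E n)} (h1 : OscBound Ω σ W W')
    (h2 : OscBound Ω σ W' W'') (hpos : volume W' ≠ 0) (hW : volume W ≠ ⊤) (hW' : volume W' ≠ ⊤)
    (hW'' : volume W'' ≠ ⊤) : OscBound Ω σ W W'' := by
  obtain ⟨C1, hC1, h1⟩ := h1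
  obtain ⟨C2, hC2, h2⟩ := h2.symm
  set a := volume.real W
  set b := volume.real W'
  set c := volume.real W''
  have hb : 0 < b := ENNReal.toReal_pos hpos hW'
  refine ⟨(c * C1 + a * C2) / b, by positivity, fun M hM u => ?_⟩
  have h := volume_mul_osc_le (M.measurable_constFn u) W W' W''
  have hj := M.jumpSum_nonneg u
  have h3 : volume W' * osc (M.constFn u) W W'' ≤
      ENNReal.ofReal ((c * C1 + a * C2) * M.jumpSum u) := by
    refine h.trans ((add_le_add (mul_le_mul_right (h1 M hM u) _)
      (mul_le_mul_right (h2 M hM u) _)).trans_eq ?_)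
    rw [← ofReal_measureReal hW, ← ofReal_measureReal hW'', ← ENNReal.ofReal_mul (by positivity),
      ← ENNReal.ofReal_mul (by positivity), ← ENNReal.ofReal_add (by positivity) (by positivity)]
    congr 1
    ring
  rw [← ofReal_measureReal hW'] at h3
  have h4 : osc (M.constFn u) W W'' ≤
      (ENNReal.ofReal b)⁻¹ * ENNReal.ofReal ((c * C1 + a * C2) * M.jumpSum u) := by
    rw [← ENNReal.div_eq_inv_mul, ENNReal.le_div_iff_mul_le
      (Or.inl (by simpa using hb)) (Or.inl ENNReal.ofReal_ne_top), mul_comm]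
    exact h3
  refine h4.trans_eq ?_
  rw [← ENNReal.ofReal_inv_of_pos hb, ← ENNReal.ofReal_mul (by positivity)]
  congr 1
  ring

variable (hn : 0 < n) (hΩ : Bornology.IsBounded Ω)

include hn hΩ in
theorem oscBound_convex (σ : ℝ) {W : Set (E n)} (hWm : MeasurableSet W) (hWc : Convex ℝ W)
    (hWΩ : W ⊆ closure Ω) : OscBound Ω σ W W := by
  obtain ⟨R, hR, hsub⟩ := hΩ.closure.subset_closedBall_lt 0 0
  obtain ⟨C, hC, h⟩ := Mesh.osc_convex_le hn hR hsub
  refine ⟨C, hC.le, fun M hM u => ?_⟩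
  exact h M (Mesh.nonempty_facetSystems hn M).some (fun τ => hM.diam_pos hn hΩ τ) W hWm hWc hWΩ u

include hn hΩ in
-- The mesh `M₀` cuts `Ω` into finitely many convex pieces, each with its own oscillation bound. Two
-- pieces whose closures meet inside a ball contained in `Ω` are linked through the ball, which is
-- convex and meets both in positive measure. Connectedness links all pieces. Since `M₀` is fixed
-- while the bounds hold for every mesh `M`, the final constant does not depend on `M`.
theorem oscBound_of_connected (hopen : IsOpen Ω) (hconn : IsConnected Ω)
    (hreg : interior (closure Ω) = Ω) (σ : ℝ) (M₀ : Mesh Ω) (hM₀ : M₀.ShapeRegular σ) :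
    OscBound Ω σ Ω Ω := by
  obtain ⟨D⟩ := Mesh.nonempty_facetSystems hn M₀
  let I : Fin M₀.N → Set (E n) := fun τ => interior (M₀.cell τ).carrier
  have hfin : ∀ W ⊆ closure Ω, volume W ≠ ⊤ := fun W hW =>
    (hΩ.closure.subset hW).measure_lt_top.ne
  have hIΩ : ∀ τ, I τ ⊆ closure Ω := fun τ =>
    _root_.interior_subset.trans (M₀.carrier_subset τ)
  have hIne : ∀ τ, (I τ).Nonempty := by
    intro τ
    by_contra h
    have h1 := hM₀.vol_pos hn hΩ τ
    have h2 : interior (M₀.cell τ).carrier = ∅ := Set.not_nonempty_iff_eq_empty.1 h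
    rw [Mesh.vol_eq D τ, h2] at h1
    simp at h1
  have hII : ∀ τ, OscBound Ω σ (I τ) (I τ) := fun τ =>
    oscBound_convex hn hΩ σ isOpen_interior.measurableSet (D τ).convex.interior (hIΩ τ)
  have hcl : ∀ τ, (M₀.cell τ).carrier ⊆ closure (I τ) := by
    intro τ
    rw [(D τ).convex.closure_interior_eq_closure_of_nonempty_interior (hIne τ)]
    exact subset_closure
  have hlink : ∀ x ∈ Ω, ∀ y ∈ Ω, ∀ τ τ', x ∈ (M₀.cell τ).carrier → y ∈ (M₀.cell τ').carrier →
      OscBound Ω σ (I τ) (I τ') := by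
    intro x hx y hy
    -- The relation "all cells containing `x` are linked to all cells containing `y`" is symmetric,
    -- transitive on `Ω`, and holds for `y` near `x`; hence it holds on all of `Ω`.
    refine hconn.isPreconnected.induction₂ (fun x y => ∀ τ τ', x ∈ (M₀.cell τ).carrier →
      y ∈ (M₀.cell τ').carrier → OscBound Ω σ (I τ) (I τ')) ?_ ?_ ?_ hx hy
    · intro x hx
      obtain ⟨ε, hε, hb⟩ := Metric.isOpen_iff.1 hopen x hx
      refine mem_nhdsWithin_of_mem_nhds ?_
      filter_upwards [Metric.ball_mem_nhds x hε] with y hy τ τ' hτ hτ'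
      have hB : OscBound Ω σ (Metric.ball x ε) (Metric.ball x ε) :=
        oscBound_convex hn hΩ σ measurableSet_ball (convex_ball _ _) (hb.trans subset_closure)
      have hne : ∀ {z τ}, z ∈ Metric.ball x ε → z ∈ (M₀.cell τ).carrier →
          volume (I τ ∩ Metric.ball x ε) ≠ 0 := by
        intro z τ hz hzτ
        obtain ⟨w, hw1, hw2⟩ := mem_closure_iff.1 (hcl τ hzτ) _ Metric.isOpen_ball hz
        exact ((isOpen_interior.inter Metric.isOpen_ball).measure_pos volume ⟨w, hw2, hw1⟩).ne'
      have hf : ∀ τ, volume (I τ ∩ Metric.ball x ε) ≠ ⊤ := fun τ =>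
        hfin _ (Set.inter_subset_left.trans (hIΩ τ))
      have h1 : OscBound Ω σ (I τ) (I τ ∩ Metric.ball x ε) :=
        (hII τ).mono subset_rfl Set.inter_subset_left
      have h2 : OscBound Ω σ (I τ ∩ Metric.ball x ε) (I τ' ∩ Metric.ball x ε) :=
        hB.mono Set.inter_subset_right Set.inter_subset_right
      have h3 : OscBound Ω σ (I τ' ∩ Metric.ball x ε) (I τ') :=
        (hII τ').mono Set.inter_subset_left subset_rfl
      exact (h1.trans h2 (hne (Metric.mem_ball_self hε) hτ) (hfin _ (hIΩ τ)) (hf τ) (hf τ')).trans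
        h3 (hne hy hτ') (hfin _ (hIΩ τ)) (hf τ') (hfin _ (hIΩ τ'))
    · intro x y z _ hy _ hxy hyz τ τ' hτ hτ'
      have : y ∈ ⋃ τ, (M₀.cell τ).carrier := by
        rw [M₀.iUnion_cell]; exact subset_closure hy
      obtain ⟨τ₁, h₁⟩ := Set.mem_iUnion.1 this
      exact (hxy τ τ₁ hτ h₁).trans (hyz τ₁ τ' h₁ hτ')
        (isOpen_interior.measure_pos volume (hIne τ₁)).ne'
        (hfin _ (hIΩ τ)) (hfin _ (hIΩ τ₁)) (hfin _ (hIΩ τ'))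
    · intro x y _ _ h τ τ' hτ hτ'
      exact (h τ' τ hτ' hτ).symm
  have hall : ∀ τ τ', OscBound Ω σ (I τ) (I τ') := by
    intro τ τ'
    obtain ⟨x, hx⟩ := hIne τ
    obtain ⟨y, hy⟩ := hIne τ'
    exact hlink x (M₀.interior_subset hreg τ hx) y (M₀.interior_subset hreg τ' hy) τ τ'
      (_root_.interior_subset hx) (_root_.interior_subset hy)
  choose C hC hCb using hall
  refine ⟨∑ τ, ∑ τ', C τ τ', Finset.sum_nonneg fun τ _ => Finset.sum_nonneg fun τ' _ => hC τ τ',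
    fun M hM u => ?_⟩
  have hj := M.jumpSum_nonneg u
  have h1 : osc (M.constFn u) Ω Ω = ∑ τ, ∑ τ', osc (M.constFn u) (I τ) (I τ') := by
    unfold osc
    rw [Mesh.lintegral_eq_sum D hreg]
    refine Finset.sum_congr rfl fun τ _ => ?_
    have hm : Measurable fun p : E n × E n => ‖M.constFn u p.1 - M.constFn u p.2‖ₑ := by
      have := M.measurable_constFn u
      fun_prop
    rw [← lintegral_finsetSum _ fun τ' _ => hm.lintegral_prod_right']
    refine lintegral_congr fun x => ?_
    rw [Mesh.lintegral_eq_sum D hreg]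
  rw [h1, Finset.sum_mul, ENNReal.ofReal_sum_of_nonneg]
  · refine Finset.sum_le_sum fun τ _ => ?_
    rw [Finset.sum_mul, ENNReal.ofReal_sum_of_nonneg]
    · exact Finset.sum_le_sum fun τ' _ => hCb τ τ' M hM u
    · exact fun τ' _ => mul_nonneg (hC τ τ') hj
  · exact fun τ _ => mul_nonneg (Finset.sum_nonneg fun τ' _ => hC τ τ') hj

include hn hΩ in
/-- The Poincaré inequality for cellwise constant functions in `L¹`. -/
theorem exists_l1_poincare (hopen : IsOpen Ω) (hconn : IsConnected Ω)
    (hreg : interior (closure Ω) = Ω) (σ : ℝ) : ∃ C > 0, ∀ M : Mesh Ω, M.ShapeRegular σ →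
      ∀ u : Fin M.N → ℝ, ∑ τ, ∑ τ', M.vol τ * M.vol τ' * |u τ - u τ'| ≤ C * M.jumpSum u := by
  -- A reference mesh is needed only to decompose `Ω`. It can be chosen depending on `Ω` and `σ`
  -- alone; if none exists, there is nothing to prove.
  by_cases hex : ∃ M₀ : Mesh Ω, M₀.ShapeRegular σ
  swap
  · exact ⟨1, one_pos, fun M hM => absurd ⟨M, hM⟩ hex⟩
  obtain ⟨M₀, hM₀⟩ := hex
  obtain ⟨C, hC, h⟩ := oscBound_of_connected hn hΩ hopen hconn hreg σ M₀ hM₀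
  refine ⟨C + 1, by positivity, fun M hM u => ?_⟩
  obtain ⟨D⟩ := Mesh.nonempty_facetSystems hn M
  have hj := M.jumpSum_nonneg u
  have h1 := h M hM u
  have hv : ∀ τ, volume (interior (M.cell τ).carrier) = ENNReal.ofReal (M.vol τ) := by
    intro τ
    rw [Mesh.vol_eq D τ, ofReal_measureReal ((measure_mono _root_.interior_subset).trans_lt
      (M.volume_carrier_ne_top hΩ τ).lt_top).ne]
  have h2 : osc (M.constFn u) Ω Ω =
      ENNReal.ofReal (∑ τ, ∑ τ', M.vol τ * M.vol τ' * |u τ - u τ'|) := by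
    have hnn : ∀ τ τ', 0 ≤ M.vol τ * M.vol τ' * |u τ - u τ'| := fun τ τ' =>
      mul_nonneg (mul_nonneg (M.vol_nonneg τ) (M.vol_nonneg τ')) (abs_nonneg _)
    rw [osc, Mesh.lintegral_eq_sum D hreg, ENNReal.ofReal_sum_of_nonneg
      fun τ _ => Finset.sum_nonneg fun τ' _ => hnn τ τ']
    refine Finset.sum_congr rfl fun τ _ => ?_
    rw [ENNReal.ofReal_sum_of_nonneg fun τ' _ => hnn τ τ']
    have h3 : ∀ x ∈ interior (M.cell τ).carrier, ∫⁻ y in Ω, ‖M.constFn u x - M.constFn u y‖ₑ =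
        ∑ τ', ENNReal.ofReal |u τ - u τ'| * ENNReal.ofReal (M.vol τ') := by
      intro x hx
      rw [Mesh.lintegral_eq_sum D hreg]
      refine Finset.sum_congr rfl fun τ' _ => ?_
      rw [← hv τ', ← setLIntegral_const]
      refine setLIntegral_congr_fun isOpen_interior.measurableSet fun y hy => ?_
      simp only [Mesh.constFn]
      rw [Mesh.glue_of_mem D _ hx, Mesh.glue_of_mem D _ hy, Real.enorm_eq_ofReal_abs]
    rw [setLIntegral_congr_fun isOpen_interior.measurableSet h3, setLIntegral_const, hv,
      Finset.sum_mul]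
    refine Finset.sum_congr rfl fun τ' _ => ?_
    rw [← ENNReal.ofReal_mul (abs_nonneg _), ← ENNReal.ofReal_mul
      (mul_nonneg (abs_nonneg _) (M.vol_nonneg τ'))]
    congr 1
    ring
  rw [h2] at h1
  have h4 := (ENNReal.ofReal_le_ofReal_iff (mul_nonneg hC hj)).1 h1
  nlinarith

end Linking

end

end MixedDim

namespace MixedDim

noncomputable section

/-! ### Weighted graphs: from `L¹` to `L²`, and the graph Laplacian -/

/-- Intermediate values in `c`: the sum is nonnegative for `c` far to the left and nonpositive far
to the right. This normalization is the one adapted to the signed square, to which the `L¹`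
inequality is applied. -/
theorem exists_signedSq_mean_zero {ι : Type*} [Fintype ι] (v p : ι → ℝ)
    (hv : ∀ a, 0 ≤ v a) : ∃ c, ∑ a, v a * ((p a - c) * |p a - c|) = 0 := by
  let F : ℝ → ℝ := fun c => ∑ a, v a * ((p a - c) * |p a - c|)
  have hF : Continuous F := by
    refine continuous_finsetSum _ fun a _ => ?_
    fun_prop
  let B := ∑ a, |p a|
  have hB : ∀ a, |p a| ≤ B := fun a =>
    Finset.single_le_sum (fun b _ => abs_nonneg (p b)) (Finset.mem_univ a)
  have hB0 : 0 ≤ B := Finset.sum_nonneg fun _ _ => abs_nonneg _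
  have h1 : 0 ≤ F (-B) := by
    refine Finset.sum_nonneg fun a _ => mul_nonneg (hv a) (mul_nonneg ?_ (abs_nonneg _))
    have := neg_abs_le (p a)
    linarith [hB a]
  have h2 : F B ≤ 0 := by
    refine Finset.sum_nonpos fun a _ => mul_nonpos_of_nonneg_of_nonpos (hv a)
      (mul_nonpos_of_nonpos_of_nonneg ?_ (abs_nonneg _))
    have := le_abs_self (p a)
    linarith [hB a]
  obtain ⟨c, -, hc⟩ := intermediate_value_Icc' (by linarith : -B ≤ B) hF.continuousOn
    (show (0 : ℝ) ∈ Set.Icc (F B) (F (-B)) from ⟨h2, h1⟩)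
  exact ⟨c, hc⟩

theorem abs_signedSq_sub_le (a b : ℝ) : |(a * |a| - b * |b|)| ≤ |a - b| * (|a| + |b|) := by
  rcases abs_cases a with ⟨h1, h1'⟩ | ⟨h1, h1'⟩ <;> rcases abs_cases b with ⟨h2, h2'⟩ | ⟨h2, h2'⟩ <;>
    rcases abs_cases (a - b) with ⟨h3, h3'⟩ | ⟨h3, h3'⟩ <;> rw [h1, h2, h3, abs_le] <;>
    constructor <;> nlinarith

open Classical in
-- With `q = p - m` the signed square `u = q|q|` has mean zero, so the double sum of the `|u a - u
-- b|` dominates `V ∑ v q²`. Its jumps satisfy `|u a - u b| ≤ |p a - p b| (|q a| + |q b|)`. Young's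
-- inequality splits the product into the energy with weight `h ^ k` and a multiple of `h ^ (k + 2)
-- q²`. The latter is at most `v q² / c`, occurs at most `Δ` times per cell, and is absorbed. Here
-- `k + 2` plays the part of the dimension.
theorem exists_l2_poincare_of_l1 {ι : Type*} [Fintype ι] {k : ℕ} (v h : ι → ℝ)
    (adj : ι → ι → Prop) (hsymm : ∀ a b, adj a b → adj b a) {c C Δ V : ℝ} (hc : 0 < c)
    (hC : 0 < C) (hΔ : 0 < Δ) (hV : 0 < V) (hVs : ∑ a, v a = V) (hh : ∀ a, 0 < h a)
    (hv : ∀ a, c * h a ^ (k + 2) ≤ v a)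
    (hdeg : ∀ a, ((Finset.univ.filter fun b => adj a b).card : ℝ) ≤ Δ)
    (hL1 : ∀ u : ι → ℝ, ∑ a, ∑ b, v a * v b * |u a - u b| ≤
      C * ∑ a, ∑ b, if adj a b then min (h a) (h b) ^ (k + 1) * |u a - u b| else 0)
    (p : ι → ℝ) : ∃ m, ∑ a, v a * (p a - m) ^ 2 ≤
      4 * Δ * C ^ 2 / (V ^ 2 * c) *
        ∑ a, ∑ b, if adj a b then min (h a) (h b) ^ k * (p a - p b) ^ 2 else 0 := by
  have hv0 : ∀ a, 0 ≤ v a := fun a => le_trans (by have := hh a; positivity) (hv a)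
  obtain ⟨m, hm⟩ := exists_signedSq_mean_zero v p hv0
  refine ⟨m, ?_⟩
  set q : ι → ℝ := fun a => p a - m with hq
  set u : ι → ℝ := fun a => q a * |q a| with hu
  set S := ∑ a, v a * q a ^ 2 with hS
  set En := ∑ a, ∑ b, if adj a b then min (h a) (h b) ^ k * (p a - p b) ^ 2 else 0 with hEn
  have h1 : V * S ≤ ∑ a, ∑ b, v a * v b * |u a - u b| := by
    rw [hS, Finset.mul_sum]
    refine Finset.sum_le_sum fun a _ => ?_
    have h2 : V * u a = ∑ b, v b * (u a - u b) := by
      simp only [mul_sub, Finset.sum_sub_distrib]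
      rw [← Finset.sum_mul, hVs]
      have : ∑ b, v b * u b = 0 := hm
      rw [this, sub_zero]
    have h3 : V * |u a| ≤ ∑ b, v b * |u a - u b| := by
      calc V * |u a| = |V * u a| := by rw [abs_mul V (u a), abs_of_pos hV]
        _ ≤ ∑ b, |v b * (u a - u b)| := by rw [h2]; exact Finset.abs_sum_le_sum_abs _ _
        _ = _ := Finset.sum_congr rfl fun b _ => by rw [abs_mul, abs_of_nonneg (hv0 b)]
    have h4 : |u a| = q a ^ 2 := by
      rw [hu]
      simp only [abs_mul, abs_abs]
      rw [← sq, sq_abs]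
    calc V * (v a * q a ^ 2) = v a * (V * |u a|) := by rw [h4]; ring
      _ ≤ v a * ∑ b, v b * |u a - u b| := mul_le_mul_of_nonneg_left h3 (hv0 a)
      _ = _ := by rw [Finset.mul_sum]; exact Finset.sum_congr rfl fun b _ => by ring
  -- Chosen so that the absorbed term `C ε (2Δ/c) S` is exactly half of `V S`.
  set ε := V * c / (4 * Δ * C) with hε
  have hε0 : 0 < ε := by positivity
  have hY : ∀ a b, adj a b → min (h a) (h b) ^ (k + 1) * |u a - u b| ≤
      1 / (2 * ε) * (min (h a) (h b) ^ k * (p a - p b) ^ 2) +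
        ε * (h a ^ (k + 2) * q a ^ 2 + h b ^ (k + 2) * q b ^ 2) := by
    intro a b _
    set ρ := min (h a) (h b) with hρ
    have hρ0 : 0 < ρ := lt_min (hh a) (hh b)
    have e1 : |u a - u b| ≤ |p a - p b| * (|q a| + |q b|) := by
      have := abs_signedSq_sub_le (q a) (q b)
      have e : q a - q b = p a - p b := by simp [hq]
      rwa [e] at this
    set x := |p a - p b|
    set y := |q a| + |q b|
    have e2 : ρ ^ (k + 1) * (x * y) ≤ 1 / (2 * ε) * (ρ ^ k * x ^ 2) + ε / 2 * (ρ ^ (k + 2) * y ^ 2) := by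
      have : 1 / (2 * ε) * (ρ ^ k * x ^ 2) + ε / 2 * (ρ ^ (k + 2) * y ^ 2) - ρ ^ (k + 1) * (x * y) =
          ρ ^ k / (2 * ε) * (x - ε * ρ * y) ^ 2 := by
        field_simp
        ring
      have : 0 ≤ ρ ^ k / (2 * ε) * (x - ε * ρ * y) ^ 2 := by positivity
      linarith
    have e3 : y ^ 2 ≤ 2 * (q a ^ 2 + q b ^ 2) := by
      have : y ^ 2 = q a ^ 2 + q b ^ 2 + 2 * (|q a| * |q b|) := by
        simp only [y, add_sq, sq_abs]; ring
      have h5 := sq_nonneg (|q a| - |q b|)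
      rw [sub_sq, sq_abs, sq_abs] at h5
      linarith
    have e4 : ρ ^ (k + 2) ≤ h a ^ (k + 2) := pow_le_pow_left₀ hρ0.le (min_le_left _ _) _
    have e5 : ρ ^ (k + 2) ≤ h b ^ (k + 2) := pow_le_pow_left₀ hρ0.le (min_le_right _ _) _
    have e6 : ρ ^ (k + 2) * y ^ 2 ≤ 2 * (h a ^ (k + 2) * q a ^ 2 + h b ^ (k + 2) * q b ^ 2) := by
      calc ρ ^ (k + 2) * y ^ 2 ≤ ρ ^ (k + 2) * (2 * (q a ^ 2 + q b ^ 2)) := by gcongr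
        _ = 2 * (ρ ^ (k + 2) * q a ^ 2 + ρ ^ (k + 2) * q b ^ 2) := by ring
        _ ≤ _ := by gcongr
    calc ρ ^ (k + 1) * |u a - u b| ≤ ρ ^ (k + 1) * (x * y) := by gcongr
      _ ≤ _ := e2
      _ ≤ 1 / (2 * ε) * (ρ ^ k * x ^ 2) + ε / 2 *
          (2 * (h a ^ (k + 2) * q a ^ 2 + h b ^ (k + 2) * q b ^ 2)) := by gcongr
      _ = _ := by rw [sq_abs]; ring
  have hdeg' : ∑ a, ∑ b, (if adj a b then h a ^ (k + 2) * q a ^ 2 else 0) ≤ Δ / c * S := by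
    rw [hS, Finset.mul_sum]
    refine Finset.sum_le_sum fun a _ => ?_
    rw [← Finset.sum_filter, Finset.sum_const, nsmul_eq_mul]
    have h6 : h a ^ (k + 2) ≤ v a / c := by
      rw [le_div_iff₀ hc, mul_comm]; exact hv a
    calc _ ≤ Δ * (v a / c * q a ^ 2) := by
          apply mul_le_mul (hdeg a) _ _ hΔ.le
          · gcongr
          · have := hh a
            positivity
      _ = _ := by ring
  have hdeg'' : ∑ a, ∑ b, (if adj a b then h b ^ (k + 2) * q b ^ 2 else 0) ≤ Δ / c * S := by
    rw [Finset.sum_comm]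
    refine le_trans (le_of_eq ?_) hdeg'
    refine Finset.sum_congr rfl fun a _ => Finset.sum_congr rfl fun b _ => ?_
    exact if_congr ⟨hsymm _ _, hsymm _ _⟩ rfl rfl
  have h2 : ∑ a, ∑ b, (if adj a b then min (h a) (h b) ^ (k + 1) * |u a - u b| else 0) ≤
      1 / (2 * ε) * En + ε * (2 * (Δ / c * S)) := by
    calc _ ≤ ∑ a, ∑ b, (1 / (2 * ε) * (if adj a b then min (h a) (h b) ^ k * (p a - p b) ^ 2 else 0) +
          ε * ((if adj a b then h a ^ (k + 2) * q a ^ 2 else 0) +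
            if adj a b then h b ^ (k + 2) * q b ^ 2 else 0)) := by
          refine Finset.sum_le_sum fun a _ => Finset.sum_le_sum fun b _ => ?_
          split_ifs with hab
          · exact hY a b hab
          · simp
      _ = 1 / (2 * ε) * En + ε * (∑ a, ∑ b, (if adj a b then h a ^ (k + 2) * q a ^ 2 else 0) +
            ∑ a, ∑ b, if adj a b then h b ^ (k + 2) * q b ^ 2 else 0) := by
          simp only [Finset.sum_add_distrib, ← Finset.mul_sum, hEn]
      _ ≤ _ := by
          gcongr
          linarith
  have h3 : V * S ≤ C * (1 / (2 * ε) * En + ε * (2 * (Δ / c * S))) :=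
    h1.trans ((hL1 u).trans (mul_le_mul_of_nonneg_left h2 hC.le))
  have e1 : C * (ε * (2 * (Δ / c * S))) = V / 2 * S := by
    rw [hε]; field_simp; ring
  have e2 : C * (1 / (2 * ε) * En) = V / 2 * (4 * Δ * C ^ 2 / (V ^ 2 * c) * En) := by
    rw [hε]; field_simp
  have h4 : V / 2 * S ≤ V / 2 * (4 * Δ * C ^ 2 / (V ^ 2 * c) * En) := by
    rw [← e2]
    have : V * S = V / 2 * S + V / 2 * S := by ring
    rw [mul_add, e1] at h3
    linarith
  exact le_of_mul_le_mul_left h4 (by positivity)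

/-- Solvability of the weighted graph Laplace problem with an energy bound. -/
theorem exists_graph_potential {ι : Type*} [Fintype ι] (v : ι → ℝ) (hv : ∀ a, 0 < v a)
    (w : ι → ι → ℝ) (hws : ∀ a b, w a b = w b a) (hw : ∀ a b, 0 ≤ w a b) {CP : ℝ} (hCP : 0 < CP)
    (hP : ∀ p : ι → ℝ, ∃ m, ∑ a, v a * (p a - m) ^ 2 ≤ CP * ∑ a, ∑ b, w a b * (p a - p b) ^ 2)
    (f : ι → ℝ) (hf : ∑ a, v a * f a = 0) :
    ∃ p : ι → ℝ, (∀ a, ∑ b, w a b * (p a - p b) = v a * f a) ∧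
      ∑ a, ∑ b, w a b * (p a - p b) ^ 2 ≤ 4 * CP * ∑ a, v a * f a ^ 2 := by
  have hparts : ∀ p : ι → ℝ, ∑ a, ∑ b, w a b * (p a - p b) ^ 2 =
      2 * ∑ a, p a * ∑ b, w a b * (p a - p b) := by
    intro p
    have h1 : ∑ a, ∑ b, w a b * (p a - p b) * p b = - ∑ a, ∑ b, w a b * (p a - p b) * p a := by
      rw [Finset.sum_comm, ← Finset.sum_neg_distrib]
      refine Finset.sum_congr rfl fun a _ => ?_
      rw [← Finset.sum_neg_distrib]
      refine Finset.sum_congr rfl fun b _ => ?_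
      rw [hws b a]; ring
    calc _ = ∑ a, ∑ b, (w a b * (p a - p b) * p a - w a b * (p a - p b) * p b) :=
          Finset.sum_congr rfl fun a _ => Finset.sum_congr rfl fun b _ => by ring
      _ = 2 * ∑ a, ∑ b, w a b * (p a - p b) * p a := by
          simp only [Finset.sum_sub_distrib]
          rw [h1]; ring
      _ = _ := by
          congr 1
          refine Finset.sum_congr rfl fun a _ => ?_
          rw [Finset.mul_sum]
          exact Finset.sum_congr rfl fun b _ => by ring
  have hanti : ∀ p : ι → ℝ, ∑ a, ∑ b, w a b * (p a - p b) = 0 := by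
    intro p
    have h1 : ∑ a, ∑ b, w a b * (p a - p b) = - ∑ a, ∑ b, w a b * (p a - p b) := by
      conv_lhs => rw [Finset.sum_comm]
      rw [← Finset.sum_neg_distrib]
      refine Finset.sum_congr rfl fun a _ => ?_
      rw [← Finset.sum_neg_distrib]
      refine Finset.sum_congr rfl fun b _ => ?_
      rw [hws b a]; ring
    linarith
  by_cases hne : Nonempty ι
  swap
  · rw [not_nonempty_iff] at hne
    exact ⟨0, fun a => hne.elim a, by simp⟩
  have hVpos : 0 < ∑ a, v a := Finset.sum_pos (fun a _ => hv a) Finset.univ_nonempty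
  -- The rank-one term removes the constants from the kernel of the Laplacian and so makes `A`
  -- bijective. For data of mean zero the solution has mean zero too, and the added term disappears.
  let A : (ι → ℝ) →ₗ[ℝ] (ι → ℝ) :=
    { toFun := fun p a => ∑ b, w a b * (p a - p b) + v a * ∑ b, v b * p b
      map_add' := fun p q => by
        funext a
        simp only [Pi.add_apply, mul_add, Finset.sum_add_distrib, mul_sub, Finset.sum_sub_distrib]
        ring
      map_smul' := fun t p => by
        funext a
        simp only [Pi.smul_apply, smul_eq_mul, RingHom.id_apply, mul_add, Finset.mul_sum]
        congr 1
        · exact Finset.sum_congr rfl fun b _ => by ring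
        · exact Finset.sum_congr rfl fun b _ => by ring }
  have hinj : Function.Injective A := by
    rw [← LinearMap.ker_eq_bot, LinearMap.ker_eq_bot']
    intro p hp
    have hpa : ∀ a, ∑ b, w a b * (p a - p b) + v a * ∑ b, v b * p b = 0 := fun a => congrFun hp a
    have h0 : ∑ a, p a * (∑ b, w a b * (p a - p b) + v a * ∑ b, v b * p b) = 0 := by
      simp [hpa]
    have h1 : ∑ a, p a * ∑ b, w a b * (p a - p b) + (∑ b, v b * p b) ^ 2 = 0 := by
      rw [← h0]
      simp only [mul_add, Finset.sum_add_distrib]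
      congr 1
      rw [sq, Finset.sum_mul]
      exact Finset.sum_congr rfl fun a _ => by ring
    have h2 := hparts p
    have h3 : 0 ≤ ∑ a, ∑ b, w a b * (p a - p b) ^ 2 :=
      Finset.sum_nonneg fun a _ => Finset.sum_nonneg fun b _ => mul_nonneg (hw a b) (sq_nonneg _)
    have h4 : (∑ b, v b * p b) ^ 2 = 0 := by nlinarith [sq_nonneg (∑ b, v b * p b)]
    have h5 : ∑ a, ∑ b, w a b * (p a - p b) ^ 2 = 0 := by linarith
    obtain ⟨m, hm⟩ := hP p
    rw [h5, mul_zero] at hm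
    have h6 : ∀ a, p a = m := by
      intro a
      have h7 := (Finset.sum_eq_zero_iff_of_nonneg fun a _ =>
        mul_nonneg (hv a).le (sq_nonneg (p a - m))).1
        (le_antisymm hm (Finset.sum_nonneg fun a _ => mul_nonneg (hv a).le (sq_nonneg _)))
        a (Finset.mem_univ a)
      have := (mul_eq_zero.1 h7).resolve_left (hv a).ne'
      linarith [pow_eq_zero_iff (two_ne_zero) |>.1 this]
    have h8 : (∑ b, v b) * m = 0 := by
      rw [Finset.sum_mul]
      have := pow_eq_zero_iff (two_ne_zero) |>.1 h4
      rw [← this]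
      exact Finset.sum_congr rfl fun b _ => by rw [h6 b]
    have h9 := (mul_eq_zero.1 h8).resolve_left hVpos.ne'
    funext a
    rw [h6 a, h9]; rfl
  obtain ⟨p, hp⟩ := (LinearMap.injective_iff_surjective.1 hinj) fun a => v a * f a
  have hpa : ∀ a, ∑ b, w a b * (p a - p b) + v a * ∑ b, v b * p b = v a * f a :=
    fun a => congrFun hp a
  have hmean : ∑ b, v b * p b = 0 := by
    have h1 : ∑ a, (∑ b, w a b * (p a - p b) + v a * ∑ b, v b * p b) = 0 := by
      rw [← hf]; exact Finset.sum_congr rfl fun a _ => hpa a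
    rw [Finset.sum_add_distrib, hanti, zero_add, ← Finset.sum_mul] at h1
    exact (mul_eq_zero.1 h1).resolve_left hVpos.ne'
  have hLap : ∀ a, ∑ b, w a b * (p a - p b) = v a * f a := by
    intro a
    have := hpa a
    rwa [hmean, mul_zero, add_zero] at this
  refine ⟨p, hLap, ?_⟩
  obtain ⟨m, hm⟩ := hP p
  set En := ∑ a, ∑ b, w a b * (p a - p b) ^ 2 with hEn
  have h1 : En = 2 * ∑ a, v a * f a * (p a - m) := by
    rw [hEn, hparts p]
    congr 1
    have e : ∑ a, v a * f a * (p a - m) = ∑ a, v a * f a * p a - (∑ a, v a * f a) * m := by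
      rw [Finset.sum_mul, ← Finset.sum_sub_distrib]
      exact Finset.sum_congr rfl fun a _ => by ring
    rw [e, hf, zero_mul, sub_zero]
    exact Finset.sum_congr rfl fun a _ => by rw [hLap a]; ring
  -- Young's inequality, with the weight for which the Poincaré inequality turns the second term
  -- into `En / 2`.
  have h2 : En ≤ 2 * CP * ∑ a, v a * f a ^ 2 + 1 / (2 * CP) * ∑ a, v a * (p a - m) ^ 2 := by
    rw [h1, Finset.mul_sum, Finset.mul_sum, Finset.mul_sum, ← Finset.sum_add_distrib]
    refine Finset.sum_le_sum fun a _ => ?_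
    have : 2 * CP * (v a * f a ^ 2) + 1 / (2 * CP) * (v a * (p a - m) ^ 2) -
        2 * (v a * f a * (p a - m)) = v a / (2 * CP) * (2 * CP * f a - (p a - m)) ^ 2 := by
      field_simp
      ring
    have : 0 ≤ v a / (2 * CP) * (2 * CP * f a - (p a - m)) ^ 2 := by
      have := hv a
      positivity
    linarith
  have h3 : 1 / (2 * CP) * ∑ a, v a * (p a - m) ^ 2 ≤ En / 2 := by
    calc _ ≤ 1 / (2 * CP) * (CP * En) := by gcongr
      _ = _ := by field_simp
  linarith

end

end MixedDim

namespace MixedDim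

open MeasureTheory

noncomputable section

/-! ### Raviart-Thomas fields with prescribed divergence -/

theorem divergence_affine {n : ℕ} (A : E n →ᵃ[ℝ] E n) (x : E n) :
    divergence A x = LinearMap.trace ℝ (E n) A.linear := by
  have h : HasFDerivAt A (LinearMap.toContinuousLinearMap A.linear) x := by
    have h1 : (A : E n → E n) = fun y => LinearMap.toContinuousLinearMap A.linear y + A 0 := by
      funext y
      exact congrFun A.decomp y
    rw [h1]
    exact (LinearMap.toContinuousLinearMap A.linear).hasFDerivAt.add_const _
  rw [divergence, h.fderiv]
  rfl

/-- The discrete divergence on `rt0Zero` has right inverses that are bounded uniformly in the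
mesh. -/
def UniformRightInverse {n : ℕ} (Ω : Set (E n)) (σ : ℝ) : Prop :=
  ∃ C > 0, ∀ M : Mesh Ω, M.ShapeRegular σ → ∀ f : Fin M.N → ℝ, ∑ τ, M.vol τ * f τ = 0 →
    ∃ q ∈ M.rt0Zero, (∀ τ x, divergence (q τ) x = f τ) ∧
      ∑ τ, ∫ x in (M.cell τ).carrier, ‖q τ x‖ ^ 2 ≤ C * ∑ τ, M.vol τ * f τ ^ 2

namespace Mesh

variable {n : ℕ} {Ω : Set (E n)} {M : Mesh Ω} (D : M.FacetSystems)

/-- The index of the facet of `τ` shared with a neighbour. -/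
def sharedIdx {τ τ' : Fin M.N} (h : M.Adj τ τ') : (D τ).ι := ((D τ).exists_facet h.2.1).choose

theorem facet_sharedIdx {τ τ' : Fin M.N} (h : M.Adj τ τ') :
    (D τ).facet (sharedIdx D h) = (M.cell τ).carrier ∩ (M.cell τ').carrier :=
  ((D τ).exists_facet h.2.1).choose_spec

theorem sharedIdx_injective {τ τ₁ τ₂ : Fin M.N} (h₁ : M.Adj τ τ₁) (h₂ : M.Adj τ τ₂)
    (h : sharedIdx D h₁ = sharedIdx D h₂) : τ₁ = τ₂ := by
  refine eq_of_facet_eq D h₁.1 h₂.1 (i := sharedIdx D h₁) (j₁ := sharedIdx D h₁.symm)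
    (j₂ := sharedIdx D h₂.symm) ?_ ?_
  · rw [facet_sharedIdx, facet_sharedIdx, Set.inter_comm]
  · rw [h, facet_sharedIdx, facet_sharedIdx, Set.inter_comm]

open Classical in
include D in
theorem card_adj_le (τ : Fin M.N) :
    ((Finset.univ.filter fun τ' => M.Adj τ τ').card : ℝ) ≤ 2 * n := by
  have h1 : (Finset.univ.filter fun τ' => M.Adj τ τ').card ≤ Fintype.card (D τ).ι := by
    rw [← Fintype.card_coe]
    refine Fintype.card_le_of_injective
      (fun τ' => sharedIdx D (Finset.mem_filter.1 τ'.2).2) fun a b h => ?_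
    exact Subtype.ext (sharedIdx_injective D _ _ h)
  exact_mod_cast h1.trans (D τ).card_le

open Classical in
/-- The basis field of the facet of `τ` shared with `τ'`. -/
def sharedField (τ τ' : Fin M.N) : E n →ᵃ[ℝ] E n :=
  if h : M.Adj τ τ' then (D τ).φ (sharedIdx D h) else 0

/-- The field with outward flux `F τ τ'` from the cell `τ` to its neighbours `τ'`. -/
def fluxField (F : Fin M.N → Fin M.N → ℝ) (τ : Fin M.N) : E n →ᵃ[ℝ] E n :=
  -- A basis field has total flux `d * vol` through its facet; division by it normalizes the flux to
  -- `F τ τ'`.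
  ∑ τ', (F τ τ' / ((D τ).d * M.vol τ)) • sharedField D τ τ'

theorem fluxField_apply (F : Fin M.N → Fin M.N → ℝ) (τ : Fin M.N) (x : E n) :
    fluxField D F τ x = ∑ τ', (F τ τ' / ((D τ).d * M.vol τ)) • sharedField D τ τ' x := by
  unfold fluxField
  induction (Finset.univ : Finset (Fin M.N)) using Finset.induction_on with
  | empty => simp
  | insert a s ha ih =>
    rw [Finset.sum_insert ha, Finset.sum_insert ha, ← ih]
    rfl

theorem fluxField_linear (F : Fin M.N → Fin M.N → ℝ) (τ : Fin M.N) :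
    (fluxField D F τ).linear =
      ∑ τ', (F τ τ' / ((D τ).d * M.vol τ)) • (sharedField D τ τ').linear := by
  unfold fluxField
  induction (Finset.univ : Finset (Fin M.N)) using Finset.induction_on with
  | empty => simp
  | insert a s ha ih =>
    rw [Finset.sum_insert ha, Finset.sum_insert ha, ← ih]
    rfl

theorem normal_sharedField {τ τ' : Fin M.N} (h : M.Adj τ τ') {j : (D τ).ι} {x : E n}
    (hx : (D τ).g j x = 0) : ((D τ).g j).linear (sharedField D τ τ' x) =
      if sharedIdx D h = j then -1 else 0 := by
  rw [sharedField, dif_pos h, (D τ).φ_normal _ _ _ hx]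

theorem normal_fluxField_of_adj (F : Fin M.N → Fin M.N → ℝ)
    {τ τ₁ : Fin M.N} (h₁ : M.Adj τ τ₁) {x : E n} (hx : x ∈ (D τ).facet (sharedIdx D h₁)) :
    ((D τ).g (sharedIdx D h₁)).linear (fluxField D F τ x) =
      -(F τ τ₁ / ((D τ).d * M.vol τ)) := by
  rw [fluxField_apply, map_sum, Finset.sum_eq_single τ₁]
  · rw [map_smul, normal_sharedField D h₁ hx.2, if_pos rfl, smul_eq_mul, mul_neg, mul_one]
  · intro τ' _ hne
    by_cases h : M.Adj τ τ'
    · rw [map_smul, normal_sharedField D h hx.2, if_neg, smul_zero]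
      exact fun h' => hne (sharedIdx_injective D _ _ h')
    · simp [sharedField, h]
  · simp

theorem normal_fluxField_of_not_adj (F : Fin M.N → Fin M.N → ℝ)
    {τ : Fin M.N} {j : (D τ).ι} (hj : ∀ τ' (h : M.Adj τ τ'), sharedIdx D h ≠ j) {x : E n}
    (hx : x ∈ (D τ).facet j) : ((D τ).g j).linear (fluxField D F τ x) = 0 := by
  rw [fluxField_apply, map_sum]
  refine Finset.sum_eq_zero fun τ' _ => ?_
  by_cases h : M.Adj τ τ'
  · rw [map_smul, normal_sharedField D h hx.2, if_neg (hj τ' h), smul_zero]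
  · simp [sharedField, h]

/-- Seen from two adjacent cells, a common facet has proportional functionals with a negative
factor. That sign is compensated by the antisymmetry of `F`, and the size of the factor by the
equality of the two area computations. A facet in `∂Ω` is not shared, so no basis field used has
flux through it. -/
theorem fluxField_mem (hΩ : Bornology.IsBounded Ω) (hopen : IsOpen Ω)
    (hreg : interior (closure Ω) = Ω) (hvol : ∀ τ, 0 < M.vol τ) {F : Fin M.N → Fin M.N → ℝ}
    (hF : ∀ a b, F a b = -F b a) :
    (fun τ => (fluxField D F τ : E n → E n)) ∈ M.rt0Zero := by
  refine ⟨fun τ => ?_, ?_, ?_⟩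
  · have : (fluxField D F τ : E n → E n) =
        ∑ τ', (F τ τ' / ((D τ).d * M.vol τ)) • (sharedField D τ τ' : E n → E n) := by
      funext x
      rw [fluxField_apply]
      simp
    simp only [this]
    refine Submodule.sum_mem _ fun τ' _ => Submodule.smul_mem _ _ ?_
    unfold sharedField
    split_ifs with h
    · exact (D τ).φ_mem _
    · exact Submodule.zero_mem _
  · intro τ τ' G hG hG' ν hν x hx
    by_cases hne : τ = τ'
    · subst hne; rfl
    have hinter := inter_eq_of_facet D hne hG hG'
    have hadj : M.Adj τ τ' := ⟨hne, hinter ▸ hG, hinter ▸ hG'⟩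
    have e1 : (D τ).facet (sharedIdx D hadj) = G := by rw [facet_sharedIdx, hinter]
    have e2 : (D τ').facet (sharedIdx D hadj.symm) = G := by
      rw [facet_sharedIdx, Set.inter_comm, hinter]
    obtain ⟨κ, hκ, hlin⟩ := exists_neg_smul D hne (e1.trans e2.symm)
    have harea := smul_area_eq D hΩ (e1.trans e2.symm) hκ hlin
    have hd := (D τ).one_le_d
    have hd' := (D τ').one_le_d
    have hv := hvol τ
    have hv' := hvol τ'
    change inner ℝ (fluxField D F τ x) ν = inner ℝ (fluxField D F τ' x) ν
    rw [(D τ).eq_smul_normal (e1 ▸ hν) (fluxField D F τ x),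
      (D τ').eq_smul_normal (e2 ▸ hν) (fluxField D F τ' x),
      normal_fluxField_of_adj D F hadj (e1 ▸ hx), normal_fluxField_of_adj D F hadj.symm (e2 ▸ hx),
      (D τ').eq_smul_normal (e2 ▸ hν) ((D τ).axis _), hlin, (D τ).g_axis, hF τ' τ, ← harea]
    field_simp
  · intro τ G hG hGf ν hν x hx
    obtain ⟨j, rfl⟩ := (D τ).exists_facet hG
    rw [(D τ).eq_smul_normal hν, normal_fluxField_of_not_adj D F ?_ hx, mul_zero]
    intro τ' h hj
    refine facet_not_subset_frontier D hopen hreg h.1 h.2.1 h.2.2 ?_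
    rw [← facet_sharedIdx D h, hj]
    exact hGf

theorem divergence_fluxField {F : Fin M.N → Fin M.N → ℝ}
    (hF : ∀ a b, ¬ M.Adj a b → F a b = 0) (τ : Fin M.N) (x : E n) :
    divergence (fluxField D F τ) x = (∑ τ', F τ τ') / M.vol τ := by
  have hd := (D τ).one_le_d
  rw [divergence_affine, fluxField_linear, map_sum, Finset.sum_div]
  refine Finset.sum_congr rfl fun τ' _ => ?_
  rw [map_smul, smul_eq_mul]
  by_cases h : M.Adj τ τ'
  · rw [sharedField, dif_pos h, (D τ).trace_φ]
    field_simp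
  · rw [hF _ _ h]; simp

/-- Each basis field is bounded by the diameter and at most `2n` of them occur in a cell; the rest
is Cauchy-Schwarz and integration of a constant. -/
theorem integral_fluxField_le (hΩ : Bornology.IsBounded Ω)
    (hvol : ∀ τ, 0 < M.vol τ) {F : Fin M.N → Fin M.N → ℝ} (hF : ∀ a b, ¬ M.Adj a b → F a b = 0)
    (τ : Fin M.N) : ∫ x in (M.cell τ).carrier, ‖fluxField D F τ x‖ ^ 2 ≤
      2 * n * ∑ τ', F τ τ' ^ 2 * M.diam τ ^ 2 / M.vol τ := by
  classical
  have hd := (D τ).one_le_d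
  have hv := hvol τ
  have hpt : ∀ x ∈ (M.cell τ).carrier, ‖(‖fluxField D F τ x‖ ^ 2 : ℝ)‖ ≤
      2 * n * ∑ τ', (F τ τ' / M.vol τ * M.diam τ) ^ 2 := by
    intro x hx
    rw [Real.norm_of_nonneg (by positivity)]
    have h1 : ‖fluxField D F τ x‖ ≤ ∑ τ' with M.Adj τ τ', |F τ τ'| / M.vol τ * M.diam τ := by
      rw [fluxField_apply, Finset.sum_filter]
      refine (norm_sum_le _ _).trans (Finset.sum_le_sum fun τ' _ => ?_)
      split_ifs with h
      · rw [norm_smul, Real.norm_eq_abs, abs_div, abs_of_pos (by positivity : 0 < (D τ).d * M.vol τ)]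
        have h2 : ‖sharedField D τ τ' x‖ ≤ M.diam τ := by
          rw [sharedField, dif_pos h]
          obtain ⟨z, hz, e⟩ := (D τ).φ_sub (sharedIdx D h) x hx
          rw [e, ← dist_eq_norm]
          exact Metric.dist_le_diam_of_mem (M.isBounded_carrier hΩ τ) hx hz
        have h3 : |F τ τ'| / ((D τ).d * M.vol τ) ≤ |F τ τ'| / M.vol τ := by
          apply div_le_div_of_nonneg_left (abs_nonneg _) hv
          nlinarith
        exact mul_le_mul h3 h2 (norm_nonneg _) (by positivity)
      · rw [hF _ _ h]; simp
    have h4 : (∑ τ' with M.Adj τ τ', |F τ τ'| / M.vol τ * M.diam τ) ^ 2 ≤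
        2 * n * ∑ τ', (F τ τ' / M.vol τ * M.diam τ) ^ 2 := by
      refine (sq_sum_le_card_mul_sum_sq).trans ?_
      refine mul_le_mul (card_adj_le D τ) ?_ (Finset.sum_nonneg fun _ _ => sq_nonneg _)
        (by positivity)
      refine (Finset.sum_le_sum_of_subset_of_nonneg (Finset.filter_subset _ _)
        fun _ _ _ => sq_nonneg _).trans (Finset.sum_le_sum fun τ' _ => ?_)
      rw [mul_pow, mul_pow, div_pow, div_pow, sq_abs]
    exact (pow_le_pow_left₀ (norm_nonneg _) h1 2).trans h4
  have h5 := norm_setIntegral_le_of_norm_le_const (μ := volume)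
    (M.volume_carrier_ne_top hΩ τ).lt_top hpt
  refine (le_abs_self _).trans (h5.trans (le_of_eq ?_))
  change _ * M.vol τ = _
  rw [mul_assoc, Finset.sum_mul]
  congr 1
  refine Finset.sum_congr rfl fun τ' _ => ?_
  field_simp

theorem sum_vol (D : M.FacetSystems) (hΩ : Bornology.IsBounded Ω)
    (hreg : interior (closure Ω) = Ω) : ∑ τ, M.vol τ = volume.real Ω := by
  have h := integral_eq_sum D hreg (F := fun _ => (1 : ℝ))
    (fun τ => (setIntegral_const_interior D hΩ τ (c := 1) fun _ _ => rfl).1)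
  have h2 := h.2
  simp only [setIntegral_const, smul_eq_mul, mul_one] at h2
  rw [h2]
  exact Finset.sum_congr rfl fun τ _ => vol_eq D τ

end Mesh

open Mesh in
-- A finite-volume construction: `w = min(h) ^ (n - 2)` has the size of facet area divided by
-- distance, and `w (p a - p b)` is taken as the flux from `a` to `b`. The graph equation is the
-- divergence condition. The `L²` norm of the field is controlled by the graph energy because `w h²
-- ≤ h ^ n ≤ vol / c`. The exponent `n - 2` is why `n = 1` is treated separately.
theorem uniformRightInverse_of_two_le {n : ℕ} (hn : 2 ≤ n) {Ω : Set (E n)}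
    (hΩ : Bornology.IsBounded Ω) (hopen : IsOpen Ω) (hconn : IsConnected Ω)
    (hreg : interior (closure Ω) = Ω) (σ : ℝ) : UniformRightInverse Ω σ := by
  classical
  have hn0 : 0 < n := by omega
  obtain ⟨C, hC, hL1⟩ := exists_l1_poincare hn0 hΩ hopen hconn hreg σ
  obtain ⟨c, hc, hvolc⟩ := exists_vol_ge hn0 hΩ σ
  obtain ⟨k, rfl⟩ : ∃ k, n = k + 2 := ⟨n - 2, by omega⟩
  set V := volume.real Ω
  have hV : 0 < V := ENNReal.toReal_pos (hopen.measure_pos volume hconn.nonempty).ne'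
    hΩ.measure_lt_top.ne
  set Δ : ℝ := 2 * (k + 2 : ℕ) with hΔdef
  have hΔ : 0 < Δ := by positivity
  set CP := 4 * Δ * C ^ 2 / (V ^ 2 * c) with hCP
  have hCP0 : 0 < CP := by positivity
  refine ⟨Δ / c * (4 * CP), by positivity, fun M hM f hf => ?_⟩
  obtain ⟨D⟩ := nonempty_facetSystems hn0 M
  have hdiam := hM.diam_pos hn0 hΩ
  have hvol := hM.vol_pos hn0 hΩ
  set w : Fin M.N → Fin M.N → ℝ := fun a b =>
    if M.Adj a b then min (M.diam a) (M.diam b) ^ k else 0 with hw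
  have hw0 : ∀ a b, 0 ≤ w a b := by
    intro a b
    simp only [hw]
    split_ifs
    · exact pow_nonneg (le_min (hdiam a).le (hdiam b).le) _
    · exact le_rfl
  have hws : ∀ a b, w a b = w b a := by
    intro a b
    simp only [hw, min_comm]
    exact if_congr ⟨Adj.symm, Adj.symm⟩ rfl rfl
  have hP : ∀ p : Fin M.N → ℝ, ∃ m, ∑ a, M.vol a * (p a - m) ^ 2 ≤
      CP * ∑ a, ∑ b, w a b * (p a - p b) ^ 2 := by
    intro p
    obtain ⟨m, hm⟩ := exists_l2_poincare_of_l1 (k := k) M.vol M.diam M.Adj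
      (fun _ _ h => Adj.symm h) hc hC hΔ hV (sum_vol D hΩ hreg) hdiam (hvolc M hM)
      (card_adj_le D) (hL1 M hM) p
    refine ⟨m, hm.trans (le_of_eq ?_)⟩
    congr 1
    refine Finset.sum_congr rfl fun a _ => Finset.sum_congr rfl fun b _ => ?_
    simp only [hw]
    split_ifs <;> simp
  obtain ⟨p, hp, hE⟩ := exists_graph_potential M.vol hvol w hws hw0 hCP0 hP f hf
  set F : Fin M.N → Fin M.N → ℝ := fun a b => w a b * (p a - p b) with hFdef
  have hF0 : ∀ a b, ¬ M.Adj a b → F a b = 0 := by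
    intro a b h
    simp [hFdef, hw, h]
  refine ⟨fun τ => fluxField D F τ, fluxField_mem D hΩ hopen hreg hvol ?_, ?_, ?_⟩
  · intro a b
    simp only [hFdef]
    rw [hws b a]; ring
  · intro τ x
    rw [divergence_fluxField D hF0, hp τ]
    have := hvol τ
    field_simp
  · calc ∑ τ, ∫ x in (M.cell τ).carrier, ‖fluxField D F τ x‖ ^ 2
        ≤ ∑ τ, Δ * ∑ τ', F τ τ' ^ 2 * M.diam τ ^ 2 / M.vol τ :=
          Finset.sum_le_sum fun τ _ => integral_fluxField_le D hΩ hvol hF0 τ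
      _ ≤ ∑ τ, Δ * ∑ τ', 1 / c * (w τ τ' * (p τ - p τ') ^ 2) := by
          refine Finset.sum_le_sum fun τ _ => ?_
          refine mul_le_mul_of_nonneg_left (Finset.sum_le_sum fun τ' _ => ?_) hΔ.le
          have hv := hvol τ
          have hd := hdiam τ
          have h1 := hvolc M hM τ
          have h2 : w τ τ' ≤ M.diam τ ^ k := by
            simp only [hw]
            split_ifs
            · exact pow_le_pow_left₀ (le_min hd.le (hdiam τ').le) (min_le_left _ _) _
            · positivity
          rw [div_le_iff₀ hv]
          have h3 : w τ τ' * M.diam τ ^ 2 ≤ 1 / c * M.vol τ := by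
            calc w τ τ' * M.diam τ ^ 2 ≤ M.diam τ ^ k * M.diam τ ^ 2 := by gcongr
              _ = 1 / c * (c * M.diam τ ^ (k + 2)) := by
                rw [pow_add]; field_simp
              _ ≤ _ := by gcongr
          calc F τ τ' ^ 2 * M.diam τ ^ 2
              = (w τ τ' * (p τ - p τ') ^ 2) * (w τ τ' * M.diam τ ^ 2) := by
                simp only [hFdef]; ring
            _ ≤ (w τ τ' * (p τ - p τ') ^ 2) * (1 / c * M.vol τ) :=
                mul_le_mul_of_nonneg_left h3 (mul_nonneg (hw0 _ _) (sq_nonneg _))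
            _ = _ := by ring
      _ = Δ / c * ∑ τ, ∑ τ', w τ τ' * (p τ - p τ') ^ 2 := by
          simp only [← Finset.mul_sum]
          ring
      _ ≤ Δ / c * (4 * CP * ∑ τ, M.vol τ * f τ ^ 2) := by gcongr
      _ = _ := by ring

end

end MixedDim

namespace MixedDim

open MeasureTheory

noncomputable section

/-! ### The one-dimensional case: antiderivatives -/

/-- A multiple of the identity commutes with the linear part of the cell map, so it is a Piola
transform of itself, for both kinds of cells. -/
theorem add_smul_mem_rt0 {n : ℕ} (K : Cell n) (c : E n) (b : ℝ) :
    (fun x => c + b • x) ∈ K.rt0 := by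
  let p : E n → E n := fun y => K.map.linear.symm (c + b • K.map 0) + b • y
  have hmap : ∀ y, K.map y = K.map.linear y + K.map 0 := by
    intro y
    have := K.map.map_vadd 0 y
    simpa [vadd_eq_add] using this
  have hp : ∀ x, c + b • x = K.map.linear (p (K.map.symm x)) := by
    intro x
    have h1 : x = K.map.linear (K.map.symm x) + K.map 0 := by
      rw [← hmap, AffineEquiv.apply_symm_apply]
    simp only [p, map_add, map_smul, LinearEquiv.apply_symm_apply]
    conv_lhs => rw [h1]
    module
  refine ⟨p, ?_, hp⟩
  cases K.kind
  · exact ⟨_, b, fun x => rfl⟩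
  · exact ⟨(K.map.linear.symm (c + b • K.map 0)).ofLp, fun _ => b, fun x i => rfl⟩

theorem volume_real_slab (a b : ℝ) (hab : a ≤ b) :
    volume.real {z : E 1 | a < z 0 ∧ z 0 ≤ b} = b - a := by
  have hm : MeasurableSet {z : E 1 | a < z 0 ∧ z 0 ≤ b} := by
    have hi : Measurable fun x : E 1 => x 0 := by fun_prop
    exact measurableSet_Ioc.preimage hi
  have e : (WithLp.toLp 2 : (Fin 1 → ℝ) → E 1) ⁻¹' {z : E 1 | a < z 0 ∧ z 0 ≤ b} =
      Set.pi Set.univ fun _ => Set.Ioc a b := by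
    ext z
    simp [Set.mem_pi]
  rw [Measure.real, preimage_toLp_volume _ hm, e, volume_pi_pi]
  simp [hab]

/-- The antiderivative of a cellwise constant function on an interval. -/
def Mesh.antideriv {Ω : Set (E 1)} (M : Mesh Ω) (f : Fin M.N → ℝ) (x : E 1) : ℝ :=
  ∫ z in {z : E 1 | z 0 ≤ x 0}, M.constFn f z

namespace Mesh

variable {Ω : Set (E 1)} {M : Mesh Ω} (D : M.FacetSystems) (hΩ : Bornology.IsBounded Ω)
  (hreg : interior (closure Ω) = Ω)

theorem constFn_eq_zero (f : Fin M.N → ℝ) {z : E 1}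
    (hz : ∀ τ, z ∉ interior (M.cell τ).carrier) : M.constFn f z = 0 := by
  rw [constFn, glue]
  exact Finset.sum_eq_zero fun τ _ => Set.indicator_of_notMem (hz τ) _

include D hΩ hreg in
theorem constFn_integrals (f : Fin M.N → ℝ) : Integrable (M.constFn f) ∧
    ∫ z, M.constFn f z = ∑ τ, M.vol τ * f τ ∧ ∫ z, |M.constFn f z| = ∑ τ, M.vol τ * |f τ| := by
  have hsupp : ∀ z ∉ Ω, M.constFn f z = 0 := fun z hz =>
    constFn_eq_zero f fun τ h => hz (M.interior_subset hreg τ h)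
  have h1 : ∀ τ, ∀ x ∈ interior (M.cell τ).carrier, M.constFn f x = f τ := fun τ x hx => by
    rw [constFn, glue_of_mem D _ hx]
  have h2 : ∀ τ, ∀ x ∈ interior (M.cell τ).carrier, |M.constFn f x| = |f τ| := fun τ x hx => by
    rw [h1 τ x hx]
  have hI := integral_eq_sum D hreg (F := M.constFn f)
    fun τ => (setIntegral_const_interior D hΩ τ (h1 τ)).1
  have hI' := integral_eq_sum D hreg (F := fun x => |M.constFn f x|)
    fun τ => (setIntegral_const_interior D hΩ τ (h2 τ)).1
  refine ⟨?_, ?_, ?_⟩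
  · exact (integrableOn_iff_integrable_of_support_subset
      (fun z hz => by_contra fun h => hz (hsupp z h))).1 hI.1
  · rw [← setIntegral_eq_integral_of_forall_compl_eq_zero hsupp, hI.2]
    refine Finset.sum_congr rfl fun τ _ => ?_
    rw [(setIntegral_const_interior D hΩ τ (h1 τ)).2, mul_comm]
  · rw [← setIntegral_eq_integral_of_forall_compl_eq_zero
      (fun z hz => by rw [hsupp z hz, abs_zero]), hI'.2]
    refine Finset.sum_congr rfl fun τ _ => ?_
    rw [(setIntegral_const_interior D hΩ τ (h2 τ)).2, mul_comm]

theorem measurableSet_halfline (a : ℝ) : MeasurableSet {z : E 1 | z 0 ≤ a} := by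
  have hi : Measurable fun x : E 1 => x 0 := by fun_prop
  exact measurableSet_Iic.preimage hi

include D hΩ hreg in
-- In dimension one a cell is an interval: everything between two of its points belongs to it, and
-- there the integrand is almost everywhere the constant `f τ`.
theorem antideriv_sub {f : Fin M.N → ℝ} {τ : Fin M.N} {x y : E 1}
    (hx : x ∈ (M.cell τ).carrier) (hy : y ∈ (M.cell τ).carrier) (hxy : x 0 ≤ y 0) :
    M.antideriv f y - M.antideriv f x = f τ * (y 0 - x 0) := by
  obtain ⟨hInt, -, -⟩ := constFn_integrals D hΩ hreg f
  have hsub : {z : E 1 | z 0 ≤ x 0} ⊆ {z : E 1 | z 0 ≤ y 0} := fun z hz => le_trans hz hxy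
  have hdiff : {z : E 1 | z 0 ≤ y 0} \ {z : E 1 | z 0 ≤ x 0} = {z | x 0 < z 0 ∧ z 0 ≤ y 0} := by
    ext z
    simp [and_comm]
  have hslab : {z : E 1 | x 0 < z 0 ∧ z 0 ≤ y 0} ⊆ (M.cell τ).carrier := by
    rintro z ⟨h1, h2⟩
    have h3 : 0 < y 0 - x 0 := by linarith
    have : z = AffineMap.lineMap x y ((z 0 - x 0) / (y 0 - x 0)) := by
      ext i
      fin_cases i
      simp [AffineMap.lineMap_apply]
      field_simp
      ring
    rw [this]
    exact (D τ).convex.lineMap_mem hx hy ⟨by positivity, by rw [div_le_one h3]; linarith⟩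
  have hms : MeasurableSet {z : E 1 | x 0 < z 0 ∧ z 0 ≤ y 0} := by
    rw [← hdiff]
    exact (measurableSet_halfline _).diff (measurableSet_halfline _)
  unfold antideriv
  rw [← setIntegral_sdiff (measurableSet_halfline _) hInt.integrableOn hsub, hdiff]
  have hae : ∀ᵐ z ∂volume, z ∈ {z : E 1 | x 0 < z 0 ∧ z 0 ≤ y 0} → M.constFn f z = f τ := by
    filter_upwards [measure_eq_zero_iff_ae_notMem.1 (volume_carrier_diff_interior D τ)] with z hz hzs
    have : z ∈ interior (M.cell τ).carrier := by
      by_contra h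
      exact hz ⟨hslab hzs, h⟩
    rw [constFn, glue_of_mem D _ this]
  rw [setIntegral_congr_ae hms hae, setIntegral_const, volume_real_slab _ _ hxy, smul_eq_mul,
    mul_comm]

include D hΩ hreg in
-- A connected set on the line lies entirely on one side of each of its boundary points. The
-- antiderivative there is therefore either zero or the total integral, which vanishes as well.
theorem antideriv_frontier (hopen : IsOpen Ω) (hconn : IsConnected Ω) {f : Fin M.N → ℝ}
    (hf : ∑ τ, M.vol τ * f τ = 0) {x : E 1} (hx : x ∈ frontier Ω) : M.antideriv f x = 0 := by
  obtain ⟨-, htot, -⟩ := constFn_integrals D hΩ hreg f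
  have hxΩ : x ∉ Ω := fun h => by
    rw [hopen.frontier_eq] at hx
    exact hx.2 h
  have hne : ∀ z ∈ Ω, z 0 ≠ x 0 := by
    intro z hz h
    apply hxΩ
    have : x = z := by
      ext i
      fin_cases i
      exact h.symm
    rwa [this]
  have hc0 : Continuous fun z : E 1 => z 0 := by fun_prop
  have hpre : (∀ z ∈ Ω, x 0 < z 0) ∨ ∀ z ∈ Ω, z 0 < x 0 := by
    by_contra h
    push Not at h
    obtain ⟨⟨z, hz, hz'⟩, w, hw, hw'⟩ := h
    have hmem := (hconn.isPreconnected.image _ hc0.continuousOn).Icc_subset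
      (Set.mem_image_of_mem _ hz) (Set.mem_image_of_mem _ hw) ⟨hz', hw'⟩
    obtain ⟨v, hv, hv'⟩ := hmem
    exact hne v hv hv'
  have hsupp : ∀ z ∉ Ω, M.constFn f z = 0 := fun z hz =>
    constFn_eq_zero f fun τ h => hz (M.interior_subset hreg τ h)
  unfold antideriv
  rcases hpre with h | h
  · rw [setIntegral_eq_zero_of_forall_eq_zero]
    intro z hz
    exact hsupp z fun hzΩ => absurd (h z hzΩ) (not_lt.2 hz)
  · rw [setIntegral_eq_integral_of_forall_compl_eq_zero, htot, hf]
    intro z hz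
    exact hsupp z fun hzΩ => hz (h z hzΩ).le

include D hΩ hreg in
theorem antideriv_sq_le (f : Fin M.N → ℝ) (x : E 1) :
    M.antideriv f x ^ 2 ≤ volume.real Ω * ∑ τ, M.vol τ * f τ ^ 2 := by
  obtain ⟨hInt, -, habs⟩ := constFn_integrals D hΩ hreg f
  have h1 : |M.antideriv f x| ≤ ∑ τ, M.vol τ * |f τ| := by
    rw [← habs]
    refine (abs_integral_le_integral_abs).trans ?_
    exact setIntegral_le_integral hInt.abs (Filter.Eventually.of_forall fun z => abs_nonneg _)
  have h2 : (∑ τ, M.vol τ * |f τ|) ^ 2 ≤ (∑ τ, M.vol τ) * ∑ τ, M.vol τ * f τ ^ 2 := by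
    have := Finset.sum_sq_le_sum_mul_sum_of_sq_le_mul (Finset.univ : Finset (Fin M.N))
      (r := fun τ => M.vol τ * |f τ|) (f := M.vol) (g := fun τ => M.vol τ * f τ ^ 2)
      (fun τ _ => M.vol_nonneg τ) (fun τ _ => mul_nonneg (M.vol_nonneg τ) (sq_nonneg _))
      (fun τ _ => le_of_eq (by simp only [mul_pow, sq_abs]; ring))
    exact this
  rw [← sum_vol D hΩ hreg, ← sq_abs]
  exact (pow_le_pow_left₀ (abs_nonneg _) h1 2).trans h2

end Mesh

open Mesh in
-- The antiderivative is a single function on the line, so normal continuity is automatic, and it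
-- vanishes on `∂Ω`. Its square is at most `V ∑ vol f²` pointwise; integration over `Ω` gives the
-- constant `V²`.
theorem uniformRightInverse_of_dim_one {Ω : Set (E 1)}
    (hΩ : Bornology.IsBounded Ω) (hopen : IsOpen Ω) (hconn : IsConnected Ω)
    (hreg : interior (closure Ω) = Ω) (σ : ℝ) : UniformRightInverse Ω σ := by
  set V := volume.real Ω
  have hV : 0 < V := ENNReal.toReal_pos (hopen.measure_pos volume hconn.nonempty).ne'
    hΩ.measure_lt_top.ne
  refine ⟨V ^ 2, by positivity, fun M hM f hf => ?_⟩
  obtain ⟨D⟩ := nonempty_facetSystems one_pos M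
  have hne : ∀ τ, (M.cell τ).carrier.Nonempty := by
    intro τ
    obtain ⟨x, r, hr, hsub, -⟩ := hM τ
    exact ⟨x, hsub (Metric.mem_closedBall_self hr.le)⟩
  choose y hy using hne
  let e : E 1 := EuclideanSpace.single 0 1
  have he : ∀ x : E 1, x = x 0 • e := by
    intro x
    ext i
    fin_cases i
    simp [e]
  -- Elements of the RT0 space are polynomial on the whole line, so the antiderivative is continued
  -- affinely from a base point of each cell.
  let q : Fin M.N → E 1 → E 1 := fun τ x =>
    (M.antideriv f (y τ) • e - f τ • y τ) + f τ • x
  have hq : ∀ τ, ∀ x ∈ (M.cell τ).carrier, q τ x = M.antideriv f x • e := by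
    intro τ x hx
    have h1 : M.antideriv f x = M.antideriv f (y τ) + f τ * (x 0 - y τ 0) := by
      rcases le_total (x 0) (y τ 0) with h | h
      · linarith [antideriv_sub D hΩ hreg (f := f) hx (hy τ) h]
      · linarith [antideriv_sub D hΩ hreg (f := f) (hy τ) hx h]
    simp only [q]
    rw [h1]
    ext i
    fin_cases i
    simp [e]
    ring
  have hfac : ∀ τ, ∀ G ∈ (M.cell τ).facets, G ⊆ (M.cell τ).carrier := by
    intro τ G hG
    obtain ⟨i, rfl⟩ := (D τ).exists_facet hG
    exact fun x hx => hx.1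
  refine ⟨q, ⟨fun τ => add_smul_mem_rt0 _ _ _, ?_, ?_⟩, ?_, ?_⟩
  · intro τ τ' G hG hG' ν _ x hx
    rw [hq τ x (hfac τ G hG hx), hq τ' x (hfac τ' G hG' hx)]
  · intro τ G hG hGf ν _ x hx
    rw [hq τ x (hfac τ G hG hx), antideriv_frontier D hΩ hreg hopen hconn hf (hGf hx)]
    simp
  · intro τ x
    have : q τ = ((f τ • LinearMap.id (R := ℝ) (M := E 1)).toAffineMap +
        AffineMap.const ℝ (E 1) (M.antideriv f (y τ) • e - f τ • y τ) : E 1 →ᵃ[ℝ] E 1) := by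
      funext z
      simp only [q, AffineMap.coe_add, Pi.add_apply, LinearMap.coe_toAffineMap,
        LinearMap.smul_apply, LinearMap.id_apply, AffineMap.const_apply]
      abel
    rw [this, divergence_affine]
    simp [LinearMap.trace_id]
  · calc ∑ τ, ∫ x in (M.cell τ).carrier, ‖q τ x‖ ^ 2
        ≤ ∑ τ, (V * ∑ τ, M.vol τ * f τ ^ 2) * M.vol τ := by
          refine Finset.sum_le_sum fun τ _ => ?_
          have h5 := norm_setIntegral_le_of_norm_le_const (μ := volume)
            (f := fun x => ‖q τ x‖ ^ 2) (C := V * ∑ τ, M.vol τ * f τ ^ 2)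
            (M.volume_carrier_ne_top hΩ τ).lt_top fun x hx => ?_
          · exact (le_abs_self _).trans h5
          · rw [Real.norm_of_nonneg (by positivity), hq τ x hx, norm_smul]
            have : ‖e‖ = 1 := by simp [e]
            rw [this, mul_one, Real.norm_eq_abs, sq_abs]
            exact antideriv_sq_le D hΩ hreg f x
      _ = _ := by
          rw [← Finset.mul_sum, sum_vol D hΩ hreg]
          ring

theorem uniformRightInverse {n : ℕ} (hn : 0 < n) {Ω : Set (E n)}
    (hΩ : Bornology.IsBounded Ω) (hopen : IsOpen Ω) (hconn : IsConnected Ω)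
    (hreg : interior (closure Ω) = Ω) (σ : ℝ) : UniformRightInverse Ω σ := by
  obtain rfl | h : n = 1 ∨ 2 ≤ n := by omega
  · exact uniformRightInverse_of_dim_one hΩ hopen hconn hreg σ
  · exact uniformRightInverse_of_two_le h hΩ hopen hconn hreg σ

end

end MixedDim

namespace MixedDim

noncomputable section

/-! ### The network -/

namespace RootedForest

variable {V : Type*} [Fintype V] [DecidableEq V] (F : RootedForest V)

/-- The component is a tree with at least two vertices, since its root has a neighbour. Such a tree
has two leaves, and at most one of them is the root. -/
theorem exists_terminal (v : V) : ∃ t ∈ F.terminals, F.graph.Reachable v t := by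
  classical
  let c := F.graph.connectedComponentMk v
  obtain ⟨r, ⟨hr, hrc⟩, huniq⟩ := F.existsUnique_root c
  obtain ⟨w, hw⟩ := Set.ncard_eq_one.1 (F.root_degree r hr)
  have hrw : F.graph.Adj r w := by
    have : w ∈ F.graph.neighborSet r := by rw [hw]; rfl
    exact this
  have hrmem : r ∈ c := hrc
  have hwmem : w ∈ c := by
    change F.graph.connectedComponentMk w = c
    rw [← hrc]
    exact SimpleGraph.ConnectedComponent.sound hrw.reachable.symm
  have htree := F.acyclic.isTree_connectedComponent c
  have : Nontrivial c := ⟨⟨r, hrmem⟩, ⟨w, hwmem⟩, fun h => hrw.ne (congrArg Subtype.val h)⟩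
  obtain ⟨a, b, hab, ha, hb⟩ := htree.exists_ne_and_degree_eq_one
  have key : ∀ a : c, c.toSimpleGraph.degree a = 1 → a.1 ≠ r → a.1 ∈ F.terminals := by
    intro a ha har
    refine Finset.mem_filter.2 ⟨Finset.mem_univ _, fun h => har (huniq a.1 ⟨h, a.2⟩), ?_⟩
    rw [SimpleGraph.degree_eq_one_iff_existsUnique_adj] at ha
    obtain ⟨x, hx, hx'⟩ := ha
    rw [Set.ncard_eq_one]
    refine ⟨x.1, ?_⟩
    ext y
    constructor
    · intro hy
      have hay : F.graph.Adj a.1 y := hy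
      have hyc : y ∈ c := by
        change F.graph.connectedComponentMk y = c
        rw [← (show F.graph.connectedComponentMk a.1 = c from a.2)]
        exact SimpleGraph.ConnectedComponent.sound hay.reachable.symm
      exact congrArg Subtype.val (hx' ⟨y, hyc⟩ hay)
    · intro hy
      rw [Set.mem_singleton_iff.1 hy]
      exact hx
  have hreach : ∀ a : c, F.graph.Reachable v a.1 := fun a =>
    SimpleGraph.ConnectedComponent.exact (a.2.symm : F.graph.connectedComponentMk v = _)
  by_cases h : a.1 = r
  · have hbr : b.1 ≠ r := fun h' => hab (Subtype.ext (h.trans h'.symm))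
    exact ⟨b.1, key b hb hbr, hreach b⟩
  · exact ⟨a.1, key a ha h, hreach a⟩

open Classical in
/-- Net outflow at the free nodes, and the total exchange with the domain, for edge fluxes and
exchange rates at the terminals. -/
def netMap : (F.edgeFlux × (F.terminals → ℝ)) →ₗ[ℝ] (F.FreeNode → ℝ) × ℝ where
  toFun x := (fun i => (if h : i.1 ∈ F.terminals then x.2 ⟨i.1, h⟩ else 0) -
    ∑ j with F.graph.Adj i.1 j, x.1.1 j i.1, ∑ t, x.2 t)
  map_add' x y := by
    ext i
    · simp only [Prod.fst_add, Prod.snd_add, Submodule.coe_add, Pi.add_apply,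
        Finset.sum_add_distrib]
      split_ifs <;> ring
    · simp [Finset.sum_add_distrib]
  map_smul' c x := by
    ext i
    · simp only [Prod.smul_fst, Prod.smul_snd, Submodule.coe_smul, Pi.smul_apply, smul_eq_mul,
        RingHom.id_apply, ← Finset.mul_sum]
      split_ifs <;> ring
    · simp [Finset.mul_sum]

/-- The unit flux along an edge. -/
def unitFlux {a b : V} (h : F.graph.Adj a b) : F.edgeFlux :=
  ⟨fun i j => (if i = a ∧ j = b then 1 else 0) - (if i = b ∧ j = a then 1 else 0), by
    constructor
    · intro i j
      have h1 : (j = a ∧ i = b) ↔ (i = b ∧ j = a) := and_comm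
      have h2 : (j = b ∧ i = a) ↔ (i = a ∧ j = b) := and_comm
      simp only [h1, h2]
      ring
    · intro i j hij
      have h1 : ¬ (i = a ∧ j = b) := by
        rintro ⟨rfl, rfl⟩
        exact hij h
      have h2 : ¬ (i = b ∧ j = a) := by
        rintro ⟨rfl, rfl⟩
        exact hij h.symm
      simp [h1, h2]⟩

/-- Otherwise a nonzero functional `(s, l)` vanishes on the range. Unit flows along edges show that
`s` is constant on trees, unit exchanges that `s = -l` at terminals. A tree with a Dirichlet root
has `s = 0` and a terminal, so `l = 0`; then `s = 0` on every tree through its terminals. -/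
theorem netMap_surjective (hF : F.dirichlet.Nonempty) : Function.Surjective F.netMap := by
  classical
  rw [← LinearMap.range_eq_top]
  by_contra hne
  obtain ⟨f, hf0, hf⟩ := Submodule.exists_le_ker_of_lt_top _ (lt_top_iff_ne_top.2 hne)
  apply hf0
  have hz : ∀ x, f (F.netMap x) = 0 := fun x => hf ⟨x, rfl⟩
  -- Extended by zero to the Dirichlet nodes, which carry no equation; with this extension every
  -- edge gives `s a = s b`.
  let s : V → ℝ := fun i => if h : i ∉ F.dirichlet then f (Pi.single ⟨i, h⟩ 1, 0) else 0
  let l : ℝ := f (0, 1)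
  have hfs : ∀ a : F.FreeNode → ℝ, ∀ b : ℝ, f (a, b) = ∑ i, a i * s i.1 + b * l := by
    intro a b
    have e : (a, b) = ∑ i, a i • ((Pi.single i 1, 0) : (F.FreeNode → ℝ) × ℝ) + b • (0, 1) := by
      ext j
      · simp [Prod.fst_sum, Finset.sum_apply, Pi.single_apply]
      · simp [Prod.snd_sum]
    rw [e, map_add, map_sum, map_smul]
    congr 1
    refine Finset.sum_congr rfl fun i _ => ?_
    rw [map_smul, smul_eq_mul]
    simp only [s, dif_pos i.2]
  have hterm : ∀ t ∈ F.terminals, s t = -l := by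
    intro t ht
    have hfree : t ∉ F.dirichlet := fun h =>
      (Finset.mem_filter.1 ht).2.1 (Finset.mem_union_left _ h)
    have h1 := hz (0, Pi.single ⟨t, ht⟩ 1)
    have h2 : F.netMap (0, Pi.single ⟨t, ht⟩ 1) =
        (fun i => if i.1 = t then 1 else 0, 1) := by
      ext i
      · simp only [netMap, LinearMap.coe_mk, AddHom.coe_mk]
        by_cases hi : i.1 = t
        · have : i.1 ∈ F.terminals := hi ▸ ht
          simp [hi, ht]
        · by_cases h : i.1 ∈ F.terminals
          · have : (⟨i.1, h⟩ : F.terminals) ≠ ⟨t, ht⟩ := fun h' => hi (congrArg Subtype.val h')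
            simp [hi, h, this]
          · simp [hi, h]
      · simp [netMap]
    rw [h2, hfs] at h1
    have h3 : ∑ i : F.FreeNode, (if i.1 = t then (1 : ℝ) else 0) * s i.1 = s t := by
      rw [Finset.sum_eq_single ⟨t, hfree⟩]
      · simp
      · intro i _ hi
        have : i.1 ≠ t := fun h => hi (Subtype.ext h)
        simp [this]
      · simp
    rw [h3] at h1
    linarith
  have hdir : ∀ v ∈ F.dirichlet, s v = 0 := by
    intro v hv
    simp [s, hv]
  have hedge : ∀ a b, F.graph.Adj a b → s a = s b := by
    intro a b hab
    have h1 := hz (F.unitFlux hab, 0)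
    have h2 : ∀ i : V, ∑ j with F.graph.Adj i j, (F.unitFlux hab).1 j i =
        (if i = b then 1 else 0) - (if i = a then 1 else 0) := by
      intro i
      simp only [unitFlux, Finset.sum_sub_distrib]
      congr 1
      · by_cases hi : i = b
        · subst hi
          rw [Finset.sum_eq_single a]
          · simp
          · intro j _ hj; simp [hj]
          · intro h; exact absurd (Finset.mem_filter.2 ⟨Finset.mem_univ _, hab.symm⟩) h
        · simp [hi]
      · by_cases hi : i = a
        · subst hi
          rw [Finset.sum_eq_single b]
          · simp
          · intro j _ hj; simp [hj]
          · intro h; exact absurd (Finset.mem_filter.2 ⟨Finset.mem_univ _, hab⟩) h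
        · simp [hi]
    have h3 : F.netMap (F.unitFlux hab, 0) =
        (fun i => (if i.1 = a then 1 else 0) - (if i.1 = b then 1 else 0), 0) := by
      ext i
      · simp only [netMap, LinearMap.coe_mk, AddHom.coe_mk, h2]
        simp
      · simp [netMap]
    rw [h3, hfs] at h1
    have h4 : ∀ c : V, ∑ i : F.FreeNode, (if i.1 = c then (1 : ℝ) else 0) * s i.1 = s c := by
      intro c
      by_cases hc : c ∈ F.dirichlet
      · rw [hdir c hc]
        refine Finset.sum_eq_zero fun i _ => ?_
        have : i.1 ≠ c := fun h => i.2 (h ▸ hc)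
        simp [this]
      · rw [Finset.sum_eq_single ⟨c, hc⟩]
        · simp
        · intro i _ hi
          have : i.1 ≠ c := fun h => hi (Subtype.ext h)
          simp [this]
        · simp
    simp only [sub_mul, Finset.sum_sub_distrib, h4] at h1
    linarith
  have hreach : ∀ a b, F.graph.Reachable a b → s a = s b := by
    rintro a b ⟨p⟩
    induction p with
    | nil => rfl
    | cons h _ ih => exact (hedge _ _ h).trans ih
  have hl : l = 0 := by
    obtain ⟨v, hv⟩ := hF
    obtain ⟨t, ht, hvt⟩ := F.exists_terminal v
    have := hreach v t hvt
    rw [hdir v hv, hterm t ht] at this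
    linarith
  have hs : ∀ v, s v = 0 := by
    intro v
    obtain ⟨t, ht, hvt⟩ := F.exists_terminal v
    rw [hreach v t hvt, hterm t ht, hl, neg_zero]
  apply LinearMap.ext
  rintro ⟨a, b⟩
  rw [hfs, hl]
  simp [hs]

open Classical in
/-- Every distribution of sources at the free nodes can be balanced by edge fluxes and exchange
rates with a prescribed total. -/
theorem exists_balance (hF : F.dirichlet.Nonempty) : ∃ C > 0, ∀ (s : F.FreeNode → ℝ) (m : ℝ),
    ∃ (q : F.edgeFlux) (t : F.terminals → ℝ),
      (∀ i : F.FreeNode, (if h : i.1 ∈ F.terminals then t ⟨i.1, h⟩ else 0) -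
        ∑ j with F.graph.Adj i.1 j, q.1 j i.1 = s i) ∧ ∑ i, t i = m ∧
      ∑ i, ∑ j, q.1 i j ^ 2 ≤ C * (∑ i, s i ^ 2 + m ^ 2) ∧
      ∑ i, t i ^ 2 ≤ C * (∑ i, s i ^ 2 + m ^ 2) := by
  obtain ⟨R, hR⟩ := F.netMap.exists_rightInverse_of_surjective
    (LinearMap.range_eq_top.2 (F.netMap_surjective hF))
  set R' := LinearMap.toContinuousLinearMap R
  -- The norms are maxima of entries; `N` is the number of entries of the edge array and of the
  -- rates together.
  set N : ℝ := (Fintype.card V : ℝ) ^ 2 + Fintype.card F.terminals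
  refine ⟨N * ‖R'‖ ^ 2 + 1, by positivity, fun s m => ⟨(R (s, m)).1, (R (s, m)).2, ?_⟩⟩
  have hRs : F.netMap (R (s, m)) = (s, m) := LinearMap.congr_fun hR (s, m)
  have hnorm : ‖R (s, m)‖ ^ 2 ≤ ‖R'‖ ^ 2 * (∑ i, s i ^ 2 + m ^ 2) := by
    have h1 : ‖R (s, m)‖ ≤ ‖R'‖ * ‖(s, m)‖ := R'.le_opNorm (s, m)
    have h2 : ‖(s, m)‖ ^ 2 ≤ ∑ i, s i ^ 2 + m ^ 2 := by
      have h3 : ‖s‖ ^ 2 ≤ ∑ i, s i ^ 2 := by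
        have h4 : ‖s‖ ≤ √(∑ i, s i ^ 2) := by
          rw [pi_norm_le_iff_of_nonneg (Real.sqrt_nonneg _)]
          intro i
          apply Real.le_sqrt_of_sq_le
          rw [Real.norm_eq_abs, sq_abs]
          exact Finset.single_le_sum (f := fun i => s i ^ 2) (fun j _ => sq_nonneg _)
            (Finset.mem_univ i)
        calc ‖s‖ ^ 2 ≤ √(∑ i, s i ^ 2) ^ 2 := pow_le_pow_left₀ (norm_nonneg _) h4 2
          _ = _ := Real.sq_sqrt (Finset.sum_nonneg fun _ _ => sq_nonneg _)
      have h5 : 0 ≤ ∑ i, s i ^ 2 := Finset.sum_nonneg fun _ _ => sq_nonneg _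
      rw [Prod.norm_def]
      rcases max_choice ‖s‖ ‖m‖ with h | h
      · rw [h]; nlinarith [sq_nonneg m]
      · rw [h, Real.norm_eq_abs, sq_abs]; linarith
    calc ‖R (s, m)‖ ^ 2 ≤ (‖R'‖ * ‖(s, m)‖) ^ 2 := pow_le_pow_left₀ (norm_nonneg _) h1 2
      _ = ‖R'‖ ^ 2 * ‖(s, m)‖ ^ 2 := by ring
      _ ≤ _ := by gcongr
  have hpos : 0 ≤ ∑ i, s i ^ 2 + m ^ 2 :=
    add_nonneg (Finset.sum_nonneg fun _ _ => sq_nonneg _) (sq_nonneg _)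
  have hfin : ∀ x : ℝ, 0 ≤ x → x ≤ N → x * ‖R (s, m)‖ ^ 2 ≤
      (N * ‖R'‖ ^ 2 + 1) * (∑ i, s i ^ 2 + m ^ 2) := by
    intro x hx0 hx
    calc x * ‖R (s, m)‖ ^ 2 ≤ N * (‖R'‖ ^ 2 * (∑ i, s i ^ 2 + m ^ 2)) :=
          mul_le_mul hx hnorm (by positivity) (hx0.trans hx)
      _ ≤ _ := by nlinarith
  refine ⟨fun i => congrFun (congrArg Prod.fst hRs) i, congrArg Prod.snd hRs, ?_, ?_⟩
  · refine le_trans ?_ (hfin ((Fintype.card V : ℝ) ^ 2) (by positivity)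
      (by simp [N]))
    have h1 : ∀ i j, (R (s, m)).1.1 i j ^ 2 ≤ ‖R (s, m)‖ ^ 2 := by
      intro i j
      rw [← sq_abs]
      refine pow_le_pow_left₀ (abs_nonneg _) ?_ 2
      have h2 : ‖(R (s, m)).1.1‖ ≤ ‖R (s, m)‖ := norm_fst_le (R (s, m))
      exact ((norm_le_pi_norm ((R (s, m)).1.1 i) j).trans
        (norm_le_pi_norm (R (s, m)).1.1 i)).trans h2
    calc _ ≤ ∑ _i : V, ∑ _j : V, ‖R (s, m)‖ ^ 2 :=
          Finset.sum_le_sum fun i _ => Finset.sum_le_sum fun j _ => h1 i j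
      _ = _ := by simp; ring
  · refine le_trans ?_ (hfin (Fintype.card F.terminals) (by positivity)
      (by simp only [N]; nlinarith [sq_nonneg (Fintype.card V : ℝ)]))
    have h1 : ∀ i, (R (s, m)).2 i ^ 2 ≤ ‖R (s, m)‖ ^ 2 := by
      intro i
      rw [← sq_abs]
      refine pow_le_pow_left₀ (abs_nonneg _) ?_ 2
      exact (norm_le_pi_norm (R (s, m)).2 i).trans (norm_snd_le (R (s, m)))
    calc _ ≤ ∑ _i : F.terminals, ‖R (s, m)‖ ^ 2 := Finset.sum_le_sum fun i _ => h1 i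
      _ = _ := by simp

end RootedForest

end

end MixedDim

namespace MixedDim

open MeasureTheory

noncomputable section

/-! ### The inverse permeability -/

theorem measurable_det {α : Type*} [MeasurableSpace α] {n : ℕ}
    {A : α → Matrix (Fin n) (Fin n) ℝ} (hA : ∀ a b, Measurable fun x => A x a b) :
    Measurable fun x => (A x).det := by
  simp only [Matrix.det_apply]
  refine Finset.measurable_fun_sum _ fun σ _ => ?_
  refine Measurable.const_smul ?_ _
  exact Finset.measurable_fun_prod _ fun i _ => hA _ _

theorem measurable_inv_apply {α : Type*} [MeasurableSpace α] {n : ℕ}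
    {A : α → Matrix (Fin n) (Fin n) ℝ} (hA : ∀ a b, Measurable fun x => A x a b) (a b : Fin n) :
    Measurable fun x => (A x)⁻¹ a b := by
  simp only [Matrix.inv_def, Matrix.smul_apply, Matrix.adjugate_apply, Ring.inverse_eq_inv',
    smul_eq_mul]
  refine (measurable_det hA).inv.mul (measurable_det fun i j => ?_)
  by_cases h : i = b
  · subst h
    simp only [Matrix.updateRow_self]
    exact measurable_const
  · simp only [Matrix.updateRow_ne h]
    exact hA i j

section Matrix

variable {n : ℕ} {A : Matrix (Fin n) (Fin n) ℝ} {c : ℝ}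

theorem isUnit_det_of_coercive (hc : 0 < c)
    (hA : ∀ ξ : E n, c * ‖ξ‖ ^ 2 ≤ inner ℝ ξ (Matrix.toEuclideanLin A ξ)) : IsUnit A.det := by
  rw [isUnit_iff_ne_zero]
  intro h0
  obtain ⟨v, hv, hv0⟩ := Matrix.exists_mulVec_eq_zero_iff.2 h0
  have h1 := hA (WithLp.toLp 2 v)
  have h2 : Matrix.toEuclideanLin A (WithLp.toLp 2 v) = 0 := by
    rw [Matrix.toLpLin_toLp, Matrix.toLin'_apply, hv0]
    rfl
  rw [h2, inner_zero_right] at h1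
  have h3 : WithLp.toLp 2 v ≠ (0 : E n) := fun h => hv (by simpa using h)
  have : 0 < ‖(WithLp.toLp 2 v : E n)‖ := norm_pos_iff.2 h3
  nlinarith [mul_pos hc (pow_pos this 2)]

theorem toEuclideanLin_inv_apply (h : IsUnit A.det) (ξ : E n) :
    Matrix.toEuclideanLin A (Matrix.toEuclideanLin A⁻¹ ξ) = ξ := by
  apply (WithLp.ofLp_injective 2)
  simp [Matrix.toLpLin_apply, Matrix.mulVec_mulVec, Matrix.mul_nonsing_inv A h]

/-- Coercivity at `y = A⁻¹ ξ` reads `c ‖y‖² ≤ ⟨y, ξ⟩`. The energy contains only the inverse of the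
permeability, so no upper bound on `kD` is needed. -/
theorem norm_inv_le (hc : 0 < c)
    (hA : ∀ ξ : E n, c * ‖ξ‖ ^ 2 ≤ inner ℝ ξ (Matrix.toEuclideanLin A ξ)) (ξ : E n) :
    ‖Matrix.toEuclideanLin A⁻¹ ξ‖ ≤ ‖ξ‖ / c := by
  have h1 := hA (Matrix.toEuclideanLin A⁻¹ ξ)
  rw [toEuclideanLin_inv_apply (isUnit_det_of_coercive hc hA)] at h1
  have h2 := real_inner_le_norm (Matrix.toEuclideanLin A⁻¹ ξ) ξ
  set y := ‖Matrix.toEuclideanLin A⁻¹ ξ‖ with hy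
  rw [le_div_iff₀ hc]
  have hy0 : 0 ≤ y := norm_nonneg _
  rcases hy0.eq_or_lt with h | h
  · rw [← h, zero_mul]; exact norm_nonneg _
  · have : y * (y * c) ≤ y * ‖ξ‖ := by nlinarith
    exact le_of_mul_le_mul_left this h

theorem inner_inv_nonneg (hc : 0 < c)
    (hA : ∀ ξ : E n, c * ‖ξ‖ ^ 2 ≤ inner ℝ ξ (Matrix.toEuclideanLin A ξ)) (ξ : E n) :
    0 ≤ inner ℝ (Matrix.toEuclideanLin A⁻¹ ξ) ξ := by
  have h1 := hA (Matrix.toEuclideanLin A⁻¹ ξ)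
  rw [toEuclideanLin_inv_apply (isUnit_det_of_coercive hc hA)] at h1
  exact le_trans (by positivity) h1

theorem eq_zero_of_inner_inv_eq_zero (hc : 0 < c)
    (hA : ∀ ξ : E n, c * ‖ξ‖ ^ 2 ≤ inner ℝ ξ (Matrix.toEuclideanLin A ξ)) {ξ : E n}
    (h0 : inner ℝ (Matrix.toEuclideanLin A⁻¹ ξ) ξ = 0) : ξ = 0 := by
  have h1 := hA (Matrix.toEuclideanLin A⁻¹ ξ)
  have hu := isUnit_det_of_coercive hc hA
  rw [toEuclideanLin_inv_apply hu, h0] at h1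
  have h2 : ‖Matrix.toEuclideanLin A⁻¹ ξ‖ ^ 2 = 0 := by
    have := sq_nonneg ‖Matrix.toEuclideanLin A⁻¹ ξ‖
    nlinarith
  rw [pow_eq_zero_iff two_ne_zero, norm_eq_zero] at h2
  rw [← toEuclideanLin_inv_apply hu ξ, h2, map_zero]

theorem inner_inv_le (hc : 0 < c)
    (hA : ∀ ξ : E n, c * ‖ξ‖ ^ 2 ≤ inner ℝ ξ (Matrix.toEuclideanLin A ξ)) (ξ : E n) :
    inner ℝ (Matrix.toEuclideanLin A⁻¹ ξ) ξ ≤ 1 / c * ‖ξ‖ ^ 2 := by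
  refine (real_inner_le_norm _ _).trans ?_
  have := norm_inv_le hc hA ξ
  calc ‖Matrix.toEuclideanLin A⁻¹ ξ‖ * ‖ξ‖ ≤ ‖ξ‖ / c * ‖ξ‖ := by gcongr
    _ = _ := by ring

theorem inner_toEuclideanLin (A : Matrix (Fin n) (Fin n) ℝ) (ξ η : E n) :
    inner ℝ (Matrix.toEuclideanLin A ξ) η = ∑ a, ∑ b, A a b * ξ b * η a := by
  rw [real_inner_comm]
  simp only [PiLp.inner_apply, Matrix.toLpLin_apply, Matrix.mulVec, dotProduct]
  refine Finset.sum_congr rfl fun a _ => ?_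
  simp [Finset.sum_mul]

theorem inner_inv_comm (hs : A.IsSymm) (ξ η : E n) :
    inner ℝ (Matrix.toEuclideanLin A⁻¹ ξ) η = inner ℝ (Matrix.toEuclideanLin A⁻¹ η) ξ := by
  have hs' : (A⁻¹).transpose = A⁻¹ := by rw [Matrix.transpose_nonsing_inv, hs.eq]
  rw [inner_toEuclideanLin, inner_toEuclideanLin, Finset.sum_comm]
  refine Finset.sum_congr rfl fun a _ => Finset.sum_congr rfl fun b _ => ?_
  have : A⁻¹ b a = A⁻¹ a b := congrFun (congrFun hs' a) b
  rw [this]; ring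

end Matrix

/-- Cauchy-Schwarz from nonnegativity of a quadratic polynomial. -/
theorem sq_le_of_quadratic_nonneg {A B C : ℝ} (h : ∀ t : ℝ, 0 ≤ A + 2 * t * B + t ^ 2 * C) :
    B ^ 2 ≤ A * C := by
  have := discrim_le_zero (a := C) (b := 2 * B) (c := A) fun t => by
    have := h t
    nlinarith
  rw [discrim] at this
  nlinarith

/-- A coercive symmetric saddle point problem on finite-dimensional spaces is well posed. -/
theorem existsUnique_saddlePoint {X Y : Type*} [AddCommGroup X] [Module ℝ X]
    [FiniteDimensional ℝ X] [AddCommGroup Y] [Module ℝ Y] [FiniteDimensional ℝ Y]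
    (a : X →ₗ[ℝ] X →ₗ[ℝ] ℝ) (b : X →ₗ[ℝ] Y →ₗ[ℝ] ℝ) (ha : ∀ q, a q q = 0 → q = 0)
    (hb : ∀ p, (∀ v, b v p = 0) → p = 0) (l : Y →ₗ[ℝ] ℝ) :
    ∃! u : X × Y, (∀ v, a u.1 v - b v u.2 = 0) ∧ ∀ w, b u.1 w = l w := by
  let T : X × Y →ₗ[ℝ] Module.Dual ℝ X × Module.Dual ℝ Y :=
    ((a.comp (LinearMap.fst ℝ X Y)) - (b.flip.comp (LinearMap.snd ℝ X Y))).prod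
      (b.comp (LinearMap.fst ℝ X Y))
  have hT : ∀ u : X × Y, ∀ f : Module.Dual ℝ X, ∀ g : Module.Dual ℝ Y, T u = (f, g) ↔
      (∀ v, a u.1 v - b v u.2 = f v) ∧ ∀ w, b u.1 w = g w := by
    intro u f g
    constructor
    · intro h
      exact ⟨fun v => LinearMap.congr_fun (congrArg Prod.fst h) v,
        fun w => LinearMap.congr_fun (congrArg Prod.snd h) w⟩
    · rintro ⟨h1, h2⟩
      exact Prod.ext (LinearMap.ext h1) (LinearMap.ext h2)
  have hinj : Function.Injective T := by
    rw [← LinearMap.ker_eq_bot, LinearMap.ker_eq_bot']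
    rintro ⟨q, p⟩ h
    obtain ⟨h1, h2⟩ := (hT (q, p) 0 0).1 h
    -- The rows tested with `q` and `p` combine to `a q q = 0`.
    have hq : q = 0 := by
      apply ha
      have h3 := h1 q
      have h4 : b q p = 0 := h2 p
      simp only [LinearMap.zero_apply] at h3
      linarith
    have hp : p = 0 := by
      apply hb
      intro v
      have h3 := h1 v
      simp only [hq, map_zero, LinearMap.zero_apply] at h3
      linarith
    rw [hq, hp]; rfl
  have hdim : Module.finrank ℝ (X × Y) = Module.finrank ℝ (Module.Dual ℝ X × Module.Dual ℝ Y) := by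
    simp [Module.finrank_prod, Subspace.dual_finrank_eq]
  have hsurj : Function.Surjective T :=
    (LinearMap.injective_iff_surjective_of_finrank_eq_finrank hdim).1 hinj
  obtain ⟨u, hu⟩ := hsurj (0, l)
  refine ⟨u, ?_, fun u' hu' => hinj ?_⟩
  · simpa using (hT u 0 l).1 hu
  · rw [hu]
    exact (hT u' 0 l).2 (by simpa using hu')

end

end MixedDim

namespace MixedDim

open MeasureTheory

noncomputable section

/-! ### Elements of the discrete spaces as functions -/

theorem exists_affine_of_mem_rt0 {n : ℕ} {K : Cell n} {q : E n → E n} (hq : q ∈ K.rt0) :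
    ∃ A : E n →ᵃ[ℝ] E n, ∀ x, A x = q x := by
  obtain ⟨p, hp, h⟩ := hq
  obtain ⟨P, hP⟩ : ∃ P : E n →ᵃ[ℝ] E n, ∀ x, P x = p x := by
    cases hk : K.kind
    · rw [hk] at hp
      obtain ⟨a, b, hab⟩ := hp
      refine ⟨AffineMap.const ℝ (E n) a + (b • LinearMap.id).toAffineMap, fun x => ?_⟩
      simp [hab x]
    · rw [hk] at hp
      obtain ⟨a, b, hab⟩ := hp
      refine ⟨AffineMap.const ℝ (E n) (WithLp.toLp 2 a) +
        (Matrix.toEuclideanLin (Matrix.diagonal b)).toAffineMap, fun x => ?_⟩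
      ext i
      simp [hab x i, Matrix.toLpLin_apply, Matrix.mulVec_diagonal]
  refine ⟨(K.map.linear : E n →ₗ[ℝ] E n).toAffineMap.comp
    (P.comp (K.map.symm : E n →ᵃ[ℝ] E n)), fun x => ?_⟩
  simp [h x, hP]

/-- The affine vector fields `x ↦ L x + c`. -/
def affineFields (n : ℕ) : ((E n →ₗ[ℝ] E n) × E n) →ₗ[ℝ] (E n → E n) where
  toFun A x := A.1 x + A.2
  map_add' A B := by
    ext1 x
    simp only [Prod.fst_add, Prod.snd_add, LinearMap.add_apply, Pi.add_apply]
    abel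
  map_smul' c A := by
    ext1 x
    simp

theorem rt0_le_affineFields {n : ℕ} {K : Cell n} {q : E n → E n} (hq : q ∈ K.rt0) :
    ∃ A, affineFields n A = q := by
  obtain ⟨A, hA⟩ := exists_affine_of_mem_rt0 hq
  refine ⟨(A.linear, A 0), ?_⟩
  ext1 x
  rw [← hA x]
  conv_rhs => rw [A.decomp]
  rfl

namespace Mesh

variable {n : ℕ} {Ω : Set (E n)} (M : Mesh Ω)

instance finiteDimensional_rt0Zero : FiniteDimensional ℝ M.rt0Zero := by
  let T : (Fin M.N → (E n →ₗ[ℝ] E n) × E n) →ₗ[ℝ] (Fin M.N → E n → E n) :=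
    LinearMap.pi fun τ => affineFields n ∘ₗ LinearMap.proj τ
  refine Submodule.finiteDimensional_of_le (S₂ := LinearMap.range T) fun q hq => ?_
  choose A hA using fun τ => rt0_le_affineFields (hq.1 τ)
  exact ⟨A, funext fun τ => hA τ⟩

variable {M}

theorem continuous_of_mem_rt0Zero {q : Fin M.N → E n → E n} (hq : q ∈ M.rt0Zero) (τ : Fin M.N) :
    Continuous (q τ) := by
  obtain ⟨A, hA⟩ := exists_affine_of_mem_rt0 (hq.1 τ)
  rw [← funext hA]
  exact A.continuous_of_finiteDimensional

theorem differentiable_of_mem_rt0Zero {q : Fin M.N → E n → E n} (hq : q ∈ M.rt0Zero)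
    (τ : Fin M.N) : Differentiable ℝ (q τ) := by
  obtain ⟨A, hA⟩ := rt0_le_affineFields (hq.1 τ)
  rw [← hA]
  exact (A.1.toContinuousLinearMap.differentiable).add_const A.2

theorem divergence_eq_of_mem_rt0Zero {q : Fin M.N → E n → E n} (hq : q ∈ M.rt0Zero)
    (τ : Fin M.N) (x : E n) : divergence (q τ) x = divergence (q τ) 0 := by
  obtain ⟨A, hA⟩ := exists_affine_of_mem_rt0 (hq.1 τ)
  rw [← funext hA, divergence_affine, divergence_affine]

/-- The cellwise (constant) divergence of a Raviart-Thomas field. -/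
def cellDiv : M.rt0Zero →ₗ[ℝ] (Fin M.N → ℝ) where
  toFun q τ := divergence (q.1 τ) 0
  map_add' q q' := by
    ext1 τ
    have h := (differentiable_of_mem_rt0Zero q.2 τ) 0
    have h' := (differentiable_of_mem_rt0Zero q'.2 τ) 0
    change divergence (q.1 τ + q'.1 τ) 0 = _
    simp [divergence, fderiv_add h h']
  map_smul' c q := by
    ext1 τ
    have h := (differentiable_of_mem_rt0Zero q.2 τ) 0
    change divergence (c • q.1 τ) 0 = _
    simp [divergence, fderiv_const_smul h]

theorem cellDiv_apply (q : M.rt0Zero) (τ : Fin M.N) (x : E n) :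
    divergence (q.1 τ) x = cellDiv q τ := divergence_eq_of_mem_rt0Zero q.2 τ x

theorem glue_add {X : Type*} [AddCommMonoid X] (f g : Fin M.N → E n → X) (x : E n) :
    M.glue (f + g) x = M.glue f x + M.glue g x := by
  simp only [glue, ← Finset.sum_add_distrib]
  refine Finset.sum_congr rfl fun τ _ => ?_
  by_cases h : x ∈ interior (M.cell τ).carrier <;> simp [h]

theorem glue_smul {X : Type*} [AddCommGroup X] [Module ℝ X] (c : ℝ) (f : Fin M.N → E n → X)
    (x : E n) : M.glue (c • f) x = c • M.glue f x := by
  simp only [glue, Finset.smul_sum]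
  refine Finset.sum_congr rfl fun τ _ => ?_
  by_cases h : x ∈ interior (M.cell τ).carrier <;> simp [h]

theorem constFn_add (u v : Fin M.N → ℝ) (x : E n) :
    M.constFn (u + v) x = M.constFn u x + M.constFn v x :=
  glue_add (fun τ _ => u τ) (fun τ _ => v τ) x

theorem constFn_smul (c : ℝ) (u : Fin M.N → ℝ) (x : E n) :
    M.constFn (c • u) x = c * M.constFn u x :=
  glue_smul c (fun τ _ => u τ) x

theorem glueOn_add {B : Set (E n)} (c d : M.restrict B → ℝ) (x : E n) :
    M.glueOn B (c + d) x = M.glueOn B c x + M.glueOn B d x := by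
  simp only [glueOn, ← Finset.sum_add_distrib]
  refine Finset.sum_congr rfl fun τ _ => ?_
  by_cases h : x ∈ interior (M.cell τ.1).carrier ∩ B <;> simp [Set.indicator, h]

theorem glueOn_smul {B : Set (E n)} (a : ℝ) (c : M.restrict B → ℝ) (x : E n) :
    M.glueOn B (a • c) x = a * M.glueOn B c x := by
  simp only [glueOn, Finset.mul_sum]
  refine Finset.sum_congr rfl fun τ _ => ?_
  by_cases h : x ∈ interior (M.cell τ.1).carrier ∩ B <;> simp [Set.indicator, h]

theorem measurable_glue {X : Type*} [AddCommMonoid X] [MeasurableSpace X] [MeasurableAdd₂ X]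
    {f : Fin M.N → E n → X} (hf : ∀ τ, Measurable (f τ)) : Measurable (M.glue f) :=
  Finset.measurable_fun_sum _ fun τ _ => (hf τ).indicator isOpen_interior.measurableSet

theorem measurable_glueOn {B : Set (E n)} (hB : MeasurableSet B) (c : M.restrict B → ℝ) :
    Measurable (M.glueOn B c) :=
  Finset.measurable_fun_sum _ fun _ _ =>
    measurable_const.indicator (isOpen_interior.measurableSet.inter hB)

theorem exists_norm_glue_le {X : Type*} [NormedAddCommGroup X] {f : Fin M.N → E n → X}
    (hf : ∀ τ, ∃ R : ℝ, ∀ x ∈ (M.cell τ).carrier, ‖f τ x‖ ≤ R) : ∃ R : ℝ, ∀ x, ‖M.glue f x‖ ≤ R := by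
  choose R hR using hf
  refine ⟨∑ τ, |R τ|, fun x => (norm_sum_le _ _).trans (Finset.sum_le_sum fun τ _ => ?_)⟩
  by_cases h : x ∈ interior (M.cell τ).carrier
  · rw [Set.indicator_of_mem h]
    exact (hR τ x (_root_.interior_subset h)).trans (le_abs_self _)
  · rw [Set.indicator_of_notMem h]; simp

theorem exists_norm_glue_rt0_le (hΩ : Bornology.IsBounded Ω) (q : M.rt0Zero) :
    ∃ R : ℝ, ∀ x, ‖M.glue q.1 x‖ ≤ R := by
  refine exists_norm_glue_le fun τ => ?_
  have hc : IsCompact (closure (M.cell τ).carrier) := (M.isBounded_carrier hΩ τ).isCompact_closure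
  obtain ⟨R, hR⟩ := hc.exists_bound_of_continuousOn (continuous_of_mem_rt0Zero q.2 τ).continuousOn
  exact ⟨R, fun x hx => hR x (subset_closure hx)⟩

theorem exists_norm_constFn_le (u : Fin M.N → ℝ) : ∃ R : ℝ, ∀ x, ‖M.constFn u x‖ ≤ R :=
  exists_norm_glue_le fun τ => ⟨‖u τ‖, fun _ _ => le_rfl⟩

theorem exists_norm_glueOn_le {B : Set (E n)} (c : M.restrict B → ℝ) :
    ∃ R : ℝ, ∀ x, ‖M.glueOn B c x‖ ≤ R := by
  refine ⟨∑ τ, ‖c τ‖, fun x => (norm_sum_le _ _).trans (Finset.sum_le_sum fun τ _ => ?_)⟩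
  exact norm_indicator_le_norm_self _ _

variable (D : M.FacetSystems)
include D

theorem constFn_of_mem (u : Fin M.N → ℝ) {τ : Fin M.N} {x : E n}
    (hx : x ∈ interior (M.cell τ).carrier) : M.constFn u x = u τ :=
  glue_of_mem D (fun τ _ => u τ) hx

theorem glueOn_of_mem {B : Set (E n)} (c : M.restrict B → ℝ) {τ : M.restrict B} {x : E n}
    (hx : x ∈ interior (M.cell τ.1).carrier) (hB : x ∈ B) : M.glueOn B c x = c τ := by
  rw [glueOn, Finset.sum_eq_single τ]
  · rw [Set.indicator_of_mem (Set.mem_inter hx hB)]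
  · intro τ' _ h
    refine Set.indicator_of_notMem (fun h' => ?_) _
    exact notMem_of_mem_interior D (fun e => h (Subtype.ext e.symm)) hx (_root_.interior_subset h'.1)
  · simp

theorem ae_exists_restrict {B : Set (E n)} (hB : B ⊆ Ω) : ∀ᵐ x ∂volume, x ∈ B →
    ∃ τ : M.restrict B, x ∈ interior (M.cell τ.1).carrier := by
  have h0 : ∀ᵐ x ∂volume, ∀ τ, τ ∉ M.restrict B → x ∉ (M.cell τ).carrier ∩ B := by
    rw [ae_all_iff]
    intro τ
    by_cases h : τ ∈ M.restrict B
    · simp [h]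
    · have : volume ((M.cell τ).carrier ∩ B) = 0 := by
        by_contra h'
        exact h (by simp [restrict, h'])
      filter_upwards [measure_eq_zero_iff_ae_notMem.1 this] with x hx _ using hx
  filter_upwards [h0, ae_exists_mem_interior D] with x hx hx' hxB
  obtain ⟨τ, hτ⟩ := hx' (subset_closure (hB hxB))
  refine ⟨⟨τ, ?_⟩, hτ⟩
  by_contra h
  exact hx τ h ⟨_root_.interior_subset hτ, hxB⟩

theorem glueOn_const_ae {B : Set (E n)} (hB : B ⊆ Ω) (c : ℝ) :
    ∀ᵐ x ∂volume, x ∈ B → M.glueOn B (fun _ => c) x = c := by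
  filter_upwards [ae_exists_restrict D hB] with x hx hxB
  obtain ⟨τ, hτ⟩ := hx hxB
  exact glueOn_of_mem D _ hτ hxB

theorem divergence_glue {q : M.rt0Zero} {τ : Fin M.N} {x : E n}
    (hx : x ∈ interior (M.cell τ).carrier) : divergence (M.glue q.1) x = cellDiv q τ := by
  rw [← cellDiv_apply q τ x, divergence, divergence]
  have : M.glue q.1 =ᶠ[nhds x] q.1 τ := by
    filter_upwards [isOpen_interior.mem_nhds hx] with y hy using glue_of_mem D q.1 hy
  rw [this.fderiv_eq]

end Mesh

/-! ### The inner product of `L²(𝔅)` -/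

section L2

variable {V : Type*} [Fintype V] [DecidableEq V] {n : ℕ} {F : RootedForest V} {Ω : Set (E n)}
  {p p' w : Pressure n F}

theorem l2Inner_comm (p w : Pressure n F) : l2Inner Ω p w = l2Inner Ω w p := by
  simp only [l2Inner, mul_comm]

theorem l2Inner_add_left (hp : MemLp p.1 2 (volume.restrict Ω))
    (hp' : MemLp p'.1 2 (volume.restrict Ω)) (hw : MemLp w.1 2 (volume.restrict Ω)) :
    l2Inner Ω (p + p') w = l2Inner Ω p w + l2Inner Ω p' w := by
  have h := integral_add (hp.integrable_mul hw) (hp'.integrable_mul hw)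
  simp only [Pi.mul_apply] at h
  simp only [l2Inner, Prod.fst_add, Prod.snd_add, Pi.add_apply, add_mul, Finset.sum_add_distrib, h]
  ring

theorem l2Inner_smul_left (c : ℝ) (p w : Pressure n F) :
    l2Inner Ω (c • p) w = c * l2Inner Ω p w := by
  simp only [l2Inner, Prod.smul_fst, Prod.smul_snd, Pi.smul_apply, smul_eq_mul, mul_assoc,
    integral_const_mul, mul_add, Finset.mul_sum]

theorem l2Inner_add_right (hp : MemLp p.1 2 (volume.restrict Ω))
    (hp' : MemLp p'.1 2 (volume.restrict Ω)) (hw : MemLp w.1 2 (volume.restrict Ω)) :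
    l2Inner Ω w (p + p') = l2Inner Ω w p + l2Inner Ω w p' := by
  rw [l2Inner_comm, l2Inner_add_left hp hp' hw, l2Inner_comm p, l2Inner_comm p']

theorem l2Inner_smul_right (c : ℝ) (p w : Pressure n F) :
    l2Inner Ω p (c • w) = c * l2Inner Ω p w := by
  rw [l2Inner_comm, l2Inner_smul_left, l2Inner_comm w]

theorem l2Inner_self_nonneg (p : Pressure n F) : 0 ≤ l2Inner Ω p p :=
  add_nonneg (integral_nonneg fun x => mul_self_nonneg (p.1 x))
    (Finset.sum_nonneg fun i _ => mul_self_nonneg (p.2 i))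

theorem l2Norm_nonneg (p : Pressure n F) : 0 ≤ l2Norm Ω p := Real.sqrt_nonneg _

theorem l2Norm_sq (p : Pressure n F) : l2Norm Ω p ^ 2 = l2Inner Ω p p :=
  Real.sq_sqrt (l2Inner_self_nonneg p)

theorem l2Inner_sq_le (hp : MemLp p.1 2 (volume.restrict Ω))
    (hw : MemLp w.1 2 (volume.restrict Ω)) :
    l2Inner Ω p w ^ 2 ≤ l2Inner Ω p p * l2Inner Ω w w := by
  refine sq_le_of_quadratic_nonneg fun t => ?_
  have htw : MemLp (t • w).1 2 (volume.restrict Ω) := hw.const_smul t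
  have h := l2Inner_self_nonneg (Ω := Ω) (p + t • w)
  rw [l2Inner_add_left hp htw (hp.add htw), l2Inner_add_right hp htw hp,
    l2Inner_add_right hp htw htw, l2Inner_smul_left, l2Inner_smul_left, l2Inner_smul_right,
    l2Inner_smul_right, l2Inner_comm w p] at h
  linarith

theorem abs_l2Inner_le (hp : MemLp p.1 2 (volume.restrict Ω))
    (hw : MemLp w.1 2 (volume.restrict Ω)) : |l2Inner Ω p w| ≤ l2Norm Ω p * l2Norm Ω w := by
  refine abs_le_of_sq_le_sq ?_ (mul_nonneg (l2Norm_nonneg _) (l2Norm_nonneg _))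
  rw [mul_pow, l2Norm_sq, l2Norm_sq]
  exact l2Inner_sq_le hp hw

end L2

end

end MixedDim

/-! ### The mixed-dimensional forms on discrete fluxes -/

namespace MixedDim

open MeasureTheory

noncomputable section

variable {V : Type*} [Fintype V] [DecidableEq V] {n : ℕ} {F : RootedForest V} {Ω : Set (E n)}
  {M : Mesh Ω} {K : Coefficients n F} {cD cN cS CS : ℝ}

theorem Coefficients.Admissible.abs_kS_le (hK : K.Admissible Ω cD cN cS CS) {i : F.terminals}
    {x : E n} (hx : x ∈ K.B i) : |K.kS i x| ≤ |CS| := by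
  rw [abs_of_nonneg (hK.kS_nonneg i x hx)]
  exact (hK.kS_le i x hx).trans (le_abs_self _)

theorem isFiniteMeasure_restrict_of_isBounded {n : ℕ} {B : Set (E n)}
    (hB : Bornology.IsBounded B) : IsFiniteMeasure (volume.restrict B) :=
  isFiniteMeasure_restrict.2 hB.measure_lt_top.ne

namespace DiscreteFlux

theorem toFlux_add (q v : DiscreteFlux M K) : toFlux (q + v) = toFlux q + toFlux v := by
  refine Prod.ext (funext fun x => ?_) (Prod.ext (funext fun i => funext fun x => ?_) rfl)
  · exact Mesh.glue_add q.1.1 v.1.1 x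
  · exact Mesh.glueOn_add (q.2.1 i) (v.2.1 i) x

theorem toFlux_smul (c : ℝ) (q : DiscreteFlux M K) : toFlux (c • q) = c • toFlux q := by
  refine Prod.ext (funext fun x => ?_) (Prod.ext (funext fun i => funext fun x => ?_) rfl)
  · exact Mesh.glue_smul c q.1.1 x
  · exact Mesh.glueOn_smul c (q.2.1 i) x

/-- The mass exchange `∑ kS i * qS i` between the network and the domain. -/
def exchange (q : DiscreteFlux M K) (x : E n) : ℝ :=
  ∑ i, (K.B i).indicator (fun y => K.kS i y * M.glueOn (K.B i) (q.2.1 i) y) x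

theorem exchange_add (q v : DiscreteFlux M K) (x : E n) :
    exchange (q + v) x = exchange q x + exchange v x := by
  simp only [exchange, ← Finset.sum_add_distrib]
  refine Finset.sum_congr rfl fun i _ => ?_
  have : M.glueOn (K.B i) ((q + v).2.1 i) x = _ := Mesh.glueOn_add (q.2.1 i) (v.2.1 i) x
  by_cases h : x ∈ K.B i
  · simp only [Set.indicator_of_mem h, this]; ring
  · simp [h]

theorem exchange_smul (c : ℝ) (q : DiscreteFlux M K) (x : E n) :
    exchange (c • q) x = c * exchange q x := by
  simp only [exchange, Finset.mul_sum]
  refine Finset.sum_congr rfl fun i _ => ?_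
  have : M.glueOn (K.B i) ((c • q).2.1 i) x = _ := Mesh.glueOn_smul c (q.2.1 i) x
  by_cases h : x ∈ K.B i
  · simp only [Set.indicator_of_mem h, this]; ring
  · simp [h]

theorem measurable_exchange (hK : K.Admissible Ω cD cN cS CS) (q : DiscreteFlux M K) :
    Measurable (exchange q) :=
  Finset.measurable_fun_sum _ fun i _ =>
    ((hK.kS_measurable i).mul (Mesh.measurable_glueOn (hK.B_measurable i) _)).indicator
      (hK.B_measurable i)

theorem exists_kS_mul_glueOn_le (hK : K.Admissible Ω cD cN cS CS) (i : F.terminals)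
    (c : M.restrict (K.B i) → ℝ) : ∃ R : ℝ, 0 ≤ R ∧
      ∀ x ∈ K.B i, ‖K.kS i x * M.glueOn (K.B i) c x‖ ≤ R := by
  obtain ⟨R, hR⟩ := Mesh.exists_norm_glueOn_le c
  refine ⟨|CS| * R, mul_nonneg (abs_nonneg _) ((norm_nonneg _).trans (hR 0)), fun x hx => ?_⟩
  rw [norm_mul]
  exact mul_le_mul (hK.abs_kS_le hx) (hR x) (norm_nonneg _) (abs_nonneg _)

theorem exists_exchange_le (hK : K.Admissible Ω cD cN cS CS) (q : DiscreteFlux M K) :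
    ∃ R : ℝ, ∀ x, ‖exchange q x‖ ≤ R := by
  choose R hR0 hR using fun i => exists_kS_mul_glueOn_le hK i (q.2.1 i)
  refine ⟨∑ i, R i, fun x => (norm_sum_le _ _).trans (Finset.sum_le_sum fun i _ => ?_)⟩
  by_cases h : x ∈ K.B i
  · rw [Set.indicator_of_mem h]; exact hR i x h
  · rw [Set.indicator_of_notMem h, norm_zero]; exact hR0 i

theorem integrableOn_kS_mul_glueOn (hΩ : Bornology.IsBounded Ω)
    (hK : K.Admissible Ω cD cN cS CS) (i : F.terminals) (c : M.restrict (K.B i) → ℝ) :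
    IntegrableOn (fun x => K.kS i x * M.glueOn (K.B i) c x) (K.B i) := by
  obtain ⟨R, -, hR⟩ := exists_kS_mul_glueOn_le hK i c
  have := isFiniteMeasure_restrict_of_isBounded (hΩ.subset (hK.B_subset i))
  refine Integrable.of_bound ((hK.kS_measurable i).mul
    (Mesh.measurable_glueOn (hK.B_measurable i) _)).aestronglyMeasurable R ?_
  exact (ae_restrict_iff' (hK.B_measurable i)).2 (Filter.Eventually.of_forall hR)

/-- The divergence of a discrete flux, with the first component given as the cellwise divergence
minus the exchange term. -/
def divFn (q : DiscreteFlux M K) : Pressure n F :=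
  (fun x => M.constFn (Mesh.cellDiv q.1) x - exchange q x, (mdDiv K (toFlux q)).2)

theorem memLp_constFn (hΩ : Bornology.IsBounded Ω) (u : Fin M.N → ℝ) :
    MemLp (M.constFn u) 2 (volume.restrict Ω) := by
  have := isFiniteMeasure_restrict_of_isBounded hΩ
  obtain ⟨R, hR⟩ := Mesh.exists_norm_constFn_le u
  exact MemLp.of_bound (M.measurable_constFn u).aestronglyMeasurable R (Filter.Eventually.of_forall hR)

theorem memLp_exchange (hΩ : Bornology.IsBounded Ω) (hK : K.Admissible Ω cD cN cS CS)
    (q : DiscreteFlux M K) : MemLp (exchange q) 2 (volume.restrict Ω) := by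
  have := isFiniteMeasure_restrict_of_isBounded hΩ
  obtain ⟨R, hR⟩ := exists_exchange_le hK q
  exact MemLp.of_bound (measurable_exchange hK q).aestronglyMeasurable R
    (Filter.Eventually.of_forall hR)

theorem memLp_divFn (hΩ : Bornology.IsBounded Ω) (hK : K.Admissible Ω cD cN cS CS)
    (q : DiscreteFlux M K) : MemLp (divFn q).1 2 (volume.restrict Ω) :=
  (memLp_constFn hΩ _).sub (memLp_exchange hΩ hK q)

theorem divFn_add (hΩ : Bornology.IsBounded Ω) (hK : K.Admissible Ω cD cN cS CS)
    (q v : DiscreteFlux M K) : divFn (q + v) = divFn q + divFn v := by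
  refine Prod.ext (funext fun x => ?_) (funext fun i => ?_)
  · have := Mesh.constFn_add (Mesh.cellDiv q.1) (Mesh.cellDiv v.1) x
    simp only [divFn, Prod.fst_add, map_add, this, exchange_add, Pi.add_apply]
    ring
  · simp only [divFn, Prod.snd_add, Pi.add_apply, mdDiv, toFlux_add, Finset.sum_add_distrib]
    by_cases h : i.1 ∈ F.terminals
    · have h1 := integral_add (integrableOn_kS_mul_glueOn hΩ hK ⟨i.1, h⟩ (q.2.1 ⟨i.1, h⟩))
        (integrableOn_kS_mul_glueOn hΩ hK ⟨i.1, h⟩ (v.2.1 ⟨i.1, h⟩))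
      simp only [dif_pos h, Prod.fst_add, Pi.add_apply, mul_add]
      rw [show (∫ x in K.B ⟨i.1, h⟩, (K.kS ⟨i.1, h⟩ x * (toFlux q).2.1 ⟨i.1, h⟩ x +
        K.kS ⟨i.1, h⟩ x * (toFlux v).2.1 ⟨i.1, h⟩ x)) = _ from h1]
      simp only [toFlux]
      ring
    · simp only [dif_neg h]
      ring

theorem divFn_smul (c : ℝ) (q : DiscreteFlux M K) : divFn (c • q) = c • divFn q := by
  refine Prod.ext (funext fun x => ?_) (funext fun i => ?_)
  · have := Mesh.constFn_smul c (Mesh.cellDiv q.1) x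
    simp only [divFn, Prod.smul_fst, map_smul, this, exchange_smul, Pi.smul_apply, smul_eq_mul]
    ring
  · simp only [divFn, Prod.smul_snd, Pi.smul_apply, mdDiv, toFlux_smul, smul_eq_mul]
    by_cases h : i.1 ∈ F.terminals
    · simp only [dif_pos h, Prod.smul_fst, Pi.smul_apply, smul_eq_mul, mul_left_comm _ c,
        integral_const_mul, ← Finset.mul_sum]
      ring
    · simp only [dif_neg h, ← Finset.mul_sum]
      ring

/-- The two can differ only on a null set such as the mesh skeleton, where the glued field need not
be differentiable. In contrast to the pointwise divergence, `divFn` is linear in `q` at every point,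
so the algebra is done with it. -/
theorem mdDiv_fst_ae (D : M.FacetSystems) (hopen : IsOpen Ω) (q : DiscreteFlux M K) :
    ∀ᵐ x ∂volume.restrict Ω, (mdDiv K (toFlux q)).1 x = (divFn q).1 x := by
  rw [ae_restrict_iff' hopen.measurableSet]
  filter_upwards [Mesh.ae_exists_mem_interior D] with x hx hxΩ
  obtain ⟨τ, hτ⟩ := hx (subset_closure hxΩ)
  simp only [mdDiv, divFn, toFlux, exchange]
  rw [Mesh.divergence_glue D hτ, Mesh.constFn_of_mem D _ hτ]

theorem l2Inner_mdDiv_right (D : M.FacetSystems) (hopen : IsOpen Ω) (p : Pressure n F)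
    (q : DiscreteFlux M K) : l2Inner Ω p (mdDiv K (toFlux q)) = l2Inner Ω p (divFn q) := by
  simp only [l2Inner]
  congr 1
  refine integral_congr_ae ?_
  filter_upwards [mdDiv_fst_ae D hopen q] with x hx
  rw [hx]

theorem l2Inner_mdDiv_left (D : M.FacetSystems) (hopen : IsOpen Ω) (p : Pressure n F)
    (q : DiscreteFlux M K) : l2Inner Ω (mdDiv K (toFlux q)) p = l2Inner Ω (divFn q) p := by
  rw [l2Inner_comm, l2Inner_mdDiv_right D hopen, l2Inner_comm]

theorem l2Norm_mdDiv (D : M.FacetSystems) (hopen : IsOpen Ω) (q : DiscreteFlux M K) :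
    l2Norm Ω (mdDiv K (toFlux q)) = l2Norm Ω (divFn q) := by
  rw [l2Norm, l2Norm, l2Inner_mdDiv_right D hopen, l2Inner_mdDiv_left D hopen]

theorem measurable_toFlux_fst (q : DiscreteFlux M K) : Measurable (toFlux q).1 :=
  Mesh.measurable_glue fun τ => (Mesh.continuous_of_mem_rt0Zero q.1.2 τ).measurable

/-! ### The bilinear form of the inverse permeability -/

theorem integrableOn_inner_inv (hΩ : Bornology.IsBounded Ω) (hopen : IsOpen Ω) (hcD : 0 < cD)
    (hK : K.Admissible Ω cD cN cS CS) (q v : DiscreteFlux M K) :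
    IntegrableOn (fun x => inner ℝ (Matrix.toEuclideanLin (K.kD x)⁻¹ ((toFlux q).1 x))
      ((toFlux v).1 x)) Ω := by
  have := isFiniteMeasure_restrict_of_isBounded hΩ
  obtain ⟨R, hR⟩ := Mesh.exists_norm_glue_rt0_le hΩ q.1
  obtain ⟨S, hS⟩ := Mesh.exists_norm_glue_rt0_le hΩ v.1
  refine Integrable.of_bound (C := R / cD * S) (Measurable.aestronglyMeasurable ?_) ?_
  · simp only [inner_toEuclideanLin]
    refine Finset.measurable_fun_sum _ fun a _ => Finset.measurable_fun_sum _ fun b _ => ?_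
    refine ((measurable_inv_apply hK.kD_measurable a b).mul ?_).mul ?_
    · exact (EuclideanSpace.proj b).continuous.measurable.comp (measurable_toFlux_fst q)
    · exact (EuclideanSpace.proj a).continuous.measurable.comp (measurable_toFlux_fst v)
  · refine (ae_restrict_iff' hopen.measurableSet).2 (Filter.Eventually.of_forall fun x hx => ?_)
    refine (norm_inner_le_norm _ _).trans ?_
    refine mul_le_mul ((norm_inv_le hcD (hK.kD_lower x hx) _).trans ?_) (hS x) (norm_nonneg _) ?_
    · have := hR x
      simp only [toFlux]
      gcongr
    · exact div_nonneg ((norm_nonneg _).trans (hR 0)) hcD.le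

theorem integrableOn_glueOn_mul (hΩ : Bornology.IsBounded Ω) (hK : K.Admissible Ω cD cN cS CS)
    (i : F.terminals) (c d : M.restrict (K.B i) → ℝ) :
    IntegrableOn (fun x => M.glueOn (K.B i) c x * M.glueOn (K.B i) d x) (K.B i) := by
  obtain ⟨R, hR⟩ := Mesh.exists_norm_glueOn_le c
  obtain ⟨S, hS⟩ := Mesh.exists_norm_glueOn_le d
  have := isFiniteMeasure_restrict_of_isBounded (hΩ.subset (hK.B_subset i))
  refine Integrable.of_bound (C := R * S) ((Mesh.measurable_glueOn (hK.B_measurable i) _).mul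
    (Mesh.measurable_glueOn (hK.B_measurable i) _)).aestronglyMeasurable ?_
  refine Filter.Eventually.of_forall fun x => ?_
  rw [norm_mul]
  exact mul_le_mul (hR x) (hS x) (norm_nonneg _) ((norm_nonneg _).trans (hR 0))

theorem kInner_comm (hopen : IsOpen Ω) (hK : K.Admissible Ω cD cN cS CS) (q v : Flux n F) :
    kInner Ω K q v = kInner Ω K v q := by
  simp only [kInner]
  congr 1
  · congr 1
    · refine setIntegral_congr_fun hopen.measurableSet fun x hx => ?_
      exact inner_inv_comm (hK.kD_symm x hx) _ _
    · simp only [mul_comm]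
  · congr 1
    refine Finset.sum_congr rfl fun i _ => Finset.sum_congr rfl fun j _ => ?_
    ring

theorem kInner_add_left (hΩ : Bornology.IsBounded Ω) (hopen : IsOpen Ω) (hcD : 0 < cD)
    (hK : K.Admissible Ω cD cN cS CS) (q q' v : DiscreteFlux M K) :
    kInner Ω K (toFlux (q + q')) (toFlux v) =
      kInner Ω K (toFlux q) (toFlux v) + kInner Ω K (toFlux q') (toFlux v) := by
  have h1 := integral_add (integrableOn_inner_inv hΩ hopen hcD hK q v)
    (integrableOn_inner_inv hΩ hopen hcD hK q' v)
  have h2 : ∀ i, _ := fun i => integral_add (integrableOn_glueOn_mul hΩ hK i (q.2.1 i) (v.2.1 i))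
    (integrableOn_glueOn_mul hΩ hK i (q'.2.1 i) (v.2.1 i))
  rw [toFlux_add]
  simp only [kInner, Prod.fst_add, Prod.snd_add, Pi.add_apply, map_add, inner_add_left, add_mul,
    mul_add, Finset.sum_add_distrib, h1]
  have h3 : ∀ i, (∫ x in K.B i, ((toFlux q).2.1 i x * (toFlux v).2.1 i x +
    (toFlux q').2.1 i x * (toFlux v).2.1 i x)) = _ := h2
  simp only [h3, Finset.sum_add_distrib]
  simp only [toFlux]
  ring

theorem kInner_smul_left (c : ℝ) (q v : DiscreteFlux M K) :
    kInner Ω K (toFlux (c • q)) (toFlux v) = c * kInner Ω K (toFlux q) (toFlux v) := by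
  rw [toFlux_smul]
  simp only [kInner, Prod.smul_fst, Prod.smul_snd, Pi.smul_apply, map_smul, inner_smul_left,
    smul_eq_mul, mul_assoc, integral_const_mul, mul_add, Finset.mul_sum, mul_left_comm _ c]
  simp

/-- `(q, v) ↦ (q, v)_{𝔎⁻¹}` as a bilinear form on the discrete fluxes. -/
def kForm (hΩ : Bornology.IsBounded Ω) (hopen : IsOpen Ω) (hcD : 0 < cD)
    (hK : K.Admissible Ω cD cN cS CS) : DiscreteFlux M K →ₗ[ℝ] DiscreteFlux M K →ₗ[ℝ] ℝ :=
  LinearMap.mk₂ ℝ (fun q v => kInner Ω K (toFlux q) (toFlux v))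
    (kInner_add_left hΩ hopen hcD hK) kInner_smul_left
    (fun q v v' => by
      rw [kInner_comm hopen hK, kInner_add_left hΩ hopen hcD hK, kInner_comm hopen hK,
        kInner_comm hopen hK (toFlux v')])
    (fun c q v => by
      rw [kInner_comm hopen hK, kInner_smul_left, kInner_comm hopen hK, smul_eq_mul])

theorem edge_term_nonneg (hcN : 0 < cN) (hK : K.Admissible Ω cD cN cS CS) (q : Flux n F)
    {i j : V} (h : F.graph.Adj i j) : 0 ≤ (K.kN s(i, j))⁻¹ * q.2.2 i j * q.2.2 i j := by
  rw [mul_assoc]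
  exact mul_nonneg (inv_nonneg.2 (hcN.le.trans (hK.kN_lower _ h))) (mul_self_nonneg _)

open Classical in
theorem kInner_parts_nonneg (hopen : IsOpen Ω) (hcD : 0 < cD) (hcN : 0 < cN)
    (hK : K.Admissible Ω cD cN cS CS) (q : Flux n F) :
    (0 ≤ ∫ x in Ω, inner ℝ (Matrix.toEuclideanLin (K.kD x)⁻¹ (q.1 x)) (q.1 x)) ∧
    (0 ≤ ∑ i, ∫ x in K.B i, q.2.1 i x * q.2.1 i x) ∧
    0 ≤ 1 / 2 * ∑ i, ∑ j with F.graph.Adj i j, (K.kN s(i, j))⁻¹ * q.2.2 i j * q.2.2 i j := by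
  refine ⟨setIntegral_nonneg hopen.measurableSet fun x hx => inner_inv_nonneg hcD
    (hK.kD_lower x hx) _, Finset.sum_nonneg fun i _ => integral_nonneg fun x => mul_self_nonneg _,
    mul_nonneg (by norm_num) (Finset.sum_nonneg fun i _ => Finset.sum_nonneg fun j hj => ?_)⟩
  exact edge_term_nonneg hcN hK q (Finset.mem_filter.1 hj).2

theorem kInner_self_nonneg (hopen : IsOpen Ω) (hcD : 0 < cD) (hcN : 0 < cN)
    (hK : K.Admissible Ω cD cN cS CS) (q : Flux n F) : 0 ≤ kInner Ω K q q := by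
  obtain ⟨h1, h2, h3⟩ := kInner_parts_nonneg hopen hcD hcN hK q
  exact add_nonneg (add_nonneg h1 h2) h3

theorem integral_sq_le_kInner (hopen : IsOpen Ω) (hcD : 0 < cD) (hcN : 0 < cN)
    (hK : K.Admissible Ω cD cN cS CS) (q : Flux n F) :
    ∑ i, ∫ x in K.B i, q.2.1 i x * q.2.1 i x ≤ kInner Ω K q q := by
  obtain ⟨h1, h2, h3⟩ := kInner_parts_nonneg hopen hcD hcN hK q
  rw [kInner]
  linarith

theorem rt0_eq_zero {q : M.rt0Zero} {τ : Fin M.N} {U : Set (E n)} (hU : IsOpen U)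
    (hne : U.Nonempty) (h : ∀ x ∈ U, q.1 τ x = 0) : q.1 τ = 0 := by
  obtain ⟨A, hA⟩ := rt0_le_affineFields (q.2.1 τ)
  obtain ⟨x, hx⟩ := hne
  have h1 : HasFDerivAt (q.1 τ) A.1.toContinuousLinearMap x := by
    rw [← hA]
    exact (A.1.toContinuousLinearMap.hasFDerivAt).add_const A.2
  have h2 : q.1 τ =ᶠ[nhds x] fun _ => 0 := by
    filter_upwards [hU.mem_nhds hx] with y hy using h y hy
  have h3 : A.1.toContinuousLinearMap = 0 := by
    rw [← h1.fderiv, h2.fderiv_eq]; simp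
  have h4 : A.1 = 0 := by
    ext1 y; exact congrArg (fun L : E n →L[ℝ] E n => L y) h3
  have h5 : A.2 = 0 := by
    have := h x hx
    rw [← hA] at this
    simpa [affineFields, h4] using this
  rw [← hA]
  ext1 y
  simp [affineFields, h4, h5]

/-- Each part of the energy vanishes separately. On a cell the affine field is zero almost
everywhere, hence zero. On `B i` every coefficient is seen, because `restrict` keeps only cells that
meet `B i` in positive measure. -/
theorem eq_zero_of_kInner_self (D : M.FacetSystems) (hΩ : Bornology.IsBounded Ω) (hopen : IsOpen Ω)
    (hreg : interior (closure Ω) = Ω) (hvol : ∀ τ, 0 < M.vol τ)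
    (hcD : 0 < cD) (hcN : 0 < cN) (hK : K.Admissible Ω cD cN cS CS) (q : DiscreteFlux M K)
    (h0 : kInner Ω K (toFlux q) (toFlux q) = 0) : q = 0 := by
  classical
  obtain ⟨h1, h2, h3⟩ := kInner_parts_nonneg hopen hcD hcN hK (toFlux q)
  rw [kInner] at h0
  have e1 : (∫ x in Ω, inner ℝ (Matrix.toEuclideanLin (K.kD x)⁻¹ ((toFlux q).1 x))
      ((toFlux q).1 x)) = 0 := by linarith
  have e2 : (∑ i, ∫ x in K.B i, (toFlux q).2.1 i x * (toFlux q).2.1 i x) = 0 := by linarith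
  have e3 : (∑ i, ∑ j with F.graph.Adj i j,
    (K.kN s(i, j))⁻¹ * (toFlux q).2.2 i j * (toFlux q).2.2 i j) = 0 := by linarith
  refine Prod.ext (Subtype.ext (funext fun τ => ?_)) (Prod.ext (funext fun i => funext fun τ => ?_)
    (Subtype.ext (funext fun i => funext fun j => ?_)))
  · rw [setIntegral_eq_zero_iff_of_nonneg_ae
      ((ae_restrict_iff' hopen.measurableSet).2 (Filter.Eventually.of_forall fun x hx =>
        inner_inv_nonneg hcD (hK.kD_lower x hx) _))
      (integrableOn_inner_inv hΩ hopen hcD hK q q)] at e1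
    have e4 := ae_imp_of_ae_restrict e1
    have hne : (interior (M.cell τ).carrier).Nonempty := by
      rw [Set.nonempty_iff_ne_empty]
      intro h
      have := hvol τ
      rw [Mesh.vol_eq D, h] at this
      simp at this
    refine rt0_eq_zero isOpen_interior hne ?_
    refine Measure.eqOn_open_of_ae_eq (μ := volume) ?_ isOpen_interior
      (Mesh.continuous_of_mem_rt0Zero q.1.2 τ).continuousOn continuousOn_const
    refine (ae_restrict_iff' isOpen_interior.measurableSet).2 ?_
    filter_upwards [e4] with x hx hxτ
    have hxΩ := M.interior_subset hreg τ hxτ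
    have := eq_zero_of_inner_inv_eq_zero hcD (hK.kD_lower x hxΩ) (hx hxΩ)
    exact (Mesh.glue_of_mem D q.1.1 hxτ).symm.trans this
  · have e4 := (Finset.sum_eq_zero_iff_of_nonneg fun i _ =>
      integral_nonneg fun x => mul_self_nonneg ((toFlux q).2.1 i x)).1 e2 i (Finset.mem_univ _)
    rw [integral_eq_zero_iff_of_nonneg (fun x => mul_self_nonneg ((toFlux q).2.1 i x))
      (integrableOn_glueOn_mul hΩ hK i (q.2.1 i) (q.2.1 i))] at e4
    have e5 := ae_imp_of_ae_restrict e4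
    have hτ : volume ((M.cell τ.1).carrier ∩ K.B i) ≠ 0 := by
      have := τ.2
      simpa [Mesh.restrict] using this
    have hτ' : volume (interior (M.cell τ.1).carrier ∩ K.B i) ≠ 0 := by
      have : volume (interior (M.cell τ.1).carrier ∩ K.B i) =
          volume ((M.cell τ.1).carrier ∩ K.B i) :=
        measure_congr (ae_eq_set_inter (Mesh.interior_ae_eq D τ.1) (ae_eq_refl _))
      rwa [this]
    have e6 : ∃ᵐ x ∂volume, x ∈ interior (M.cell τ.1).carrier ∩ K.B i :=
      frequently_ae_mem_iff.2 hτ'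
    obtain ⟨x, hx, hx'⟩ := (e6.and_eventually e5).exists
    have := hx' hx.2
    simpa [toFlux, Mesh.glueOn_of_mem D _ hx.1 hx.2] using this
  · by_cases h : F.graph.Adj i j
    · have e4 := (Finset.sum_eq_zero_iff_of_nonneg fun i _ => Finset.sum_nonneg fun j hj =>
        edge_term_nonneg hcN hK (toFlux q) (Finset.mem_filter.1 hj).2).1 e3 i (Finset.mem_univ _)
      have e5 := (Finset.sum_eq_zero_iff_of_nonneg fun j hj =>
        edge_term_nonneg hcN hK (toFlux q) (Finset.mem_filter.1 hj).2).1 e4 j (by simp [h])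
      have hk : (K.kN s(i, j))⁻¹ ≠ 0 := inv_ne_zero (hcN.trans_le (hK.kN_lower _ h)).ne'
      simpa [hk, toFlux] using e5
    · exact q.2.2.2.2 i j h

/-- Cauchy-Schwarz for `(q, v)_{𝔎⁻¹}`. -/
theorem kInner_sq_le (hΩ : Bornology.IsBounded Ω) (hopen : IsOpen Ω) (hcD : 0 < cD) (hcN : 0 < cN)
    (hK : K.Admissible Ω cD cN cS CS) (q v : DiscreteFlux M K) :
    kInner Ω K (toFlux q) (toFlux v) ^ 2 ≤
      kInner Ω K (toFlux q) (toFlux q) * kInner Ω K (toFlux v) (toFlux v) := by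
  refine sq_le_of_quadratic_nonneg fun t => ?_
  have h := kInner_self_nonneg hopen hcD hcN hK (toFlux (q + t • v))
  have h' : kForm hΩ hopen hcD hK (q + t • v) (q + t • v) = kInner Ω K (toFlux q) (toFlux q) +
      2 * t * kInner Ω K (toFlux q) (toFlux v) + t ^ 2 * kInner Ω K (toFlux v) (toFlux v) := by
    have e : ∀ q v : DiscreteFlux M K,
      kForm hΩ hopen hcD hK q v = kInner Ω K (toFlux q) (toFlux v) := fun _ _ => rfl
    simp only [map_add, map_smul, LinearMap.add_apply, LinearMap.smul_apply, smul_eq_mul, e,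
      kInner_comm hopen hK (toFlux v) (toFlux q)]
    ring
  rw [← h']
  exact h

end DiscreteFlux

end

end MixedDim

/-! ### Cell averages and estimates for the exchange term -/

namespace MixedDim

open MeasureTheory

noncomputable section

variable {V : Type*} [Fintype V] [DecidableEq V] {n : ℕ} {F : RootedForest V} {Ω : Set (E n)}
  {M : Mesh Ω} {K : Coefficients n F} {cD cN cS CS : ℝ}

namespace Mesh

theorem integral_constFn_mul (D : M.FacetSystems) (hreg : interior (closure Ω) = Ω)
    (u : Fin M.N → ℝ) {f : E n → ℝ} (hf : IntegrableOn f Ω) :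
    ∫ x in Ω, M.constFn u x * f x = ∑ τ, u τ * ∫ x in interior (M.cell τ).carrier, f x := by
  have h : ∀ τ, Set.EqOn (fun x => M.constFn u x * f x) (fun x => u τ * f x)
      (interior (M.cell τ).carrier) := fun τ x hx => by
    simp only [constFn_of_mem D u hx]
  rw [(integral_eq_sum D hreg fun τ => ?_).2]
  · refine Finset.sum_congr rfl fun τ _ => ?_
    rw [setIntegral_congr_fun isOpen_interior.measurableSet (h τ), integral_const_mul]
  · refine IntegrableOn.congr_fun ?_ (h τ).symm isOpen_interior.measurableSet
    exact (hf.mono_set (M.interior_subset hreg τ)).const_mul _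

theorem integral_constFn_mul_constFn (D : M.FacetSystems) (hΩ : Bornology.IsBounded Ω)
    (hreg : interior (closure Ω) = Ω) (u v : Fin M.N → ℝ) :
    ∫ x in Ω, M.constFn u x * M.constFn v x = ∑ τ, M.vol τ * (u τ * v τ) := by
  have hInt := fun τ => setIntegral_const_interior D hΩ τ (fun x hx => constFn_of_mem D v hx)
  rw [integral_constFn_mul D hreg u (integral_eq_sum D hreg fun τ => (hInt τ).1).1]
  refine Finset.sum_congr rfl fun τ _ => ?_
  rw [(hInt τ).2]
  ring

/-- The cellwise averages of a function. -/
def average (M : Mesh Ω) (f : E n → ℝ) (τ : Fin M.N) : ℝ :=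
  (∫ x in interior (M.cell τ).carrier, f x) / M.vol τ

theorem integral_constFn_mul_eq_average (D : M.FacetSystems)
    (hreg : interior (closure Ω) = Ω) (hvol : ∀ τ, 0 < M.vol τ) (u : Fin M.N → ℝ)
    {f : E n → ℝ} (hf : IntegrableOn f Ω) :
    ∫ x in Ω, M.constFn u x * f x = ∑ τ, M.vol τ * (u τ * M.average f τ) := by
  rw [integral_constFn_mul D hreg u hf]
  refine Finset.sum_congr rfl fun τ _ => ?_
  have := (hvol τ).ne'
  rw [average]
  field_simp

theorem sum_vol_mul_average (D : M.FacetSystems)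
    (hreg : interior (closure Ω) = Ω) (hvol : ∀ τ, 0 < M.vol τ) {f : E n → ℝ}
    (hf : IntegrableOn f Ω) : ∑ τ, M.vol τ * M.average f τ = ∫ x in Ω, f x := by
  rw [(integral_eq_sum D hreg fun τ => hf.mono_set (M.interior_subset hreg τ)).2]
  refine Finset.sum_congr rfl fun τ _ => ?_
  rw [average, mul_div_cancel₀ _ (hvol τ).ne']

theorem integral_sub_sq {f g : E n → ℝ} (hf : MemLp f 2 (volume.restrict Ω))
    (hg : MemLp g 2 (volume.restrict Ω)) :
    ∫ x in Ω, (f x - g x) * (f x - g x) =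
      (∫ x in Ω, f x * f x) - 2 * (∫ x in Ω, f x * g x) + ∫ x in Ω, g x * g x := by
  have h1 := hf.integrable_mul hf
  have h2 := hf.integrable_mul hg
  have h3 := hg.integrable_mul hg
  have e : (fun x => (f x - g x) * (f x - g x)) =
      (f * f - fun x => 2 * (f * g) x) + g * g := by
    ext x; simp only [Pi.add_apply, Pi.sub_apply, Pi.mul_apply]; ring
  rw [e, integral_add' (h1.sub (h2.const_mul 2)) h3, integral_sub' h1 (h2.const_mul 2),
    integral_const_mul]
  rfl

theorem integral_sub_sq_le {f g : E n → ℝ} (hf : MemLp f 2 (volume.restrict Ω))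
    (hg : MemLp g 2 (volume.restrict Ω)) :
    ∫ x in Ω, (f x - g x) * (f x - g x) ≤
      2 * (∫ x in Ω, f x * f x) + 2 * ∫ x in Ω, g x * g x := by
  have h1 := integral_sub_sq hf hg
  have h2 := integral_sub_sq hf hg.neg
  have h3 : 0 ≤ ∫ x in Ω, (f x - (-g) x) * (f x - (-g) x) :=
    integral_nonneg fun x => mul_self_nonneg _
  simp only [Pi.neg_apply, mul_neg, neg_mul, neg_neg, integral_neg] at h2 h3
  rw [h2] at h3
  linarith

/-- Averaging is the orthogonal projection of `L²` onto the cellwise constants, so `0 ≤ ‖average f -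
f‖² = ‖f‖² - ‖average f‖²`. -/
theorem sum_vol_mul_average_sq_le (D : M.FacetSystems) (hΩ : Bornology.IsBounded Ω)
    (hreg : interior (closure Ω) = Ω) (hvol : ∀ τ, 0 < M.vol τ) {f : E n → ℝ}
    (hf : MemLp f 2 (volume.restrict Ω)) :
    ∑ τ, M.vol τ * (M.average f τ * M.average f τ) ≤ ∫ x in Ω, f x * f x := by
  have := isFiniteMeasure_restrict_of_isBounded hΩ
  have h := integral_sub_sq (DiscreteFlux.memLp_constFn hΩ (M.average f)) hf
  rw [integral_constFn_mul_constFn D hΩ hreg, integral_constFn_mul_eq_average D hreg hvol _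
    (hf.integrable (by norm_num))] at h
  have h0 : 0 ≤ ∫ x in Ω, (M.constFn (M.average f) x - f x) * (M.constFn (M.average f) x - f x) :=
    integral_nonneg fun x => mul_self_nonneg _
  linarith

theorem integral_norm_glue_sq (D : M.FacetSystems) (hΩ : Bornology.IsBounded Ω)
    (hreg : interior (closure Ω) = Ω) (q : M.rt0Zero) :
    IntegrableOn (fun x => ‖M.glue q.1 x‖ ^ 2) Ω ∧
    ∫ x in Ω, ‖M.glue q.1 x‖ ^ 2 = ∑ τ, ∫ x in (M.cell τ).carrier, ‖q.1 τ x‖ ^ 2 := by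
  have h : ∀ τ, Set.EqOn (fun x => ‖M.glue q.1 x‖ ^ 2) (fun x => ‖q.1 τ x‖ ^ 2)
      (interior (M.cell τ).carrier) := fun τ x hx => by
    simp only [glue_of_mem D q.1 hx]
  have hi : ∀ τ, IntegrableOn (fun x => ‖M.glue q.1 x‖ ^ 2) (interior (M.cell τ).carrier) := by
    intro τ
    have hc : IsCompact (closure (M.cell τ).carrier) := (M.isBounded_carrier hΩ τ).isCompact_closure
    refine IntegrableOn.congr_fun ?_ (h τ).symm isOpen_interior.measurableSet
    refine IntegrableOn.mono_set ?_ (_root_.interior_subset.trans subset_closure)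
    exact ((continuous_of_mem_rt0Zero q.2 τ).norm.pow 2).continuousOn.integrableOn_compact hc
  refine ⟨(integral_eq_sum D hreg hi).1, (integral_eq_sum D hreg hi).2.trans ?_⟩
  refine Finset.sum_congr rfl fun τ _ => ?_
  rw [setIntegral_congr_fun isOpen_interior.measurableSet (h τ),
    setIntegral_congr_set (interior_ae_eq D τ)]

theorem sum_vol_mul_sq_le (D : M.FacetSystems) (hΩ : Bornology.IsBounded Ω)
    (hreg : interior (closure Ω) = Ω) (u : Fin M.N → ℝ) :
    (∑ τ, M.vol τ * u τ) ^ 2 ≤ volume.real Ω * ∑ τ, M.vol τ * (u τ * u τ) := by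
  rw [← sum_vol D hΩ hreg]
  refine Finset.sum_sq_le_sum_mul_sum_of_sq_le_mul _ (fun τ _ => M.vol_nonneg τ)
    (fun τ _ => mul_nonneg (M.vol_nonneg τ) (mul_self_nonneg _)) fun τ _ => le_of_eq ?_
  ring

end Mesh

namespace DiscreteFlux

theorem integral_indicator_of_subset (hK : K.Admissible Ω cD cN cS CS) (i : F.terminals)
    (f : E n → ℝ) : ∫ x in Ω, (K.B i).indicator f x = ∫ x in K.B i, f x := by
  rw [integral_indicator (hK.B_measurable i), Measure.restrict_restrict (hK.B_measurable i),
    Set.inter_eq_left.2 (hK.B_subset i)]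

/-- The regions `B i` may overlap, so Cauchy-Schwarz over the terminals costs a factor equal to
their number. -/
theorem integral_exchange_sq_le (hΩ : Bornology.IsBounded Ω) (hK : K.Admissible Ω cD cN cS CS)
    (q : DiscreteFlux M K) : ∫ x in Ω, exchange q x * exchange q x ≤
      F.terminals.card * CS ^ 2 * ∑ i, ∫ x in K.B i, (toFlux q).2.1 i x * (toFlux q).2.1 i x := by
  have hInt : ∀ i, IntegrableOn ((K.B i).indicator
      fun x => (toFlux q).2.1 i x * (toFlux q).2.1 i x) Ω := fun i =>
    (integrable_indicator_iff (hK.B_measurable i)).2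
      ((integrableOn_glueOn_mul hΩ hK i (q.2.1 i) (q.2.1 i)).mono_measure
        Measure.restrict_le_self)
  calc ∫ x in Ω, exchange q x * exchange q x
      ≤ ∫ x in Ω, F.terminals.card * CS ^ 2 * ∑ i, (K.B i).indicator
          (fun x => (toFlux q).2.1 i x * (toFlux q).2.1 i x) x := by
        refine integral_mono ((memLp_exchange hΩ hK q).integrable_mul (memLp_exchange hΩ hK q))
          ((integrable_finsetSum _ fun i _ => hInt i).const_mul _) fun x => ?_
        change exchange q x * exchange q x ≤ _
        rw [← sq, exchange]
        refine sq_sum_le_card_mul_sum_sq.trans ?_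
        rw [Finset.card_univ, Fintype.card_coe, mul_assoc, Finset.mul_sum _ _ (CS ^ 2)]
        refine mul_le_mul_of_nonneg_left (Finset.sum_le_sum fun i _ => ?_) (Nat.cast_nonneg _)
        by_cases h : x ∈ K.B i
        · simp only [Set.indicator_of_mem h, mul_pow, toFlux, ← sq (M.glueOn _ _ x)]
          refine mul_le_mul_of_nonneg_right ?_ (sq_nonneg _)
          exact sq_le_sq.2 (hK.abs_kS_le h)
        · simp [h]
    _ = _ := by
        rw [integral_const_mul, integral_finsetSum _ fun i _ => hInt i]
        simp only [integral_indicator_of_subset hK]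

theorem integral_exchange (hΩ : Bornology.IsBounded Ω) (hK : K.Admissible Ω cD cN cS CS)
    (q : DiscreteFlux M K) : ∫ x in Ω, exchange q x =
      ∑ i, ∫ x in K.B i, K.kS i x * M.glueOn (K.B i) (q.2.1 i) x := by
  simp only [exchange]
  rw [integral_finsetSum]
  · simp only [integral_indicator_of_subset hK]
  · exact fun i _ => (integrable_indicator_iff (hK.B_measurable i)).2
      ((integrableOn_kS_mul_glueOn hΩ hK i (q.2.1 i)).mono_measure
        Measure.restrict_le_self)

theorem l2Inner_toPressure (D : M.FacetSystems) (hΩ : Bornology.IsBounded Ω)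
    (hreg : interior (closure Ω) = Ω) (s t : DiscretePressure M F) :
    l2Inner Ω s.toPressure t.toPressure =
      ∑ τ, M.vol τ * (s.1 τ * t.1 τ) + ∑ i, s.2 i * t.2 i := by
  rw [← Mesh.integral_constFn_mul_constFn D hΩ hreg]
  rfl

end DiscreteFlux

end

end MixedDim

/-! ### The flux that realizes the inf-sup condition -/

namespace MixedDim

open MeasureTheory

noncomputable section

variable {V : Type*} [Fintype V] [DecidableEq V] {n : ℕ} {F : RootedForest V} {Ω : Set (E n)}
  {cD cN cS CS : ℝ}

namespace DiscreteFlux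

theorem integral_inner_inv_le {M : Mesh Ω} {K : Coefficients n F} (D : M.FacetSystems)
    (hΩ : Bornology.IsBounded Ω) (hopen : IsOpen Ω) (hreg : interior (closure Ω) = Ω)
    (hcD : 0 < cD) (hK : K.Admissible Ω cD cN cS CS) (q : DiscreteFlux M K) :
    ∫ x in Ω, inner ℝ (Matrix.toEuclideanLin (K.kD x)⁻¹ ((toFlux q).1 x)) ((toFlux q).1 x) ≤
      1 / cD * ∑ τ, ∫ x in (M.cell τ).carrier, ‖q.1.1 τ x‖ ^ 2 := by
  obtain ⟨h1, h2⟩ := Mesh.integral_norm_glue_sq D hΩ hreg q.1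
  rw [← h2, ← integral_const_mul]
  refine setIntegral_mono_on (integrableOn_inner_inv hΩ hopen hcD hK q q) (h1.const_mul _)
    hopen.measurableSet fun x hx => ?_
  exact inner_inv_le hcD (hK.kD_lower x hx) _

open Classical in
theorem sum_edge_le {K : Coefficients n F} (hcN : 0 < cN) (hK : K.Admissible Ω cD cN cS CS)
    (q : V → V → ℝ) :
    ∑ i, ∑ j with F.graph.Adj i j, (K.kN s(i, j))⁻¹ * q i j * q i j ≤
      1 / cN * ∑ i, ∑ j, q i j ^ 2 := by
  rw [Finset.mul_sum]
  refine Finset.sum_le_sum fun i _ => ?_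
  rw [Finset.mul_sum, Finset.sum_filter]
  refine Finset.sum_le_sum fun j _ => ?_
  split_ifs with h
  · rw [mul_assoc, ← sq, one_div]
    exact mul_le_mul_of_nonneg_right (inv_anti₀ hcN (hK.kN_lower _ h)) (sq_nonneg _)
  · positivity

/-- A discrete pressure sees only the cell averages `g` of the exchange. If the RT0 field has
divergence `s^D + g`, the exchange cancels in the pairing and `(s, 𝔇·q) = ‖s‖²`, although `𝔇·q`
itself need not equal `s`. Each component of `q` is bounded by the data it was built from. -/
theorem exists_flux (hn : 0 < n) (hΩ : Bornology.IsBounded Ω) (hopen : IsOpen Ω)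
    (hconn : IsConnected Ω) (hreg : interior (closure Ω) = Ω) (hF : F.dirichlet.Nonempty)
    (σ CS : ℝ) (hcD : 0 < cD) (hcN : 0 < cN) (hcS : 0 < cS) :
    ∃ C > 0, ∀ M : Mesh Ω, M.ShapeRegular σ → ∀ K : Coefficients n F,
      K.Admissible Ω cD cN cS CS → ∀ s : DiscretePressure M F, ∃ q : DiscreteFlux M K,
        l2Inner Ω s.toPressure (divFn q) = l2Inner Ω s.toPressure s.toPressure ∧
        kInner Ω K (toFlux q) (toFlux q) + l2Inner Ω (divFn q) (divFn q) ≤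
          C * l2Inner Ω s.toPressure s.toPressure := by
  classical
  obtain ⟨Cu, hCu, hu⟩ := uniformRightInverse hn hΩ hopen hconn hreg σ
  obtain ⟨Cb, hCb, hb⟩ := F.exists_balance hF
  set v := volume.real Ω with hv
  have hv0 : 0 ≤ v := measureReal_nonneg
  set B := Cb * (1 + v) with hB
  have hB0 : 0 ≤ B := by positivity
  set C1 := v * (B / cS ^ 2) with hC1
  set C2 := F.terminals.card * CS ^ 2 * C1 with hC2
  have hC10 : 0 ≤ C1 := by positivity
  have hC20 : 0 ≤ C2 := by positivity
  -- In this order: the energies of the domain field, of the exchange and of the edge flows, then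
  -- the squared norm of the divergence.
  refine ⟨1 / cD * (Cu * (2 + 2 * C2)) + C1 + 1 / 2 * (1 / cN * B) + (2 * (2 + 2 * C2) + 2 * C2 + 1),
    by positivity, fun M hM K hK s => ?_⟩
  obtain ⟨D⟩ := Mesh.nonempty_facetSystems hn M
  have hvol := fun τ => hM.vol_pos hn hΩ τ
  set A := l2Inner Ω s.toPressure s.toPressure with hA
  have hA' := l2Inner_toPressure D hΩ hreg s s
  rw [← hA] at hA'
  have hs1 : 0 ≤ ∑ τ, M.vol τ * (s.1 τ * s.1 τ) :=
    Finset.sum_nonneg fun τ _ => mul_nonneg (M.vol_nonneg τ) (mul_self_nonneg _)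
  have hs2 : 0 ≤ ∑ i, s.2 i * s.2 i := Finset.sum_nonneg fun i _ => mul_self_nonneg _
  have hA0 : 0 ≤ A := by linarith
  -- The total exchange is set to `-∫ s^D`, which gives `s^D + g` mean zero.
  obtain ⟨qN, t, hbal, hsum, hqN, ht⟩ := hb s.2 (-∑ τ, M.vol τ * s.1 τ)
  have hm : (∑ i, s.2 i ^ 2) + (-∑ τ, M.vol τ * s.1 τ) ^ 2 ≤ (1 + v) * A := by
    have h1 := Mesh.sum_vol_mul_sq_le D hΩ hreg s.1
    have h2 : ∑ i, s.2 i ^ 2 = ∑ i, s.2 i * s.2 i := Finset.sum_congr rfl fun i _ => sq _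
    rw [neg_sq, h2, hA']
    nlinarith
  have hmB : Cb * ((∑ i, s.2 i ^ 2) + (-∑ τ, M.vol τ * s.1 τ) ^ 2) ≤ B * A := by
    rw [hB, mul_assoc]
    exact mul_le_mul_of_nonneg_left hm hCb.le
  replace hqN := hqN.trans hmB
  replace ht := ht.trans hmB
  -- The constant on `B i` whose weighted integral is the rate `t i`; the lower bound `cS` on the
  -- denominator makes it stable.
  set c : F.terminals → ℝ := fun i => t i / ∫ x in K.B i, K.kS i x with hc
  have hκ : ∀ i, 0 < ∫ x in K.B i, K.kS i x := fun i => hcS.trans_le (hK.kS_integral i)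
  have hcs : ∑ i, c i ^ 2 ≤ B / cS ^ 2 * A := by
    calc ∑ i, c i ^ 2 ≤ ∑ i, t i ^ 2 / cS ^ 2 := by
          refine Finset.sum_le_sum fun i _ => ?_
          rw [hc, div_pow]
          have := hK.kS_integral i
          gcongr
      _ = (∑ i, t i ^ 2) / cS ^ 2 := by rw [Finset.sum_div]
      _ ≤ (B * A) / cS ^ 2 := by gcongr
      _ = _ := by ring
  -- the flux without its domain component; the exchange does not see that component
  let q₀ : DiscreteFlux M K := (0, fun i _ => c i, qN)
  have hgl : ∀ i, ∀ᵐ x ∂volume, x ∈ K.B i → M.glueOn (K.B i) (q₀.2.1 i) x = c i := fun i =>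
    Mesh.glueOn_const_ae D (hK.B_subset i) (c i)
  have hI1 : ∀ i, ∫ x in K.B i, K.kS i x * M.glueOn (K.B i) (q₀.2.1 i) x = t i := by
    intro i
    have h1 : ∫ x in K.B i, K.kS i x * M.glueOn (K.B i) (q₀.2.1 i) x =
        ∫ x in K.B i, K.kS i x * c i := by
      refine setIntegral_congr_ae (hK.B_measurable i) ?_
      filter_upwards [hgl i] with x hx hxB
      rw [hx hxB]
    rw [h1, integral_mul_const, hc]
    exact mul_div_cancel₀ _ (hκ i).ne'
  have hI2 : ∑ i, ∫ x in K.B i, M.glueOn (K.B i) (q₀.2.1 i) x * M.glueOn (K.B i) (q₀.2.1 i) x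
      ≤ C1 * A := by
    calc _ ≤ ∑ i, v * c i ^ 2 := by
          refine Finset.sum_le_sum fun i _ => ?_
          have h1 : ∫ x in K.B i, M.glueOn (K.B i) (q₀.2.1 i) x * M.glueOn (K.B i) (q₀.2.1 i) x =
              ∫ x in K.B i, c i ^ 2 := by
            refine setIntegral_congr_ae (hK.B_measurable i) ?_
            filter_upwards [hgl i] with x hx hxB
            rw [hx hxB, sq]
          rw [h1, setIntegral_const, smul_eq_mul]
          exact mul_le_mul_of_nonneg_right
            (measureReal_mono (hK.B_subset i) hΩ.measure_lt_top.ne) (sq_nonneg _)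
      _ = v * ∑ i, c i ^ 2 := by rw [Finset.mul_sum]
      _ ≤ v * (B / cS ^ 2 * A) := mul_le_mul_of_nonneg_left hcs hv0
      _ = _ := by rw [hC1]; ring
  have hSm := memLp_exchange hΩ hK q₀
  have := isFiniteMeasure_restrict_of_isBounded hΩ
  have hSi : IntegrableOn (exchange q₀) Ω := hSm.integrable (by norm_num)
  have hS2 : ∫ x in Ω, exchange q₀ x * exchange q₀ x ≤ C2 * A := by
    refine (integral_exchange_sq_le hΩ hK q₀).trans ?_
    rw [hC2, mul_assoc _ C1]
    exact mul_le_mul_of_nonneg_left hI2 (by positivity)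
  set g := M.average (exchange q₀) with hg
  have hg2 : ∑ τ, M.vol τ * (g τ * g τ) ≤ C2 * A :=
    (Mesh.sum_vol_mul_average_sq_le D hΩ hreg hvol hSm).trans hS2
  -- Compatibility: the cell averages of the exchange integrate to `∑ t i`, the negative of the
  -- integral of `s^D`.
  obtain ⟨qD, hqD, hdiv, hnorm⟩ := hu M hM (s.1 + g) (by
    have h1 := Mesh.sum_vol_mul_average D hreg hvol hSi
    rw [integral_exchange hΩ hK, Finset.sum_congr rfl fun i _ => hI1 i, hsum] at h1
    simp only [Pi.add_apply, mul_add, Finset.sum_add_distrib, hg, h1, add_neg_cancel])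
  have hf2 : ∑ τ, M.vol τ * ((s.1 + g) τ * (s.1 + g) τ) ≤ (2 + 2 * C2) * A := by
    calc _ ≤ ∑ τ, (2 * (M.vol τ * (s.1 τ * s.1 τ)) + 2 * (M.vol τ * (g τ * g τ))) := by
          refine Finset.sum_le_sum fun τ _ => ?_
          simp only [Pi.add_apply]
          nlinarith [mul_nonneg (M.vol_nonneg τ) (sq_nonneg (s.1 τ - g τ))]
      _ ≤ _ := by
          rw [Finset.sum_add_distrib, ← Finset.mul_sum, ← Finset.mul_sum]
          nlinarith
  have hf2' : ∑ τ, M.vol τ * (s.1 + g) τ ^ 2 ≤ (2 + 2 * C2) * A := by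
    simpa only [sq] using hf2
  let q : DiscreteFlux M K := (⟨qD, hqD⟩, fun i _ => c i, qN)
  have hcd : Mesh.cellDiv q.1 = s.1 + g := funext fun τ => hdiv τ 0
  have hfst : (divFn q).1 = fun x => M.constFn (s.1 + g) x - exchange q₀ x := by
    ext1 x
    change M.constFn (Mesh.cellDiv q.1) x - exchange q₀ x = _
    rw [hcd]
  have hsnd : (divFn q).2 = s.2 := by
    ext1 i
    rw [← hbal i]
    change (if h : i.1 ∈ F.terminals then ∫ x in K.B ⟨i.1, h⟩, K.kS ⟨i.1, h⟩ x *
      M.glueOn (K.B ⟨i.1, h⟩) (q₀.2.1 ⟨i.1, h⟩) x else 0) - _ = _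
    simp only [hI1]
    rfl
  have hcm := memLp_constFn (M := M) hΩ (s.1 + g)
  refine ⟨q, ?_, ?_⟩
  · have h1 : ∫ x in Ω, M.constFn s.1 x * (M.constFn (s.1 + g) x - exchange q₀ x) =
        (∫ x in Ω, M.constFn s.1 x * M.constFn (s.1 + g) x) -
          ∫ x in Ω, M.constFn s.1 x * exchange q₀ x := by
      simp only [mul_sub]
      exact integral_sub ((memLp_constFn hΩ s.1).integrable_mul hcm)
        ((memLp_constFn hΩ s.1).integrable_mul hSm)
    rw [Mesh.integral_constFn_mul_constFn D hΩ hreg,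
      Mesh.integral_constFn_mul_eq_average D hreg hvol _ hSi] at h1
    rw [l2Inner, hfst, hsnd]
    change (∫ x in Ω, M.constFn s.1 x * (M.constFn (s.1 + g) x - exchange q₀ x)) +
      ∑ i, s.2 i * s.2 i = A
    rw [h1, hA', ← Finset.sum_sub_distrib]
    congr 1
    refine Finset.sum_congr rfl fun τ _ => ?_
    simp only [Pi.add_apply, hg]
    ring
  · have h1 : kInner Ω K (toFlux q) (toFlux q) ≤
        1 / cD * (Cu * ((2 + 2 * C2) * A)) + C1 * A + 1 / 2 * (1 / cN * (B * A)) := by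
      refine add_le_add (add_le_add ?_ ?_) ?_
      · refine (integral_inner_inv_le D hΩ hopen hreg hcD hK q).trans ?_
        refine mul_le_mul_of_nonneg_left (hnorm.trans ?_) (by positivity)
        exact mul_le_mul_of_nonneg_left hf2' hCu.le
      · exact hI2
      · refine mul_le_mul_of_nonneg_left ((sum_edge_le hcN hK _).trans ?_) (by norm_num)
        exact mul_le_mul_of_nonneg_left hqN (by positivity)
    have h2 : l2Inner Ω (divFn q) (divFn q) ≤ 2 * ((2 + 2 * C2) * A) + 2 * (C2 * A) + A := by
      rw [l2Inner, hfst, hsnd]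
      have h3 := Mesh.integral_sub_sq_le hcm hSm
      rw [Mesh.integral_constFn_mul_constFn D hΩ hreg] at h3
      simp only at h3 ⊢
      linarith
    calc _ ≤ _ := add_le_add h1 h2
      _ = _ := by ring

end DiscreteFlux

end

end MixedDim

/-! ### Inf-sup condition, unique solvability and stability -/

namespace MixedDim

open MeasureTheory

noncomputable section

variable {V : Type*} [Fintype V] [DecidableEq V] {n : ℕ} {F : RootedForest V} {Ω : Set (E n)}
  {M : Mesh Ω} {K : Coefficients n F} {cD cN cS CS : ℝ}

namespace DiscretePressure

theorem toPressure_add (s t : DiscretePressure M F) :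
    toPressure (s + t) = toPressure s + toPressure t :=
  Prod.ext (funext fun x => Mesh.constFn_add s.1 t.1 x) rfl

theorem toPressure_smul (c : ℝ) (s : DiscretePressure M F) :
    toPressure (c • s) = c • toPressure s :=
  Prod.ext (funext fun x => Mesh.constFn_smul c s.1 x) rfl

theorem memLp_toPressure (hΩ : Bornology.IsBounded Ω) (s : DiscretePressure M F) :
    MemLp s.toPressure.1 2 (volume.restrict Ω) := DiscreteFlux.memLp_constFn hΩ s.1

theorem eq_zero_of_l2Inner_self (D : M.FacetSystems) (hΩ : Bornology.IsBounded Ω)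
    (hreg : interior (closure Ω) = Ω) (hvol : ∀ τ, 0 < M.vol τ) {s : DiscretePressure M F}
    (h : l2Inner Ω s.toPressure s.toPressure = 0) : s = 0 := by
  rw [DiscreteFlux.l2Inner_toPressure D hΩ hreg] at h
  have h1 : ∀ τ ∈ Finset.univ, 0 ≤ M.vol τ * (s.1 τ * s.1 τ) := fun τ _ =>
    mul_nonneg (M.vol_nonneg τ) (mul_self_nonneg _)
  have h2 : ∀ i ∈ Finset.univ, 0 ≤ s.2 i * s.2 i := fun i _ => mul_self_nonneg _
  have h3 := Finset.sum_nonneg h1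
  have h4 := Finset.sum_nonneg h2
  have e1 := (Finset.sum_eq_zero_iff_of_nonneg h1).1 (by linarith)
  have e2 := (Finset.sum_eq_zero_iff_of_nonneg h2).1 (by linarith)
  refine Prod.ext (funext fun τ => ?_) (funext fun i => ?_)
  · have := e1 τ (Finset.mem_univ _)
    simpa [(hvol τ).ne'] using this
  · have := e2 i (Finset.mem_univ _)
    simpa using this

/-- `w ↦ (r, w)` as a linear form on the discrete pressures. -/
def l2Form (hΩ : Bornology.IsBounded Ω) {r : Pressure n F}
    (hr : MemLp r.1 2 (volume.restrict Ω)) : DiscretePressure M F →ₗ[ℝ] ℝ where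
  toFun w := l2Inner Ω r w.toPressure
  map_add' s t := by
    rw [toPressure_add, l2Inner_add_right (memLp_toPressure hΩ s) (memLp_toPressure hΩ t) hr]
  map_smul' c s := by
    rw [toPressure_smul, l2Inner_smul_right]
    rfl

end DiscretePressure

namespace DiscreteFlux

/-- `(q, w) ↦ (𝔇 · q, w)` as a bilinear form on the discrete spaces. -/
def divForm (hΩ : Bornology.IsBounded Ω) (hK : K.Admissible Ω cD cN cS CS) :
    DiscreteFlux M K →ₗ[ℝ] DiscretePressure M F →ₗ[ℝ] ℝ where
  toFun q := DiscretePressure.l2Form hΩ (memLp_divFn hΩ hK q)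
  map_add' q v := LinearMap.ext fun w => by
    have := DiscretePressure.memLp_toPressure hΩ w
    simp only [DiscretePressure.l2Form, LinearMap.coe_mk, AddHom.coe_mk, LinearMap.add_apply]
    rw [divFn_add hΩ hK, l2Inner_add_left (memLp_divFn hΩ hK q) (memLp_divFn hΩ hK v) this]
  map_smul' c q := LinearMap.ext fun w => by
    simp only [DiscretePressure.l2Form, LinearMap.coe_mk, AddHom.coe_mk, LinearMap.smul_apply,
      divFn_smul, l2Inner_smul_left, smul_eq_mul, RingHom.id_apply]

theorem hdivNorm_sq (hopen : IsOpen Ω) (hcD : 0 < cD) (hcN : 0 < cN)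
    (hK : K.Admissible Ω cD cN cS CS) (D : M.FacetSystems) (q : DiscreteFlux M K) :
    hdivNorm Ω K (toFlux q) ^ 2 =
      kInner Ω K (toFlux q) (toFlux q) + l2Inner Ω (divFn q) (divFn q) := by
  have := kInner_self_nonneg hopen hcD hcN hK (toFlux q)
  rw [hdivNorm, Real.sq_sqrt (by positivity), l2Norm_mdDiv D hopen, l2Norm_sq]

theorem hdivNorm_nonneg (q : Flux n F) : 0 ≤ hdivNorm Ω K q := Real.sqrt_nonneg _

theorem l2Norm_divFn_le (hopen : IsOpen Ω) (hcD : 0 < cD) (hcN : 0 < cN)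
    (hK : K.Admissible Ω cD cN cS CS) (D : M.FacetSystems) (q : DiscreteFlux M K) :
    l2Norm Ω (divFn q) ≤ hdivNorm Ω K (toFlux q) := by
  refine Real.sqrt_le_sqrt ?_
  rw [l2Norm_mdDiv D hopen, l2Norm_sq]
  exact le_add_of_nonneg_left (kInner_self_nonneg hopen hcD hcN hK _)

/-- For the given flux the numerator is `‖s‖²` and the denominator at most `√C ‖s‖`, whence `1 /
√C`. The real supremum is meaningful only for quotients bounded above, which Cauchy-Schwarz
provides; the zero flux contributes `0 / 0 = 0`. -/
theorem infSup_of_exists_flux (hΩ : Bornology.IsBounded Ω) (hopen : IsOpen Ω) (hcD : 0 < cD)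
    (hcN : 0 < cN) (hK : K.Admissible Ω cD cN cS CS) (D : M.FacetSystems) {C : ℝ} (hC : 0 < C)
    {s : DiscretePressure M F} {q : DiscreteFlux M K}
    (h1 : l2Inner Ω s.toPressure (divFn q) = l2Inner Ω s.toPressure s.toPressure)
    (h2 : kInner Ω K (toFlux q) (toFlux q) + l2Inner Ω (divFn q) (divFn q) ≤
      C * l2Inner Ω s.toPressure s.toPressure) :
    1 / √C * l2Norm Ω s.toPressure ≤ ⨆ q : DiscreteFlux M K,
      l2Inner Ω s.toPressure (mdDiv K (toFlux q)) / hdivNorm Ω K (toFlux q) := by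
  have hle : ∀ q : DiscreteFlux M K, l2Inner Ω s.toPressure (divFn q) ≤
      l2Norm Ω s.toPressure * hdivNorm Ω K (toFlux q) := fun q =>
    (le_abs_self _).trans <| (abs_l2Inner_le (DiscretePressure.memLp_toPressure hΩ s)
      (memLp_divFn hΩ hK q)).trans <| mul_le_mul_of_nonneg_left
        (l2Norm_divFn_le hopen hcD hcN hK D q) (l2Norm_nonneg _)
  have hbdd : BddAbove (Set.range fun q : DiscreteFlux M K =>
      l2Inner Ω s.toPressure (mdDiv K (toFlux q)) / hdivNorm Ω K (toFlux q)) := by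
    refine ⟨l2Norm Ω s.toPressure, ?_⟩
    rintro _ ⟨q, rfl⟩
    refine div_le_of_le_mul₀ (hdivNorm_nonneg _) (l2Norm_nonneg _) ?_
    rw [l2Inner_mdDiv_right D hopen]
    exact hle q
  refine le_trans ?_ (le_ciSup hbdd q)
  rw [l2Inner_mdDiv_right D hopen, h1]
  have h3 := hle q
  rw [← hdivNorm_sq hopen hcD hcN hK D] at h2
  rw [h1] at h3
  rw [← l2Norm_sq] at h2 h3 ⊢
  have hN := l2Norm_nonneg (Ω := Ω) s.toPressure
  have hh := hdivNorm_nonneg (Ω := Ω) (K := K) (toFlux q)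
  set N := l2Norm Ω s.toPressure
  set H := hdivNorm Ω K (toFlux q)
  rcases hN.eq_or_lt with h | h
  · rw [← h]; simp
  · have hH : 0 < H := by nlinarith
    have hC' : 0 < √C := Real.sqrt_pos.2 hC
    have h4 : H ≤ √C * N := by
      refine abs_le_of_sq_le_sq' ?_ (by positivity) |>.2
      rwa [mul_pow, Real.sq_sqrt hC.le]
    rw [le_div_iff₀ hH]
    calc 1 / √C * N * H ≤ 1 / √C * N * (√C * N) := by gcongr
      _ = N ^ 2 := by field_simp

theorem isDiscreteSolution_iff (D : M.FacetSystems) (hopen : IsOpen Ω) {r : Pressure n F}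
    {q : DiscreteFlux M K} {p : DiscretePressure M F} :
    IsDiscreteSolution M K r q p ↔
      (∀ v : DiscreteFlux M K,
        kInner Ω K (toFlux q) (toFlux v) - l2Inner Ω (divFn v) p.toPressure = 0) ∧
      ∀ w : DiscretePressure M F, l2Inner Ω (divFn q) w.toPressure = l2Inner Ω r w.toPressure := by
  simp only [IsDiscreteSolution, l2Inner_mdDiv_right D hopen, l2Inner_mdDiv_left D hopen, neg_inj,
    l2Inner_comm p.toPressure]

theorem existsUnique_discreteSolution (D : M.FacetSystems) (hΩ : Bornology.IsBounded Ω)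
    (hopen : IsOpen Ω) (hreg : interior (closure Ω) = Ω) (hvol : ∀ τ, 0 < M.vol τ)
    (hcD : 0 < cD) (hcN : 0 < cN) (hK : K.Admissible Ω cD cN cS CS)
    (hs : ∀ s : DiscretePressure M F, ∃ q : DiscreteFlux M K,
      l2Inner Ω s.toPressure (divFn q) = l2Inner Ω s.toPressure s.toPressure)
    {r : Pressure n F} (hr : MemLp r.1 2 (volume.restrict Ω)) :
    ∃! u : DiscreteFlux M K × DiscretePressure M F, IsDiscreteSolution M K r u.1 u.2 := by
  simp only [isDiscreteSolution_iff D hopen]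
  refine existsUnique_saddlePoint (kForm hΩ hopen hcD hK) (divForm hΩ hK)
    (eq_zero_of_kInner_self D hΩ hopen hreg hvol hcD hcN hK) (fun p hp => ?_)
    (DiscretePressure.l2Form hΩ hr)
  obtain ⟨q, hq⟩ := hs p
  refine DiscretePressure.eq_zero_of_l2Inner_self D hΩ hreg hvol ?_
  rw [← hq, l2Inner_comm]
  exact hp q

/-- Let `α` be the energy of `q`. Testing with the inf-sup flux of `p` gives `‖p‖² ≤ C α`, and
testing with `q` itself gives `α = (r, p) ≤ ‖r‖ ‖p‖`; together `‖p‖ ≤ C ‖r‖` and `α ≤ C ‖r‖²`. The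
three summands of the constant belong to the energy, the divergence and the pressure. -/
theorem stability (D : M.FacetSystems) (hΩ : Bornology.IsBounded Ω)
    (hopen : IsOpen Ω) (hcD : 0 < cD) (hcN : 0 < cN) (hK : K.Admissible Ω cD cN cS CS)
    {C : ℝ} (hC : 0 < C)
    (hs : ∀ s : DiscretePressure M F, ∃ q : DiscreteFlux M K,
      l2Inner Ω s.toPressure (divFn q) = l2Inner Ω s.toPressure s.toPressure ∧
      kInner Ω K (toFlux q) (toFlux q) + l2Inner Ω (divFn q) (divFn q) ≤
        C * l2Inner Ω s.toPressure s.toPressure)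
    {r : Pressure n F} (hr : MemLp r.1 2 (volume.restrict Ω)) {q : DiscreteFlux M K}
    {p : DiscretePressure M F} (hqp : IsDiscreteSolution M K r q p) :
    hdivNorm Ω K (toFlux q) + l2Norm Ω p.toPressure ≤
      (√C + 2 * (1 + √(F.terminals.card * CS ^ 2 * C)) + C) * l2Norm Ω r := by
  obtain ⟨h1, h2⟩ := (isDiscreteSolution_iff D hopen).1 hqp
  have hα := kInner_self_nonneg hopen hcD hcN hK (toFlux q)
  have hpm := DiscretePressure.memLp_toPressure hΩ p
  have hR := l2Norm_nonneg (Ω := Ω) r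
  have hN := l2Norm_nonneg (Ω := Ω) p.toPressure
  have hαN : kInner Ω K (toFlux q) (toFlux q) ≤ l2Norm Ω r * l2Norm Ω p.toPressure := by
    have := h1 q
    rw [h2 p] at this
    have h3 := (le_abs_self _).trans (abs_l2Inner_le hr hpm)
    linarith
  have hsq := hdivNorm_sq hopen hcD hcN hK D q
  have hH := hdivNorm_nonneg (Ω := Ω) (K := K) (toFlux q)
  have hNα : l2Norm Ω p.toPressure ^ 2 ≤ C * kInner Ω K (toFlux q) (toFlux q) := by
    obtain ⟨v, hv1, hv2⟩ := hs p
    have h3 := h1 v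
    rw [l2Inner_comm, hv1, ← l2Norm_sq] at h3
    have h4 := kInner_sq_le hΩ hopen hcD hcN hK q v
    rw [show kInner Ω K (toFlux q) (toFlux v) = l2Norm Ω p.toPressure ^ 2 by linarith] at h4
    rw [← l2Norm_sq p.toPressure] at hv2
    have h5 : kInner Ω K (toFlux v) (toFlux v) ≤ C * l2Norm Ω p.toPressure ^ 2 := by
      have := l2Inner_self_nonneg (Ω := Ω) (divFn v)
      linarith
    have h6 := h4.trans (mul_le_mul_of_nonneg_left h5 hα)
    rcases (sq_nonneg (l2Norm Ω p.toPressure)).eq_or_lt with h | h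
    · rw [← h]; positivity
    · refine le_of_mul_le_mul_right ?_ h
      linarith
  let S : Pressure n F := (exchange q, 0)
  have hSm : MemLp S.1 2 (volume.restrict Ω) := memLp_exchange hΩ hK q
  have hU := memLp_divFn hΩ hK q
  -- The divergence with its exchange term added back is cellwise constant and hence an admissible
  -- test function.
  let w : DiscretePressure M F := (Mesh.cellDiv q.1, (divFn q).2)
  have hw : w.toPressure = divFn q + S := by
    refine Prod.ext (funext fun x => ?_) (funext fun i => ?_)
    · exact (sub_add_cancel (M.constFn (Mesh.cellDiv q.1) x) (exchange q x)).symm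
    · exact (add_zero _).symm
  have hSα : l2Norm Ω S ^ 2 ≤ F.terminals.card * CS ^ 2 * kInner Ω K (toFlux q) (toFlux q) := by
    have h3 := (integral_exchange_sq_le hΩ hK q).trans (mul_le_mul_of_nonneg_left
      (integral_sq_le_kInner hopen hcD hcN hK (toFlux q)) (by positivity))
    rw [l2Norm_sq]
    simpa [l2Inner, S] using h3
  have hUle : l2Norm Ω (divFn q) ^ 2 ≤ l2Norm Ω r * l2Norm Ω (divFn q) + l2Norm Ω r * l2Norm Ω S +
      l2Norm Ω (divFn q) * l2Norm Ω S := by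
    have h3 := h2 w
    rw [hw, l2Inner_add_right hU hSm hU, l2Inner_add_right hU hSm hr, ← l2Norm_sq] at h3
    have h4 := (le_abs_self _).trans (abs_l2Inner_le hr hU)
    have h5 := (le_abs_self _).trans (abs_l2Inner_le hr hSm)
    have h6 := (neg_le_abs _).trans (abs_l2Inner_le hU hSm)
    linarith
  have hU0 := l2Norm_nonneg (Ω := Ω) (divFn q)
  have hS0 := l2Norm_nonneg (Ω := Ω) S
  rw [← l2Norm_sq] at hsq
  set α := kInner Ω K (toFlux q) (toFlux q)
  set N := l2Norm Ω p.toPressure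
  set R := l2Norm Ω r
  set X := l2Norm Ω (divFn q)
  set Y := l2Norm Ω S
  set H := hdivNorm Ω K (toFlux q)
  have hNR : N ≤ C * R := by
    rcases hN.eq_or_lt with h | h
    · rw [← h]; positivity
    · refine le_of_mul_le_mul_right ?_ h
      nlinarith
  have hαR : α ≤ C * R ^ 2 := by nlinarith
  have hsα : √α ≤ √C * R := by
    refine Real.sqrt_le_iff.2 ⟨by positivity, ?_⟩
    rwa [mul_pow, Real.sq_sqrt hC.le]
  have hYR : Y ≤ √(F.terminals.card * CS ^ 2 * C) * R := by
    refine (abs_le_of_sq_le_sq' ?_ (by positivity)).2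
    rw [mul_pow, Real.sq_sqrt (by positivity), mul_assoc _ C]
    exact hSα.trans (mul_le_mul_of_nonneg_left hαR (by positivity))
  -- From `X² ≤ R X + R Y + X Y`: if `X > 2 (R + Y)`, half of `X²` exceeds `(R + Y) X` and the other
  -- half exceeds `R Y`.
  have hX : X ≤ 2 * (R + Y) := by
    by_contra! h
    nlinarith
  have hHle : H ≤ √α + X := by
    refine (abs_le_of_sq_le_sq' ?_ (by positivity)).2
    rw [hsq, add_sq, Real.sq_sqrt hα]
    nlinarith [mul_nonneg (Real.sqrt_nonneg α) hU0]
  nlinarith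

end DiscreteFlux

end

end MixedDim

/-! ### The theorem -/

theorem theorem3p4 {n : ℕ} (hn : 0 < n) (Ω : Set (MixedDim.E n)) (hΩ_open : IsOpen Ω)
    (hΩ_conn : IsConnected Ω) (hΩ_bdd : Bornology.IsBounded Ω) (hΩ_reg : interior (closure Ω) = Ω)
    {V : Type*} [Fintype V] [DecidableEq V] (F : MixedDim.RootedForest V)
    (hF : F.dirichlet.Nonempty)
    (σ cD cN cS CS : ℝ) (hcD : 0 < cD) (hcN : 0 < cN) (hcS : 0 < cS) :
    ∃ β > 0, ∃ C > 0, ∀ (M : MixedDim.Mesh Ω), M.ShapeRegular σ →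
      ∀ (K : MixedDim.Coefficients n F), K.Admissible Ω cD cN cS CS →
        (∀ s : MixedDim.DiscretePressure M F,
          β * MixedDim.l2Norm Ω (MixedDim.DiscretePressure.toPressure s) ≤
            ⨆ q : MixedDim.DiscreteFlux M K,
              MixedDim.l2Inner Ω (MixedDim.DiscretePressure.toPressure s)
                  (MixedDim.mdDiv K (MixedDim.DiscreteFlux.toFlux q)) /
                MixedDim.hdivNorm Ω K (MixedDim.DiscreteFlux.toFlux q)) ∧
        ∀ r : MixedDim.Pressure n F,
          MeasureTheory.MemLp r.1 2 (MeasureTheory.volume.restrict Ω) →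
            (∃! u : MixedDim.DiscreteFlux M K × MixedDim.DiscretePressure M F,
              MixedDim.IsDiscreteSolution M K r u.1 u.2) ∧
            ∀ (q : MixedDim.DiscreteFlux M K) (p : MixedDim.DiscretePressure M F),
              MixedDim.IsDiscreteSolution M K r q p →
                MixedDim.hdivNorm Ω K (MixedDim.DiscreteFlux.toFlux q) +
                    MixedDim.l2Norm Ω (MixedDim.DiscretePressure.toPressure p) ≤
                  C * MixedDim.l2Norm Ω r := by
  obtain ⟨C, hC, h⟩ := MixedDim.DiscreteFlux.exists_flux hn hΩ_bdd hΩ_open hΩ_conn hΩ_reg hF σ CS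
    hcD hcN hcS
  refine ⟨1 / √C, by positivity, √C + 2 * (1 + √(F.terminals.card * CS ^ 2 * C)) + C,
    by positivity, fun M hM K hK => ?_⟩
  obtain ⟨D⟩ := MixedDim.Mesh.nonempty_facetSystems hn M
  have hvol := fun τ => hM.vol_pos hn hΩ_bdd τ
  have hs := h M hM K hK
  refine ⟨fun s => ?_, fun r hr => ⟨?_, fun q p hqp => ?_⟩⟩
  · obtain ⟨q, h1, h2⟩ := hs s
    exact MixedDim.DiscreteFlux.infSup_of_exists_flux hΩ_bdd hΩ_open hcD hcN hK D hC h1 h2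
  · exact MixedDim.DiscreteFlux.existsUnique_discreteSolution D hΩ_bdd hΩ_open hΩ_reg hvol hcD hcN
      hK (fun s => (hs s).imp fun q hq => hq.1) hr
  · exact MixedDim.DiscreteFlux.stability D hΩ_bdd hΩ_open hcD hcN hK hC hs hr hqp
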